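/- **Setting.** Let $L\subset J^1(\mathbb R^2)$ be the Legendrian sphere whose front has exactly one upward and one downward swallowtail point and the following compatible polygonal decomposition of its base projection, a disk. The $0$-cells are $A_1,A_2$ (left and right; the projections of the upward and of the downward swallowtail point) and the top and bottom points $t,b$ where the projections of the two cusp edges intersect. The $1$-cells are $B_1$ from $b$ to $A_1$, $B_2$ from $t$ to $A_1$, $B_3$ from $A_2$ to $b$, $B_4$ from $A_2$ to $t$, the crossing arc $B_5$ from $A_1$ to $A_2$, and a left and a right outer arc from $t$ to $b$. One cusp edge lies above $B_1$, $B_2$ and the right outer arc, the other above $B_3$, $B_4$ and the left outer arc. The $2$-cells are $C_1$ (bounded by $B_1,B_2$ and the left outer arc), $C_2$ (bounded by $B_3,B_4$ and the right outer arc), $C_3$ (bounded by $B_2,B_5,B_4$, above $B_5$) and $C_4$ (bounded by $B_1,B_5,B_3$, below $B_5$). There are two sheets above $C_1$ and $C_2$ and four above $C_3$ and $C_4$; number the sheets above a cell by decreasing $z$-coordinate. Above $C_3$, sheets $1,2$ meet in the cusp edge above $B_2$ and sheets $3,4$ in the one above $B_4$; above $C_4$, sheets $1,2$ meet in the cusp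 edge above $B_1$ and sheets $3,4$ in the one above $B_3$; sheets $2,3$ cross above $B_5$; the upward swallowtail involves sheets $1,2,3$ and the downward one sheets $2,3,4$. The Maslov number of $L$ is $0$, so gradings are by $\mathbb Z$. **The cellular DGA** $(\mathcal A,\partial)$ of $L$ (with $\mathbb Z/2$ coefficients) is the free unital associative algebra with one generator for each cell and each pair of sheets above it (cusp edges do not count as sheets, a swallowtail point does) of which the first lies strictly above the second. In terms of a Maslov potential $\mu$ (whose value at a swallowtail point is that of the sheet outside the swallowtail region that ends there), the degree of the generator of the sheets $p,q$ is $\mu(p)-\mu(q)+d-1$ for a cell of dimension $d$. Here this gives $25$ generators: $a^1,a^2$ for $A_1,A_2$; $b^1,\dots,b^4$ for $B_1,\dots,B_4$; $b^5_{12},b^5_{13},b^5_{14},b^5_{24},b^5_{34}$ for $B_5$, with the numbering of sheets above $C_4$; $c^1,c^2$ for $C_1,C_2$; and $c^3_{ij},c^4_{ij}$ with $1\le i<j\le 4$ for $C_3,C_4$. The differential is defined by the general rules for the cellular DGA, for any labelling by $S$ and $T$ of the two sides of $B_5$ at each of $A_1$ and $A_2$, and any choice, for each $2$-cell, of initial and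 terminal vertices $v_0,v_1$ of its polygon $Q$ (and of a direction around $Q$ if $v_0=v_1$), where $Q$ is the boundary polygon of the $2$-cell with one additional edge that cuts off each corner labelled $S$ or $T$. Explicitly, $$\partial a^i=0,\quad \partial b^1=\partial b^2=a^1+1,\quad \partial b^3=\partial b^4=a^2+1,\quad \partial c^1=b^1+b^2,\quad \partial c^2=b^3+b^4,$$ $$\partial B_5=\widehat A_2(I+B_5)+(I+B_5)\widehat A_1,\quad \widehat A_1=E_{12}+E_{13}+a^1(E_{24}+E_{34}),\quad \widehat A_2=a^2(E_{12}+E_{13})+E_{24}+E_{34},$$ and, for $C=C_3$ or $C=C_4$, $$\partial C=A_{v_1}C+CA_{v_0}+P_++P_-,$$ where $P_+$ and $P_-$ are the products, along the counter-clockwise and the clockwise path from $v_0$ to $v_1$ and with later factors on the left, of the matrices (or their inverses, if the edge is passed against its orientation) of the edges of $Q$. For $C_3$ the successive edges of $Q$, counter-clockwise from $t$, have the matrices $I+b^2E_{34}$, $I+E_{23}$, $I+ PB_5P$, $I+E_{23}$, $I+b^4E_{12}$, with $P$ the permutation matrix of $(2\,3)$. For $C_4$ they are, clockwise from $b$, $I+b^1E_{34}$,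 $I+E_{23}$, $I+B_5$, $I+E_{23}$, $I+b^3E_{12}$. (The inverses of the matrices $I+E_{23}$ are the matrices themselves; the other edges pass along their orientation in the stated direction.) The matrices of the vertices of $Q$ met in the same order, starting and ending with $t$, respectively $b$, are $E_{12}+E_{34}$, $E_{12}+a^1E_{34}$, $\widehat A_1$, $\widehat A_2$, $a^2E_{12}+E_{34}$, $E_{12}+E_{34}$. A *tame isomorphism* of based DGAs is an isomorphism of DGAs that is a composition of elementary automorphisms (graded algebra maps that fix all generators but one, $q$, and send $q$ to $q+v$ with $v$ in the subalgebra generated by the other generators) followed by an isomorphism induced by a bijection of the generating sets. A *stabilization* adds two generators $e,f$ with $|e|=i$, $|f|=i-1$, $\partial e=f$, $\partial f=0$. Two based DGAs are *stable tame isomorphic* if they become tame isomorphic after finitely many stabilizations of each. **Proposition.** For every Maslov potential and all of the choices above, the cellular DGA of $L$, with its $25$ generators, is a $\mathbb Z$-graded DGA (that is, $\partial^2=0$ and $\partial$ has degree $-1$), and it is stable tame isomorphic to the DGA with a single generator $x$, $|x|=2$ and $\partial x=0$. -/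

import Mathlib

open scoped BigOperators

namespace LegendrianDGA

/-! ### Based differential graded algebras over `ZMod 2` and stable tame isomorphism -/

/-- The data of a based differential algebra over `ZMod 2`: the free unital associative algebra on a
finite set `Gen`, degrees of the generators in `ℤ/m` (so in `ℤ` if `m = 0`), and the values of the
differential on the generators.  The differential itself is `BasedAlg.diff`; that it has degree `-1`
and squares to zero is the predicate `BasedAlg.IsDGA`. -/
structure BasedAlg (m : ℕ) where
  Gen : Type
  finite_gen : Finite Gen
  deg : Gen → ZMod m
  dGen : Gen → FreeAlgebra (ZMod 2) Gen

namespace BasedAlg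

variable {m : ℕ}

/-- The underlying free non-commutative algebra. -/
abbrev Alg (A : BasedAlg m) : Type := FreeAlgebra (ZMod 2) A.Gen

/-- A generator, as an element of the algebra. -/
def gen (A : BasedAlg m) (x : A.Gen) : A.Alg := FreeAlgebra.ι (ZMod 2) x

/-- The algebra map `a ↦ (a, ∂ a)` into the square-zero extension of the algebra by itself. -/
noncomputable def diffHom (A : BasedAlg m) : A.Alg →ₐ[ZMod 2] TrivSqZeroExt A.Alg A.Alg :=
  FreeAlgebra.lift (ZMod 2) fun x => TrivSqZeroExt.inl (A.gen x) + TrivSqZeroExt.inr (A.dGen x)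

/-- The differential: the unique derivation with the prescribed values on the generators, see
`diff_gen`, `diff_one` and `diff_mul`.  (Signs are invisible over `ZMod 2`.) -/
noncomputable def diff (A : BasedAlg m) : A.Alg →ₗ[ZMod 2] A.Alg where
  toFun a := (A.diffHom a).snd
  map_add' a b := by simp
  map_smul' c a := by simp

theorem diffHom_fst (A : BasedAlg m) (a : A.Alg) : (A.diffHom a).fst = a := by
  have h : ((TrivSqZeroExt.fstHom (ZMod 2) A.Alg A.Alg).comp A.diffHom) = AlgHom.id (ZMod 2) A.Alg := by
    apply FreeAlgebra.hom_ext
    funext x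
    simp [diffHom, gen]
  exact DFunLike.congr_fun h a

theorem diff_gen (A : BasedAlg m) (x : A.Gen) : A.diff (A.gen x) = A.dGen x := by
  simp [diff, diffHom, gen]

theorem diff_one (A : BasedAlg m) : A.diff 1 = 0 := by
  simp [diff]

theorem diff_mul (A : BasedAlg m) (a b : A.Alg) :
    A.diff (a * b) = A.diff a * b + a * A.diff b := by
  simp [diff, diffHom_fst, add_comm]

/-- The homogeneous part of degree `g`: the span of the words in the generators of total degree
`g`. -/
def homog (A : BasedAlg m) (g : ZMod m) : Submodule (ZMod 2) A.Alg :=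
  Submodule.span (ZMod 2) {w | ∃ l : List A.Gen, (l.map A.deg).sum = g ∧ w = (l.map A.gen).prod}

/-- `∂` squares to zero and has degree `-1`. -/
def IsDGA (A : BasedAlg m) : Prop :=
  (∀ a, A.diff (A.diff a) = 0) ∧ ∀ g, ∀ a ∈ A.homog g, A.diff a ∈ A.homog (g - 1)

/-- An elementary automorphism: a graded algebra map that fixes all generators but one, `x`, and
sends `x` to `x + v` with `v` in the subalgebra generated by the other generators. -/
def IsElementary (A : BasedAlg m) (φ : A.Alg →ₐ[ZMod 2] A.Alg) : Prop :=
  (∀ g, ∀ a ∈ A.homog g, φ a ∈ A.homog g) ∧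
  ∃ x : A.Gen, (∀ y, y ≠ x → φ (A.gen y) = A.gen y) ∧
    ∃ v ∈ Algebra.adjoin (ZMod 2) (A.gen '' {y | y ≠ x}), φ (A.gen x) = A.gen x + v

/-- Existence of a tame isomorphism: a composition `φ` of elementary automorphisms, followed by the
isomorphism that extends a degree preserving bijection of the generators, and commuting with the
differentials. -/
def TameIso (A B : BasedAlg m) : Prop :=
  ∃ φ ∈ Submonoid.closure {φ : A.Alg →ₐ[ZMod 2] A.Alg | A.IsElementary φ},
    ∃ σ : A.Gen ≃ B.Gen, (∀ x, B.deg (σ x) = A.deg x) ∧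
      ∀ a, FreeAlgebra.lift (ZMod 2) (fun x => B.gen (σ x)) (φ (A.diff a)) =
        B.diff (FreeAlgebra.lift (ZMod 2) (fun x => B.gen (σ x)) (φ a))

/-- The degree `i` stabilization: two new generators `a = inr true` of degree `i` and
`b = inr false` of degree `i - 1`, with `∂ a = b` and `∂ b = 0`. -/
noncomputable def stab (A : BasedAlg m) (i : ZMod m) : BasedAlg m where
  Gen := A.Gen ⊕ Bool
  finite_gen := by
    have := A.finite_gen
    infer_instance
  deg := Sum.elim A.deg fun t => if t then i else i - 1
  dGen := Sum.elim
    (fun x => FreeAlgebra.lift (ZMod 2) (fun y => FreeAlgebra.ι (ZMod 2) (Sum.inl y)) (A.dGen x))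
    (fun t => if t then FreeAlgebra.ι (ZMod 2) (Sum.inr false) else 0)

/-- Successive stabilizations in the degrees of a list. -/
noncomputable def stabList (A : BasedAlg m) : List (ZMod m) → BasedAlg m
  | [] => A
  | i :: l => (A.stabList l).stab i

/-- Stable tame isomorphism: tame isomorphism after finitely many stabilizations on both sides. -/
def StableTameIso (A B : BasedAlg m) : Prop :=
  ∃ l l' : List (ZMod m), TameIso (A.stabList l) (B.stabList l')

/-- One generator `x`, of degree `g`, with `∂ x = 0`. -/
def single (g : ZMod m) : BasedAlg m where
  Gen := Unit
  finite_gen := inferInstance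
  deg := fun _ => g
  dGen := fun _ => 0

end BasedAlg

/-! ### Legendrian fronts with a compatible polygonal decomposition -/

/-- The possible singularity type of `L` along a connected component of the part of `L` above a
cell: away from the cusps, on a cusp edge, or an upward or downward swallowtail point.  The
*sheets* of `L` above the cell are the components that are not of type `cusp`. -/
inductive Kind
  | smooth
  | cusp
  | up
  | down
  deriving DecidableEq

/-- A swallowtail point, of either type. -/
abbrev Kind.IsSwallow (k : Kind) : Prop := k = Kind.up ∨ k = Kind.down

/-- The cell by cell description of the front projection of a Legendrian surface `L` over an
oriented surface with an `L`-compatible polygonal decomposition.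

* Every `1`-cell `e` is oriented from `vert e false` to `vert e true`.
* The boundary of a `2`-cell `f` is a polygon with `sides f` sides.  The sides are numbered
  cyclically and counter-clockwise; side `i` maps to the `1`-cell `bd f i`, and `dir f i` tells
  whether the counter-clockwise direction agrees with the orientation of this `1`-cell.
  Corner `i` of the polygon is the common vertex of side `i` and the side following it.
* The components of `L` above a cell (cusp edges, cusp points and swallowtail points included)
  are numbered.  Above a `2`-cell they are the sheets, numbered by decreasing `z`-coordinate.
  Above `0`- and `1`-cells, `vlev` and `elev` are the levels of the components, counted from the
  top: a larger level is a smaller `z`-coordinate, and equal levels are equal `z`-coordinates.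
  (Two sheets above a `1`-cell have the same level exactly if they cross along it.)
* `eclo` and `fclo` tell which component above a boundary vertex or side a given component above
  the cell has in its closure. -/
structure Front where
  V : Type
  E : Type
  F : Type
  [fintypeV : Fintype V]
  [fintypeE : Fintype E]
  [fintypeF : Fintype F]
  [decV : DecidableEq V]
  [decE : DecidableEq E]
  [decF : DecidableEq F]
  vert : E → Bool → V
  sides : F → ℕ
  bd : (f : F) → Fin (sides f) → E
  dir : (f : F) → Fin (sides f) → Bool
  vnum : V → ℕ
  enum : E → ℕ
  fnum : F → ℕ
  vlev : (v : V) → Fin (vnum v) → ℕ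
  elev : (e : E) → Fin (enum e) → ℕ
  vkind : (v : V) → Fin (vnum v) → Kind
  ekind : (e : E) → Fin (enum e) → Kind
  eclo : (e : E) → (b : Bool) → Fin (enum e) → Fin (vnum (vert e b))
  fclo : (f : F) → (i : Fin (sides f)) → Fin (fnum f) → Fin (enum (bd f i))
  sides_pos : ∀ f, 0 < sides f
  /-- Consecutive sides of a polygon share a vertex. -/
  bd_closed : ∀ f i, vert (bd f i) (dir f i) =
    vert (bd f (finRotate _ i)) (!dir f (finRotate _ i))
  /-- At a corner, the closure is the same along both sides. -/
  clo_corner : ∀ f i p, (eclo (bd f i) (dir f i) (fclo f i p) : ℕ) =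
    eclo (bd f (finRotate _ i)) (!dir f (finRotate _ i)) (fclo f (finRotate _ i) p)
  /-- Taking closures respects the order by the `z`-coordinate. -/
  elev_mono : ∀ f i p q, p ≤ q → elev (bd f i) (fclo f i p) ≤ elev (bd f i) (fclo f i q)
  vlev_mono : ∀ e b x y, elev e x ≤ elev e y → vlev (vert e b) (eclo e b x) ≤
    vlev (vert e b) (eclo e b y)
  /-- Swallowtail points lie above `0`-cells. -/
  ekind_not_swallow : ∀ e x, ¬ (ekind e x).IsSwallow
  /-- On either side of a `1`-cell, one sheet continues a given sheet above the `1`-cell, and two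
  sheets or none end at a given cusp edge. -/
  smooth_side : ∀ f i x, ekind (bd f i) x = Kind.smooth →
    (Finset.univ.filter fun p => fclo f i p = x).card = 1
  cusp_side : ∀ f i x, ekind (bd f i) x = Kind.cusp →
    (Finset.univ.filter fun p => fclo f i p = x).card = 0 ∨
    (Finset.univ.filter fun p => fclo f i p = x).card = 2
  /-- The same at the ends of a `1`-cell.  A cusp point above the end may instead be the end of one
  cusp edge above the `1`-cell. -/
  smooth_end : ∀ e b y, vkind (vert e b) y = Kind.smooth →
    (Finset.univ.filter fun x => ekind e x = Kind.smooth ∧ eclo e b x = y).card = 1 ∧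
    (Finset.univ.filter fun x => ekind e x = Kind.cusp ∧ eclo e b x = y).card = 0
  cusp_end : ∀ e b y, vkind (vert e b) y = Kind.cusp →
    ((Finset.univ.filter fun x => ekind e x = Kind.smooth ∧ eclo e b x = y).card,
      (Finset.univ.filter fun x => ekind e x = Kind.cusp ∧ eclo e b x = y).card) ∈
      ({(0, 0), (2, 0), (0, 1)} : Finset (ℕ × ℕ))
  /-- A `1`-cell that ends at a swallowtail point lies outside the swallowtail region, on a cusp
  arc, or inside the swallowtail region. -/
  swallow_end : ∀ e b y, (vkind (vert e b) y).IsSwallow →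
    ((Finset.univ.filter fun x => ekind e x = Kind.smooth ∧ eclo e b x = y).card,
      (Finset.univ.filter fun x => ekind e x = Kind.cusp ∧ eclo e b x = y).card) ∈
      ({(1, 0), (1, 1), (3, 0)} : Finset (ℕ × ℕ))
  /-- There is at most one swallowtail point above a `0`-cell. -/
  swallow_unique : ∀ v y y', (vkind v y).IsSwallow → (vkind v y').IsSwallow → y = y'

namespace Front

attribute [instance] Front.fintypeV Front.fintypeE Front.fintypeF
attribute [instance] Front.decV Front.decE Front.decF

variable (D : Front)

/-! #### Maslov number and Maslov potentials -/

/-- `D.SheetPath s t n`: a generic path in `L` leads from the sheet `s` to the sheet `t` above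
`2`-cells, and crosses cusp edges `n` times, where crossings from the upper to the lower sheet are
counted with sign `+1` and the others with sign `-1`. -/
inductive SheetPath (s : Σ f : D.F, Fin (D.fnum f)) : (Σ f : D.F, Fin (D.fnum f)) → ℤ → Prop
  | refl : SheetPath s s 0
  | cross {n : ℤ} {f g : D.F} {i : Fin (D.sides f)} {j : Fin (D.sides g)} {p : Fin (D.fnum f)}
      {q : Fin (D.fnum g)} : SheetPath s ⟨f, p⟩ n → D.bd f i = D.bd g j →
      D.ekind (D.bd f i) (D.fclo f i p) = Kind.smooth →
      (D.fclo f i p : ℕ) = (D.fclo g j q : ℕ) → SheetPath s ⟨g, q⟩ n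
  | down {n : ℤ} {f : D.F} {i : Fin (D.sides f)} {p q : Fin (D.fnum f)} :
      SheetPath s ⟨f, p⟩ n → p < q → D.fclo f i p = D.fclo f i q →
      D.ekind (D.bd f i) (D.fclo f i p) = Kind.cusp → SheetPath s ⟨f, q⟩ (n + 1)
  | up {n : ℤ} {f : D.F} {i : Fin (D.sides f)} {p q : Fin (D.fnum f)} :
      SheetPath s ⟨f, p⟩ n → q < p → D.fclo f i p = D.fclo f i q →
      D.ekind (D.bd f i) (D.fclo f i p) = Kind.cusp → SheetPath s ⟨f, q⟩ (n - 1)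

/-- The Maslov number: the smallest positive number of cusp crossings of a loop, counted with
signs, or `0` if there is none. -/
noncomputable def maslovNumber : ℕ :=
  sInf {n : ℕ | 0 < n ∧ ∃ s, D.SheetPath s s n}

/-- A Maslov potential: locally constant on `L`, with values in the integers modulo the Maslov
number, and larger by `1` on the upper sheet of a cusp edge than on the lower one.  At a swallowtail
point it has the value of the sheet outside the swallowtail region that ends there.  (The values of
`epot` and `vpot` on components of type `cusp` are irrelevant.) -/
structure MaslovPotential where
  vpot : (v : D.V) → Fin (D.vnum v) → ZMod D.maslovNumber
  epot : (e : D.E) → Fin (D.enum e) → ZMod D.maslovNumber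
  fpot : (f : D.F) → Fin (D.fnum f) → ZMod D.maslovNumber
  side_smooth : ∀ f i p, D.ekind (D.bd f i) (D.fclo f i p) = Kind.smooth →
    epot (D.bd f i) (D.fclo f i p) = fpot f p
  side_cusp : ∀ f i p q, p < q → D.fclo f i p = D.fclo f i q →
    D.ekind (D.bd f i) (D.fclo f i p) = Kind.cusp → fpot f p = fpot f q + 1
  end_smooth : ∀ e b x, D.vkind (D.vert e b) (D.eclo e b x) = Kind.smooth →
    vpot (D.vert e b) (D.eclo e b x) = epot e x
  end_swallow : ∀ e b x, (D.vkind (D.vert e b) (D.eclo e b x)).IsSwallow →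
    D.ekind e x = Kind.smooth →
    (∀ y, D.ekind e y = Kind.smooth → D.eclo e b y = D.eclo e b x → y = x) →
    vpot (D.vert e b) (D.eclo e b x) = epot e x

/-! #### Generators -/

/-- The generators of the cellular DGA: one for each cell and each pair of sheets above it of which
the first lies above the second. -/
abbrev CellGen : Type :=
  (Σ v : D.V, {pq : Fin (D.vnum v) × Fin (D.vnum v) //
    D.vkind v pq.1 ≠ Kind.cusp ∧ D.vkind v pq.2 ≠ Kind.cusp ∧ D.vlev v pq.1 < D.vlev v pq.2}) ⊕
  (Σ e : D.E, {pq : Fin (D.enum e) × Fin (D.enum e) //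
    D.ekind e pq.1 ≠ Kind.cusp ∧ D.ekind e pq.2 ≠ Kind.cusp ∧ D.elev e pq.1 < D.elev e pq.2}) ⊕
  (Σ f : D.F, {pq : Fin (D.fnum f) × Fin (D.fnum f) // pq.1 < pq.2})

/-- The free algebra on these generators. -/
abbrev CellAlg : Type := FreeAlgebra (ZMod 2) D.CellGen

variable {D}

/-- The generator `a p q` of a `0`-cell, or `0` if `p`, `q` is not a pair of sheets with `p` above
`q`. -/
noncomputable def a (v : D.V) (p q : Fin (D.vnum v)) : D.CellAlg :=
  if h : D.vkind v p ≠ Kind.cusp ∧ D.vkind v q ≠ Kind.cusp ∧ D.vlev v p < D.vlev v q then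
    FreeAlgebra.ι (ZMod 2) (Sum.inl ⟨v, (p, q), h⟩) else 0

/-- The generator `b p q` of a `1`-cell, or `0`. -/
noncomputable def b (e : D.E) (p q : Fin (D.enum e)) : D.CellAlg :=
  if h : D.ekind e p ≠ Kind.cusp ∧ D.ekind e q ≠ Kind.cusp ∧ D.elev e p < D.elev e q then
    FreeAlgebra.ι (ZMod 2) (Sum.inr (Sum.inl ⟨e, (p, q), h⟩)) else 0

/-- The generator `c p q` of a `2`-cell, or `0`. -/
noncomputable def c (f : D.F) (p q : Fin (D.fnum f)) : D.CellAlg :=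
  if h : p < q then FreeAlgebra.ι (ZMod 2) (Sum.inr (Sum.inr ⟨f, (p, q), h⟩)) else 0

/-! #### Matrices of a `0`-cell

In this part, `K` is the set of sheets above a cell that has the vertex `v` in its boundary, `lim`
sends a sheet to the component above `v` in its closure, and `lt p q` says that the sheet `p` is
above the sheet `q`.  Matrices are indexed by the set of sheets itself. -/

section Vertex

variable {K : Type} [Fintype K] [DecidableEq K] (v : D.V) (lim : K → Fin (D.vnum v))
  (lt : K → K → Prop) [DecidableRel lt]

/-- The generators of `v`, placed in a matrix, with a `1` for two sheets that meet at a cusp above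
`v`. -/
noncomputable def vMat : Matrix K K D.CellAlg := Matrix.of fun p q =>
  if lim p = lim q ∧ D.vkind v (lim p) = Kind.cusp ∧ lt p q then 1 else a v (lim p) (lim q)

/-- The sheets are those above (a part of) the swallowtail region of a swallowtail point above `v`:
three of them meet there. -/
abbrev InRegion : Prop :=
  (Finset.univ.filter fun p => (D.vkind v (lim p)).IsSwallow).card = 3

/-- `p` is the `r`-th from the top, with counting from `0`, of the sheets that meet at a swallowtail
point above `v`. -/
abbrev Rank (r : ℕ) (p : K) : Prop :=
  (D.vkind v (lim p)).IsSwallow ∧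
    (Finset.univ.filter fun q => lim q = lim p ∧ lt q p).card = r

/-- The elementary matrix at the `r`-th and `s`-th of the sheets that meet at the swallowtail
point. -/
def eMat (r s : ℕ) : Matrix K K D.CellAlg := Matrix.of fun p q =>
  if Rank v lim lt r p ∧ Rank v lim lt s q then 1 else 0

/-- The generators of a swallowtail vertex `v`, placed in a matrix that has the block `0 1; 0 0` at
the `r`-th and `s`-th of the three sheets that meet at the swallowtail point. -/
noncomputable def hatMat (r s : ℕ) : Matrix K K D.CellAlg := Matrix.of fun p q =>
  if Rank v lim lt r p ∧ Rank v lim lt s q then 1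
  else if Rank v lim lt r p ∨ Rank v lim lt s p ∨ Rank v lim lt r q ∨ Rank v lim lt s q then 0
  else a v (lim p) (lim q)

/-- The swallowtail point above `v` is upward. -/
abbrev IsUp : Prop := ∃ y, D.vkind v y = Kind.up

/-- The matrix at a swallowtail vertex for the swallowtail region away from the crossing arc: the
upper two of the three sheets (for a downward swallowtail: the lower two) are treated as if they met
at a cusp. -/
noncomputable def regionMat : Matrix K K D.CellAlg :=
  if IsUp v then hatMat v lim lt 0 1 else hatMat v lim lt 1 2

/-- The matrices `A_S` (for `s = true`) and `A_T` (for `s = false`) of a swallowtail vertex. -/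
noncomputable def arcMat (s : Bool) : Matrix K K D.CellAlg :=
  if s then
    if IsUp v then (1 + eMat v lim lt 2 1) * hatMat v lim lt 0 2 * (1 + eMat v lim lt 2 1)
    else (1 + eMat v lim lt 1 0) * hatMat v lim lt 0 2 * (1 + eMat v lim lt 1 0)
  else
    if IsUp v then (1 + eMat v lim lt 1 2) * hatMat v lim lt 0 1 * (1 + eMat v lim lt 1 2)
    else (1 + eMat v lim lt 0 1) * hatMat v lim lt 1 2 * (1 + eMat v lim lt 0 1)

/-- The matrices `S` (for `s = true`) and `T` (for `s = false`) of a swallowtail vertex. -/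
noncomputable def stMat (s : Bool) : Matrix K K D.CellAlg :=
  if s then
    if IsUp v then 1 + hatMat v lim lt 0 1 * eMat v lim lt 2 0 + eMat v lim lt 1 2
    else 1 + eMat v lim lt 2 0 * hatMat v lim lt 1 2 + eMat v lim lt 0 1
  else
    if IsUp v then 1 + eMat v lim lt 1 2 else 1 + eMat v lim lt 0 1

end Vertex

/-! #### Decorations and other choices -/

/-- The end `t` of the `1`-cell `e` is the end of the crossing arc at a swallowtail point: two
sheets that cross above `e` have the swallowtail point in their closure. -/
abbrev ArcEnd (e : D.E) (t : Bool) : Prop :=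
  ∃ x y, x ≠ y ∧ D.elev e x = D.elev e y ∧ D.ekind e x ≠ Kind.cusp ∧ D.ekind e y ≠ Kind.cusp ∧
    D.eclo e t x = D.eclo e t y ∧ (D.vkind (D.vert e t) (D.eclo e t x)).IsSwallow

/-- At corner `i` of the polygon of `f`, side `i` is the crossing arc of a swallowtail point. -/
abbrev ArcIn (f : D.F) (i : Fin (D.sides f)) : Prop := ArcEnd (D.bd f i) (D.dir f i)

/-- At corner `i` of the polygon of `f`, the side after side `i` is the crossing arc of a swallowtail
point. -/
abbrev ArcOut (f : D.F) (i : Fin (D.sides f)) : Prop :=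
  ArcEnd (D.bd f (finRotate _ i)) (!D.dir f (finRotate _ i))

/-- The corner borders the crossing arc at a swallowtail point; these are the corners decorated with
an `S` or a `T`. -/
abbrev ArcCorner (f : D.F) (i : Fin (D.sides f)) : Prop := ArcIn f i ∨ ArcOut f i

/-- The `0`-cell at corner `i` of the polygon of `f`. -/
abbrev cornerV (f : D.F) (i : Fin (D.sides f)) : D.V := D.vert (D.bd f i) (D.dir f i)

/-- The edges of the polygon `Q` of `f`, in counter-clockwise order: the sides of the polygon of `f`
and, at each decorated corner `i`, an additional edge that cuts it off.  `(i, false)` is side `i`,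
and `(i, true)` is the additional edge at corner `i`. -/
def qEdges (f : D.F) : List (Fin (D.sides f) × Bool) :=
  (List.finRange (D.sides f)).flatMap fun i =>
    if ArcCorner f i then [(i, false), (i, true)] else [(i, false)]

variable (D) in
/-- The auxiliary choices in the definition of the cellular DGA.  The vertices of the polygon `Q`
of a `2`-cell are numbered so that vertex `k` is the one at which edge `k` ends in
counter-clockwise direction. -/
structure Choices where
  /-- The label of a corner at a crossing arc that ends at a swallowtail point: `true` for `S` and
  `false` for `T`.  (Labels of other corners are not used.) -/
  label : (f : D.F) → Fin (D.sides f) → Bool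
  /-- The two corners at the crossing arc are labelled differently. -/
  label_ne : ∀ (f g : D.F) (i : Fin (D.sides f)) (j : Fin (D.sides g)),
    ArcCorner f i → ArcCorner g j → cornerV f i = cornerV g j →
    ¬ (f = g ∧ (i : ℕ) = j) → label f i ≠ label g j
  /-- Initial and terminal vertices in the polygons `Q`. -/
  v₀ : (f : D.F) → Fin (qEdges f).length
  v₁ : (f : D.F) → Fin (qEdges f).length
  /-- If the initial and terminal vertices agree, tells whether the path from the first to the second
  is the whole circle counter-clockwise (`true`) or clockwise (`false`). -/
  full : D.F → Bool

variable (χ : D.Choices)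

/-! #### The differential of the generators of a `1`-cell -/

/-- The sheets above a `1`-cell. -/
abbrev ESheet (e : D.E) : Type := {x : Fin (D.enum e) // D.ekind e x ≠ Kind.cusp}

/-- For an end `t` of `e` at a swallowtail point such that `e` is in the crossing arc: the order of
the sheets above `e` as they appear on the side of `e` that is decorated with an `S` at this end. -/
def sLt (e : D.E) (t : Bool) (x y : ESheet e) : Prop :=
  ∃ f j, D.bd f j = e ∧
    ((D.dir f j = t ∧ χ.label f j = true) ∨
      (D.dir f j = !t ∧ χ.label f ((finRotate _).symm j) = true)) ∧
    ∃ p q, p < q ∧ (D.fclo f j p : ℕ) = x.1 ∧ (D.fclo f j q : ℕ) = y.1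

instance (e : D.E) (t : Bool) : DecidableRel (sLt χ e t) := fun x y => by
  unfold sLt
  infer_instance

/-- The matrix of the end `t` of `e`.  At a swallowtail point with `e` in its crossing arc this is
`A_S`, formed with the order of the sheets on the `S` side; `A_T`, formed with the order on the `T`
side, is the same matrix. -/
noncomputable def endMat (e : D.E) (t : Bool) : Matrix (ESheet e) (ESheet e) D.CellAlg :=
  if InRegion (D.vert e t) (fun x : ESheet e => D.eclo e t x.1) then
    if ArcEnd e t then arcMat (D.vert e t) (fun x : ESheet e => D.eclo e t x.1) (sLt χ e t) true
    else regionMat (D.vert e t) (fun x : ESheet e => D.eclo e t x.1)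
      (fun x y => D.elev e x.1 < D.elev e y.1)
  else vMat (D.vert e t) (fun x : ESheet e => D.eclo e t x.1)
      (fun x y => D.elev e x.1 < D.elev e y.1)

/-- The matrix of the generators of a `1`-cell. -/
noncomputable def bMat (e : D.E) : Matrix (ESheet e) (ESheet e) D.CellAlg :=
  Matrix.of fun x y => b e x.1 y.1

/-- `∂ B = A₊ (1 + B) + (1 + B) A₋`. -/
noncomputable def dB (e : D.E) : Matrix (ESheet e) (ESheet e) D.CellAlg :=
  endMat χ e true * (1 + bMat e) + (1 + bMat e) * endMat χ e false

/-! #### The differential of the generators of a `2`-cell -/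

/-- The component above corner `i` in the closure of a sheet above `f`. -/
abbrev cornerClo (f : D.F) (i : Fin (D.sides f)) (p : Fin (D.fnum f)) :
    Fin (D.vnum (cornerV f i)) := D.eclo (D.bd f i) (D.dir f i) (D.fclo f i p)

/-- The matrix of an edge of `Q`: `1 + B` for a side and `S` or `T` for an additional edge. -/
noncomputable def yMat (f : D.F) (k : Fin (D.sides f) × Bool) :
    Matrix (Fin (D.fnum f)) (Fin (D.fnum f)) D.CellAlg :=
  if k.2 then stMat (cornerV f k.1) (cornerClo f k.1) (· < ·) (χ.label f k.1)
  else 1 + Matrix.of fun p q => b (D.bd f k.1) (D.fclo f k.1 p) (D.fclo f k.1 q)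

/-- Whether the orientation of an edge of `Q` is counter-clockwise.  The additional edges are
oriented away from the crossing arc. -/
def qDir (f : D.F) (k : Fin (D.sides f) × Bool) : Bool :=
  if k.2 then decide (ArcIn f k.1) else D.dir f k.1

/-- The matrix of the vertex of `Q` at which the edge `k` ends in counter-clockwise direction.  It
is `A_S` or `A_T` for the vertex of an additional edge that lies on the crossing arc. -/
noncomputable def qvMat (f : D.F) (k : Fin (D.sides f) × Bool) :
    Matrix (Fin (D.fnum f)) (Fin (D.fnum f)) D.CellAlg :=
  if InRegion (cornerV f k.1) (cornerClo f k.1) then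
    if (k.2 = false ∧ ArcIn f k.1) ∨ (k.2 = true ∧ ¬ ArcIn f k.1) then
      arcMat (cornerV f k.1) (cornerClo f k.1) (· < ·) (χ.label f k.1)
    else regionMat (cornerV f k.1) (cornerClo f k.1) (· < ·)
  else vMat (cornerV f k.1) (cornerClo f k.1) (· < ·)

/-- `Y` or its inverse.  The matrices in question are upper triangular with diagonal entries `1`, so
the inverse of `Y = 1 - X` is the finite geometric series in `X`. -/
noncomputable def ypow {n : ℕ} (Y : Matrix (Fin n) (Fin n) D.CellAlg) (η : Bool) :
    Matrix (Fin n) (Fin n) D.CellAlg :=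
  if η then Y else ∑ k ∈ Finset.range n, (1 - Y) ^ k

/-- The product `Y_m ^ η_m * ⋯ * Y_1 ^ η_1` along a path that passes the edges of the list in turn.
The second components tell whether an edge is passed counter-clockwise. -/
noncomputable def pathMat (f : D.F) (l : List ((Fin (D.sides f) × Bool) × Bool)) :
    Matrix (Fin (D.fnum f)) (Fin (D.fnum f)) D.CellAlg :=
  (l.map fun k => ypow (yMat χ f k.1) (qDir f k.1 == k.2)).reverse.prod

/-- The number of edges of the counter-clockwise path from the initial to the terminal vertex. -/
def plusLength (f : D.F) : ℕ :=
  if χ.v₀ f = χ.v₁ f then if χ.full f then (qEdges f).length else 0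
  else ((χ.v₁ f : ℕ) + (qEdges f).length - χ.v₀ f) % (qEdges f).length

/-- The edges of `Q` in counter-clockwise order from the initial vertex. -/
def qEdgesFrom (f : D.F) : List (Fin (D.sides f) × Bool) :=
  (qEdges f).rotate (χ.v₀ f + 1)

/-- The counter-clockwise path from the initial to the terminal vertex. -/
def gammaPlus (f : D.F) : List ((Fin (D.sides f) × Bool) × Bool) :=
  ((qEdgesFrom χ f).take (plusLength χ f)).map fun k => (k, true)

/-- The clockwise path from the initial to the terminal vertex. -/
def gammaMinus (f : D.F) : List ((Fin (D.sides f) × Bool) × Bool) :=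
  ((qEdgesFrom χ f).drop (plusLength χ f)).reverse.map fun k => (k, false)

/-- The matrix of the generators of a `2`-cell. -/
noncomputable def cMat (f : D.F) : Matrix (Fin (D.fnum f)) (Fin (D.fnum f)) D.CellAlg :=
  Matrix.of fun p q => c f p q

/-- `∂ C = A_{v₁} C + C A_{v₀} + Y_j ^ η_j ⋯ Y_1 ^ η_1 + Y_m ^ η_m ⋯ Y_{j+1} ^ η_{j+1}`, with one
product for each of the two paths from `v₀` to `v₁`. -/
noncomputable def dC (f : D.F) : Matrix (Fin (D.fnum f)) (Fin (D.fnum f)) D.CellAlg :=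
  qvMat χ f ((qEdges f).get (χ.v₁ f)) * cMat f + cMat f * qvMat χ f ((qEdges f).get (χ.v₀ f)) +
    pathMat χ f (gammaPlus χ f) + pathMat χ f (gammaMinus χ f)

/-! #### The cellular DGA -/

/-- The matrix of the generators of a `0`-cell. -/
noncomputable def aMat (v : D.V) : Matrix (Fin (D.vnum v)) (Fin (D.vnum v)) D.CellAlg :=
  Matrix.of fun p q => a v p q

/-- The cellular DGA. -/
noncomputable def cellularDGA (μ : D.MaslovPotential) (χ : D.Choices) :
    BasedAlg D.maslovNumber where
  Gen := D.CellGen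
  finite_gen := inferInstance
  deg
    | .inl ⟨v, pq⟩ => μ.vpot v pq.1.1 - μ.vpot v pq.1.2 - 1
    | .inr (.inl ⟨e, pq⟩) => μ.epot e pq.1.1 - μ.epot e pq.1.2
    | .inr (.inr ⟨f, pq⟩) => μ.fpot f pq.1.1 - μ.fpot f pq.1.2 + 1
  dGen
    | .inl ⟨v, pq⟩ => (aMat v * aMat v) pq.1.1 pq.1.2
    | .inr (.inl ⟨e, pq⟩) => dB χ e ⟨pq.1.1, pq.2.1⟩ ⟨pq.1.2, pq.2.2.1⟩
    | .inr (.inr ⟨f, pq⟩) => dC χ f pq.1.1 pq.1.2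

end Front

/-! ### The sphere with one upward and one downward swallowtail point

The base projection of `L` is a disk.  One cusp edge runs along `B1`, `B2` and the right outer arc
`outR`, and its projection has a semi-cubical cusp point at `A1`; the other runs along `B3`, `B4` and
the left outer arc `outL`, with a cusp point at `A2`.  The two projections intersect at `top` and
`bot`.  The crossing arc `B5` joins the swallowtail points. -/

/-- `A1` (left) and `A2` (right) lie below the upward and the downward swallowtail point. -/
inductive ExV
  | A1 | A2 | top | bot
  deriving DecidableEq

instance : Fintype ExV := ⟨{.A1, .A2, .top, .bot}, by intro x; cases x <;> decide⟩

inductive ExE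
  | B1 | B2 | B3 | B4 | B5 | outL | outR
  deriving DecidableEq

instance : Fintype ExE := ⟨{.B1, .B2, .B3, .B4, .B5, .outL, .outR}, by intro x; cases x <;> decide⟩

/-- The outer `2`-cells `C1` (left) and `C2` (right), and the inner ones `C3` (above `B5`) and `C4`
(below `B5`). -/
inductive ExF
  | C1 | C2 | C3 | C4
  deriving DecidableEq

instance : Fintype ExF := ⟨{.C1, .C2, .C3, .C4}, by intro x; cases x <;> decide⟩

open ExV ExE ExF Kind in
/-- The two-swallowtail sphere.  The two sheets that cross above `B5` are numbered as above `C4`. -/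
def swallowtailSphere : Front where
  V := ExV
  E := ExE
  F := ExF
  vert
    | B1, t => if t then A1 else bot
    | B2, t => if t then A1 else top
    | B3, t => if t then bot else A2
    | B4, t => if t then top else A2
    | B5, t => if t then A2 else A1
    | outL, t => if t then bot else top
    | outR, t => if t then bot else top
  sides := fun _ => 3
  bd
    | C1 => ![outL, B1, B2]
    | C2 => ![outR, B4, B3]
    | C3 => ![B2, B5, B4]
    | C4 => ![B3, B5, B1]
  dir
    | C1 => ![true, true, false]
    | C2 => ![false, false, true]
    | C3 => ![true, true, true]
    | C4 => ![false, false, false]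
  vnum := fun _ => 2
  enum
    | B1 | B2 | B3 | B4 => 3
    | B5 => 4
    | outL | outR => 1
  fnum
    | C1 | C2 => 2
    | C3 | C4 => 4
  vlev := fun _ => ![0, 1]
  elev
    | B1 | B2 | B3 | B4 => ![0, 1, 2]
    | B5 => ![0, 1, 1, 2]
    | outL | outR => ![0]
  vkind
    | A1 => ![up, smooth]
    | A2 => ![smooth, down]
    | top | bot => ![cusp, cusp]
  ekind
    | B1 | B2 => ![cusp, smooth, smooth]
    | B3 | B4 => ![smooth, smooth, cusp]
    | B5 => ![smooth, smooth, smooth, smooth]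
    | outL | outR => ![cusp]
  eclo
    | B1, t | B2, t => if t then ![0, 0, 1] else ![0, 1, 1]
    | B3, t => if t then ![0, 0, 1] else ![0, 1, 1]
    | B4, t => if t then ![0, 0, 1] else ![0, 1, 1]
    | B5, t => if t then ![0, 1, 1, 1] else ![0, 0, 0, 1]
    | outL, _ => ![1]
    | outR, _ => ![0]
  fclo
    | C1, 0 => (![0, 0] : Fin 2 → Fin 1)
    | C1, 1 => (![1, 2] : Fin 2 → Fin 3)
    | C1, 2 => (![1, 2] : Fin 2 → Fin 3)
    | C2, 0 => (![0, 0] : Fin 2 → Fin 1)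
    | C2, 1 => (![0, 1] : Fin 2 → Fin 3)
    | C2, 2 => (![0, 1] : Fin 2 → Fin 3)
    | C3, 0 => (![0, 0, 1, 2] : Fin 4 → Fin 3)
    | C3, 1 => (![0, 2, 1, 3] : Fin 4 → Fin 4)
    | C3, 2 => (![0, 1, 2, 2] : Fin 4 → Fin 3)
    | C4, 0 => (![0, 1, 2, 2] : Fin 4 → Fin 3)
    | C4, 1 => (![0, 1, 2, 3] : Fin 4 → Fin 4)
    | C4, 2 => (![0, 0, 1, 2] : Fin 4 → Fin 3)
  sides_pos := by decide
  bd_closed := by decide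
  clo_corner := by decide
  elev_mono := by decide
  vlev_mono := by decide
  ekind_not_swallow := by decide
  smooth_side := by decide
  cusp_side := by decide
  smooth_end := by decide
  cusp_end := by decide
  swallow_end := by decide
  swallow_unique := by decide

end LegendrianDGA

/-! ### Graded derivations and tame changes of generators -/

namespace LegendrianDGA

namespace BasedAlg

variable {m : ℕ} (A : BasedAlg m)

/-! After a triangular change of generators the differential pairs off 24 of the 25 generators and
annihilates the remaining one. Write p, q, r, s, t for the generators of the crossing arc with
sheets 12, 13, 14, 24, 34, and o1, o2 for those of the outer cells.

The choice of initial and terminal vertices is removed first. Each edge matrix Y of a polygon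
satisfies ∂Y = V'Y + YV, with V and V' the matrices of its ends (`IsTransport`), and this relation
passes to products and inverses. The two paths from one vertex to another therefore have products
that both obey the same relation, and they differ by one turn around the polygon. Multiplying C by
suitable path products G and H gives C' = GCH with ∂C' = V₄C' + C'V₄ + 1 + W. Here V₄ = E₁₂ + E₃₄
belongs to the top or bottom point, and W is the product once around in a fixed direction
(`exists_normal_form`, `diff_conj`). That ∂² vanishes on C follows from ∂V = V² and from the same
relation for the path products (`diff_cell_eq_zero`). The labels S and T have no effect: at these
swallowtail points both versions of each matrix coincide (`arcMat_A1`, `stMat_A1` and their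
analogues at `A2`), and the vertex matrix on the arc is invariant under exchanging the crossing
sheets (`hatM_swap`).

The normal form can be read entrywise (`exists_cell_form`): ∂c12 = W12, ∂c34 = W34, ∂c13' = c23 +
W13 and ∂c14' = c24' + c13' + W14. By `prod_boundary`, W12 is q + b4 for `C3` and p + b3 for `C4`,
while W34 is s + b2 and t + b1 respectively. So the c12 cancel q and p, the c34 cancel s and t, the
c13 cancel the c23, and the c14 cancel the c24. Further, b1 and b3 cancel a1 and a2 (shifted by 1),
and o1 and o2 cancel b2 and b4 (shifted by b1 and b3). Only r is left. Adding a2(c34 + c34 + o1) +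
(c12 + c12 + o2)a1, with both inner cells contributing, makes it a cycle, because the two brackets
have differentials s + t and p + q.

All these shifts are triangular for a suitable rank on the generators, hence tame
(`triangular_mem_closure`). The criterion `BasedAlg.stableTameIso_single` turns such a pairing into
a stable tame isomorphism. -/

theorem add_self (a : A.Alg) : a + a = 0 := by
  rw [← two_smul (ZMod 2) a, show (2 : ZMod 2) = 0 from rfl, zero_smul]

theorem one_mem_homog : (1 : A.Alg) ∈ A.homog 0 :=
  Submodule.subset_span ⟨[], by simp, by simp⟩

theorem gen_mem_homog (x : A.Gen) : A.gen x ∈ A.homog (A.deg x) :=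
  Submodule.subset_span ⟨[x], by simp, by simp⟩

theorem mul_mem_homog {g h : ZMod m} {a b : A.Alg} (ha : a ∈ A.homog g) (hb : b ∈ A.homog h) :
    a * b ∈ A.homog (g + h) := by
  have key : A.homog g * A.homog h ≤ A.homog (g + h) := by
    unfold homog
    rw [Submodule.span_mul_span]
    apply Submodule.span_mono
    rintro _ ⟨_, ⟨l, hl, rfl⟩, _, ⟨l', hl', rfl⟩, rfl⟩
    exact ⟨l ++ l', by simp [hl, hl'], by simp⟩
  exact key (Submodule.mul_mem_mul ha hb)

/-- By the Leibniz rule, ∂ of a word is a sum of words in which one letter has been replaced by its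
differential, so the generators decide the degree. -/
theorem diff_mem_homog (h : ∀ x, A.dGen x ∈ A.homog (A.deg x - 1)) {g : ZMod m} {a : A.Alg}
    (ha : a ∈ A.homog g) : A.diff a ∈ A.homog (g - 1) := by
  unfold homog at ha
  induction ha using Submodule.span_induction with
  | mem w hw =>
    obtain ⟨l, rfl, rfl⟩ := hw
    induction l with
    | nil => simp [diff_one]
    | cons x l ih =>
      rw [List.map_cons, List.map_cons, List.sum_cons, List.prod_cons, diff_mul, diff_gen]
      refine add_mem ?_ ?_
      · have h1 := A.mul_mem_homog (h x) (Submodule.subset_span ⟨l, rfl, rfl⟩)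
        rwa [sub_add_eq_add_sub] at h1
      · have h1 := A.mul_mem_homog (A.gen_mem_homog x) ih
        rwa [← add_sub_assoc] at h1
  | zero => simp
  | add a b _ _ ha hb => rw [map_add]; exact add_mem ha hb
  | smul c a _ ha => rw [map_smul]; exact Submodule.smul_mem _ _ ha

theorem map_mem_homog {φ : A.Alg →ₐ[ZMod 2] A.Alg} (h : ∀ x, φ (A.gen x) ∈ A.homog (A.deg x))
    {g : ZMod m} {a : A.Alg} (ha : a ∈ A.homog g) : φ a ∈ A.homog g := by
  unfold homog at ha
  induction ha using Submodule.span_induction with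
  | mem w hw =>
    obtain ⟨l, rfl, rfl⟩ := hw
    induction l with
    | nil => simpa using A.one_mem_homog
    | cons x l ih =>
      rw [List.map_cons, List.map_cons, List.sum_cons, List.prod_cons, map_mul]
      exact A.mul_mem_homog (h x) ih
  | zero => simp
  | add a b _ _ ha hb => rw [map_add]; exact add_mem ha hb
  | smul c a _ ha => rw [map_smul]; exact Submodule.smul_mem _ _ ha

/-- In characteristic 2 the square of a derivation is a derivation: the mixed term ∂a · ∂b occurs
twice. It therefore vanishes once it vanishes on generators. -/
theorem diff_diff (h : ∀ x, A.diff (A.dGen x) = 0) (a : A.Alg) : A.diff (A.diff a) = 0 := by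
  induction a using FreeAlgebra.induction with
  | grade0 r => rw [Algebra.algebraMap_eq_smul_one, map_smul, diff_one, smul_zero, map_zero]
  | grade1 x => rw [← h x, ← diff_gen]; rfl
  | mul a b ha hb =>
    rw [diff_mul, map_add, diff_mul, diff_mul, ha, hb, zero_mul, mul_zero, zero_add, add_zero,
      add_self]
  | add a b ha hb => rw [map_add, map_add, ha, hb, add_zero]

theorem isDGA_of_gen (h : ∀ x, A.dGen x ∈ A.homog (A.deg x - 1))
    (h' : ∀ x, A.diff (A.dGen x) = 0) : A.IsDGA :=
  ⟨A.diff_diff h', fun _ _ ha => A.diff_mem_homog h ha⟩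

variable {A}

theorem algHom_ext {R : Type*} [Semiring R] [Algebra (ZMod 2) R] {φ ψ : A.Alg →ₐ[ZMod 2] R}
    (h : ∀ x, φ (A.gen x) = ψ (A.gen x)) : φ = ψ :=
  FreeAlgebra.hom_ext (funext h)

theorem eq_self_of_mem_adjoin {φ : A.Alg →ₐ[ZMod 2] A.Alg} {s : Set A.Gen}
    (h : ∀ y ∈ s, φ (A.gen y) = A.gen y) {v : A.Alg}
    (hv : v ∈ Algebra.adjoin (ZMod 2) (A.gen '' s)) : φ v = v := by
  have : Algebra.adjoin (ZMod 2) (A.gen '' s) ≤ AlgHom.equalizer φ (AlgHom.id _ _) := by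
    rw [Algebra.adjoin_le_iff]
    rintro _ ⟨y, hy, rfl⟩
    exact h y hy
  exact this hv

/-- The added element does not involve the moved generator, so it is fixed, and applying the map
twice adds it twice. -/
theorem IsElementary.mul_self {φ : A.Alg →ₐ[ZMod 2] A.Alg} (h : A.IsElementary φ) : φ * φ = 1 := by
  obtain ⟨-, x, hy, v, hv, hx⟩ := h
  apply algHom_ext
  intro y
  by_cases hyx : y = x
  · subst hyx
    rw [AlgHom.mul_apply, hx, map_add, hx, eq_self_of_mem_adjoin hy hv, add_assoc, add_self,
      add_zero]
    rfl
  · rw [AlgHom.mul_apply, hy y hyx, hy y hyx]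
    rfl

/-- Elementary maps are involutions, so reversing the factors inverts a composition. This matters
because a change of generators and the tame isomorphism it yields are inverse to each other. -/
theorem exists_inverse_of_mem_closure {φ : A.Alg →ₐ[ZMod 2] A.Alg}
    (h : φ ∈ Submonoid.closure {φ : A.Alg →ₐ[ZMod 2] A.Alg | A.IsElementary φ}) :
    ∃ ψ ∈ Submonoid.closure {φ : A.Alg →ₐ[ZMod 2] A.Alg | A.IsElementary φ},
      φ * ψ = 1 ∧ ψ * φ = 1 := by
  induction h using Submonoid.closure_induction with
  | mem φ h => exact ⟨φ, Submonoid.subset_closure h, h.mul_self, h.mul_self⟩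
  | one => exact ⟨1, one_mem _, one_mul _, one_mul _⟩
  | mul φ φ' _ _ h h' =>
    obtain ⟨ψ, hψ, h1, h2⟩ := h
    obtain ⟨ψ', hψ', h1', h2'⟩ := h'
    refine ⟨ψ' * ψ, mul_mem hψ' hψ, ?_, ?_⟩
    · rw [mul_assoc, ← mul_assoc φ', h1', one_mul, h1]
    · rw [mul_assoc, ← mul_assoc ψ, h2, one_mul, h2']

variable (A) in
/-- The subalgebra generated by the generators of rank less than `n`. -/
def low (ρ : A.Gen → ℕ) (n : ℕ) : Subalgebra (ZMod 2) A.Alg :=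
  Algebra.adjoin (ZMod 2) (A.gen '' {y | ρ y < n})

theorem gen_mem_low {ρ : A.Gen → ℕ} {n : ℕ} {x : A.Gen} (h : ρ x < n) : A.gen x ∈ A.low ρ n :=
  Algebra.subset_adjoin ⟨x, h, rfl⟩

theorem low_mono {ρ : A.Gen → ℕ} {n k : ℕ} (h : n ≤ k) : A.low ρ n ≤ A.low ρ k :=
  Algebra.adjoin_mono (Set.image_mono fun _ hy => lt_of_lt_of_le hy h)

/-- A homogeneous triangular change of the generators is a composition of elementary
automorphisms. -/
theorem triangular_mem_closure (ρ : A.Gen → ℕ) (v : A.Gen → A.Alg)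
    (hv : ∀ x, v x ∈ A.low ρ (ρ x)) (hd : ∀ x, v x ∈ A.homog (A.deg x)) :
    FreeAlgebra.lift (ZMod 2) (fun x => A.gen x + v x) ∈
      Submonoid.closure {φ : A.Alg →ₐ[ZMod 2] A.Alg | A.IsElementary φ} := by
  classical
  have := A.finite_gen
  have := Fintype.ofFinite A.Gen
  let Φ (s : Finset A.Gen) : A.Alg →ₐ[ZMod 2] A.Alg :=
    FreeAlgebra.lift (ZMod 2) fun x => if x ∈ s then A.gen x + v x else A.gen x
  have hΦ (s : Finset A.Gen) (x : A.Gen) :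
      Φ s (A.gen x) = if x ∈ s then A.gen x + v x else A.gen x := by
    simp only [Φ, gen, FreeAlgebra.lift_ι_apply]
  have key (s : Finset A.Gen) :
      Φ s ∈ Submonoid.closure {φ : A.Alg →ₐ[ZMod 2] A.Alg | A.IsElementary φ} := by
    induction s using Finset.induction_on_max_value ρ with
    | empty =>
      convert one_mem (Submonoid.closure {φ : A.Alg →ₐ[ZMod 2] A.Alg | A.IsElementary φ})
      apply algHom_ext
      intro x
      simp [hΦ]
    | insert x s hxs hmax ih =>
      have hne (y : A.Gen) (hy : y ≠ x) : Φ {x} (A.gen y) = A.gen y := by simp [hΦ, hy]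
      have hel : A.IsElementary (Φ {x}) := by
        refine ⟨fun g a ha => A.map_mem_homog (fun y => ?_) ha, x, hne, v x, ?_, by simp [hΦ]⟩
        · rw [hΦ]
          split_ifs
          · exact add_mem (A.gen_mem_homog y) (hd y)
          · exact A.gen_mem_homog y
        · refine Algebra.adjoin_mono (Set.image_mono ?_) (hv x)
          rintro y hy rfl
          exact lt_irrefl (ρ y) hy
      -- As `x` has maximal rank in the set, the shifts of the other members of the set do not
      -- involve `x`. Shifting `x` alone therefore leaves them unchanged.
      have hmul : Φ (insert x s) = Φ {x} * Φ s := by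
        apply algHom_ext
        intro y
        rw [AlgHom.mul_apply, hΦ, hΦ]
        by_cases hyx : y = x
        · subst hyx
          simp [hxs, hΦ]
        · by_cases hys : y ∈ s
          · rw [if_pos (Finset.mem_insert_of_mem hys), if_pos hys, map_add, hne y hyx,
              eq_self_of_mem_adjoin (s := {z | ρ z < ρ y}) _ (hv y)]
            rintro z hz
            refine hne z ?_
            rintro rfl
            exact absurd hz (not_lt.2 (hmax y hys))
          · rw [if_neg (by simp [hyx, hys]), if_neg hys, hne y hyx]
      rw [hmul]
      exact mul_mem (Submonoid.subset_closure hel) ih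
  simpa [Φ] using key Finset.univ

/-! ### Cancelling pairs of generators against stabilizations -/

/-- The generators of a stabilization of `single g`, matched with a generator `z` and a list of
pairs of generators of `A`. -/
def pairing (z : A.Gen) (g : ZMod m) : (l : List (A.Gen × A.Gen)) →
    ((single g).stabList (l.map fun p => A.deg p.1)).Gen → A.Gen
  | [] => fun _ => z
  | p :: l => Sum.elim (pairing z g l) fun t => if t then p.1 else p.2

theorem pairing_surj {z : A.Gen} {g : ZMod m} {l : List (A.Gen × A.Gen)} {x : A.Gen}
    (h : x = z ∨ ∃ p ∈ l, x = p.1 ∨ x = p.2) : ∃ y, pairing z g l y = x := by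
  induction l with
  | nil => exact ⟨(), by simpa [pairing, eq_comm] using h⟩
  | cons p l ih =>
    by_cases h1 : x = p.1
    · exact ⟨Sum.inr true, h1.symm⟩
    by_cases h2 : x = p.2
    · exact ⟨Sum.inr false, h2.symm⟩
    obtain ⟨y, hy⟩ := ih (by simpa [h1, h2] using h)
    exact ⟨Sum.inl y, hy⟩

theorem card_stabList (g : ZMod m) (l : List (ZMod m)) :
    Nat.card ((single g).stabList l).Gen = 2 * l.length + 1 := by
  induction l with
  | nil => exact Nat.card_unique (α := Unit)
  | cons i l ih =>
    have := ((single g).stabList l).finite_gen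
    change Nat.card (((single g).stabList l).Gen ⊕ Bool) = _
    rw [Nat.card_sum, ih, List.length_cons, Nat.card_eq_fintype_card (α := Bool), Fintype.card_bool]
    ring

theorem deg_pairing {z : A.Gen} {l : List (A.Gen × A.Gen)}
    (hl : ∀ p ∈ l, A.deg p.2 = A.deg p.1 - 1)
    (y : ((single (A.deg z)).stabList (l.map fun p => A.deg p.1)).Gen) :
    A.deg (pairing z (A.deg z) l y) =
      ((single (A.deg z)).stabList (l.map fun p => A.deg p.1)).deg y := by
  induction l with
  | nil => rfl
  | cons p l ih =>
    rcases y with y | (_ | _)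
    · exact ih (fun q hq => hl q (List.mem_cons_of_mem _ hq)) y
    · exact hl p List.mem_cons_self
    · rfl

theorem lift_lift_inl {X Y R : Type} [Semiring R] [Algebra (ZMod 2) R] (f : X ⊕ Y → R)
    (w : FreeAlgebra (ZMod 2) X) :
    FreeAlgebra.lift (ZMod 2) f (FreeAlgebra.lift (ZMod 2)
      (fun y => FreeAlgebra.ι (ZMod 2) (Sum.inl y)) w) =
      FreeAlgebra.lift (ZMod 2) (fun y => f (Sum.inl y)) w := by
  rw [← AlgHom.comp_apply]
  refine DFunLike.congr_fun (FreeAlgebra.hom_ext (funext fun y => ?_)) w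
  simp

/-- The induction follows the stabilizations one at a time: each new pair is a generator mapped to
its partner and a partner mapped to 0, as in the model. -/
theorem diff_pairing {z : A.Gen} {g : ZMod m} {l : List (A.Gen × A.Gen)}
    {θ : A.Alg →ₐ[ZMod 2] A.Alg} (hz : A.diff (θ (A.gen z)) = 0)
    (hl : ∀ p ∈ l, A.diff (θ (A.gen p.1)) = θ (A.gen p.2) ∧ A.diff (θ (A.gen p.2)) = 0)
    (y : ((single g).stabList (l.map fun p => A.deg p.1)).Gen) :
    A.diff (θ (A.gen (pairing z g l y))) =
      θ (FreeAlgebra.lift (ZMod 2) (fun y => A.gen (pairing z g l y))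
        (((single g).stabList (l.map fun p => A.deg p.1)).dGen y)) := by
  induction l with
  | nil => exact hz.trans ((congrArg θ (map_zero _)).trans (map_zero θ)).symm
  | cons p l ih =>
    rcases y with y | (_ | _)
    · refine (ih (fun q hq => hl q (List.mem_cons_of_mem _ hq)) y).trans (congrArg θ ?_)
      exact (lift_lift_inl (fun y => A.gen (pairing z g (p :: l) y)) _).symm
    · refine (hl p List.mem_cons_self).2.trans ?_
      exact ((congrArg θ (map_zero _)).trans (map_zero θ)).symm
    · refine (hl p List.mem_cons_self).1.trans (congrArg θ ?_)
      exact (FreeAlgebra.lift_ι_apply (fun y => A.gen (pairing z g (p :: l) y)) (Sum.inr false)).symm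

/-- If, after a tame change `θ` of the generators, the differential maps generators to
generators in pairs, with one generator `z` left over, the algebra is stable tame isomorphic to the
one with the generator `z` only. -/
theorem stableTameIso_single (hA : A.IsDGA) {θ : A.Alg →ₐ[ZMod 2] A.Alg}
    (hθ : θ ∈ Submonoid.closure {φ : A.Alg →ₐ[ZMod 2] A.Alg | A.IsElementary φ})
    (z : A.Gen) (l : List (A.Gen × A.Gen)) (hcard : Nat.card A.Gen = 2 * l.length + 1)
    (hcover : ∀ x, x = z ∨ ∃ p ∈ l, x = p.1 ∨ x = p.2)
    (hdeg : ∀ p ∈ l, A.deg p.2 = A.deg p.1 - 1) (hz : A.diff (θ (A.gen z)) = 0)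
    (hl : ∀ p ∈ l, A.diff (θ (A.gen p.1)) = θ (A.gen p.2)) :
    A.StableTameIso (single (A.deg z)) := by
  obtain ⟨φ, hφ, h1, h2⟩ := exists_inverse_of_mem_closure hθ
  set B := (single (A.deg z)).stabList (l.map fun p => A.deg p.1) with hB
  have := B.finite_gen
  -- The pairs are not assumed disjoint. Covering all generators with the right total count forces
  -- injectivity.
  have hbij : Function.Bijective (pairing z (A.deg z) l) :=
    Function.Surjective.bijective_of_nat_card_le (fun x => pairing_surj (hcover x))
      (by rw [card_stabList, hcard, List.length_map])
  let τ : B.Gen ≃ A.Gen := Equiv.ofBijective _ hbij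
  have hτ (y : B.Gen) : A.diff (θ (A.gen (τ y))) =
      θ (FreeAlgebra.lift (ZMod 2) (fun y => A.gen (τ y)) (B.dGen y)) :=
    diff_pairing hz (fun p hp => ⟨hl p hp, by rw [← hl p hp]; exact hA.1 _⟩) y
  let T : B.Alg →ₐ[ZMod 2] A.Alg := FreeAlgebra.lift (ZMod 2) fun y => A.gen (τ y)
  let T' : A.Alg →ₐ[ZMod 2] B.Alg := FreeAlgebra.lift (ZMod 2) fun x => B.gen (τ.symm x)
  have hT (y : B.Gen) : T (B.gen y) = A.gen (τ y) := FreeAlgebra.lift_ι_apply _ _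
  have hT' (x : A.Gen) : T' (A.gen x) = B.gen (τ.symm x) := FreeAlgebra.lift_ι_apply _ _
  have hTT' (a : A.Alg) : T (T' a) = a := by
    have : T.comp T' = AlgHom.id _ _ := algHom_ext fun x => by simp [hT, hT']
    exact DFunLike.congr_fun this a
  have hT'T (a : B.Alg) : T' (T a) = a := by
    have : T'.comp T = AlgHom.id _ _ := algHom_ext fun x => by simp [hT, hT']
    exact DFunLike.congr_fun this a
  have hφθ (a : A.Alg) : φ (θ a) = a := DFunLike.congr_fun h2 a
  have hθφ (a : A.Alg) : θ (φ a) = a := DFunLike.congr_fun h1 a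
  -- Both sides are derivations along the algebra map `θ ∘ T`, so their agreement on generators,
  -- which is `hτ`, suffices.
  have key (c : B.Alg) : A.diff (θ (T c)) = θ (T (B.diff c)) := by
    induction c using FreeAlgebra.induction with
    | grade0 r =>
      simp only [Algebra.algebraMap_eq_smul_one, map_smul, map_one, diff_one, smul_zero, map_zero]
    | grade1 y =>
      change A.diff (θ (T (B.gen y))) = θ (T (B.diff (B.gen y)))
      rw [hT, hτ, diff_gen]
    | mul a b ha hb => simp only [map_mul, diff_mul, map_add, ha, hb]
    | add a b ha hb => simp only [map_add, ha, hb]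
  have hσ (x : A.Gen) : B.deg (τ.symm x) = A.deg x := by
    obtain ⟨y, rfl⟩ := τ.surjective x
    rw [τ.symm_apply_apply]
    exact (deg_pairing hdeg y).symm
  -- The chain map required goes from `A` to the model, so it is the inverse of `θ ∘ T`.
  have hcomm (a : A.Alg) : T' (φ (A.diff a)) = B.diff (T' (φ a)) := by
    have h3 := key (T' (φ a))
    rw [hTT', hθφ] at h3
    rw [h3, hφθ, hT'T]
  exact ⟨[], l.map fun p : A.Gen × A.Gen => A.deg p.1, φ, hφ, τ.symm, hσ, hcomm⟩

end BasedAlg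
end LegendrianDGA

/-! ### Unipotent matrices and transports -/

namespace LegendrianDGA

namespace BasedAlg

variable {m : ℕ} {A : BasedAlg m} {n : ℕ}

theorem diff_matrix_mul (M N : Matrix (Fin n) (Fin n) A.Alg) :
    (M * N).map A.diff = M.map A.diff * N + M * N.map A.diff := by
  ext i j
  simp [Matrix.mul_apply, diff_mul, Finset.sum_add_distrib]

theorem diff_matrix_add (M N : Matrix (Fin n) (Fin n) A.Alg) :
    (M + N).map A.diff = M.map A.diff + N.map A.diff := by
  ext i j
  simp

theorem diff_matrix_one : (1 : Matrix (Fin n) (Fin n) A.Alg).map A.diff = 0 := by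
  ext i j
  simp only [Matrix.map_apply, Matrix.one_apply, Matrix.zero_apply]
  split_ifs
  · exact A.diff_one
  · exact map_zero _

theorem matrix_add_self (M : Matrix (Fin n) (Fin n) A.Alg) : M + M = 0 := by
  ext i j
  exact A.add_self _

/-- The entries of a matrix are homogeneous of degree `k`, up to the degrees `ν` of the rows and
columns. -/
def IsHomogMatrix (ν : Fin n → ZMod m) (k : ZMod m) (M : Matrix (Fin n) (Fin n) A.Alg) : Prop :=
  ∀ i j, M i j ∈ A.homog (ν i - ν j + k)

theorem IsHomogMatrix.add {ν : Fin n → ZMod m} {k : ZMod m} {M N : Matrix (Fin n) (Fin n) A.Alg}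
    (hM : IsHomogMatrix ν k M) (hN : IsHomogMatrix ν k N) : IsHomogMatrix ν k (M + N) :=
  fun i j => add_mem (hM i j) (hN i j)

theorem IsHomogMatrix.mul {ν : Fin n → ZMod m} {k l : ZMod m}
    {M N : Matrix (Fin n) (Fin n) A.Alg}
    (hM : IsHomogMatrix ν k M) (hN : IsHomogMatrix ν l N) : IsHomogMatrix ν (k + l) (M * N) := by
  intro i j
  rw [Matrix.mul_apply]
  refine sum_mem fun s _ => ?_
  have h := A.mul_mem_homog (hM i s) (hN s j)
  rwa [show ν i - ν s + k + (ν s - ν j + l) = ν i - ν j + (k + l) by ring] at h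

theorem isHomogMatrix_one (ν : Fin n → ZMod m) :
    IsHomogMatrix ν 0 (1 : Matrix (Fin n) (Fin n) A.Alg) := by
  intro i j
  by_cases h : i = j
  · subst h
    simpa using A.one_mem_homog
  · rw [Matrix.one_apply_ne h]
    exact zero_mem _

/-- Upper unitriangular homogeneous matrices of degree `0` with entries in a subalgebra `S`. -/
structure IsUnipotent (S : Subalgebra (ZMod 2) A.Alg) (ν : Fin n → ZMod m)
    (M : Matrix (Fin n) (Fin n) A.Alg) : Prop where
  lower : ∀ i j, j < i → M i j = 0
  diag : ∀ i, M i i = 1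
  mem : ∀ i j, M i j ∈ S
  homog : IsHomogMatrix ν 0 M

theorem IsUnipotent.one {S : Subalgebra (ZMod 2) A.Alg} {ν : Fin n → ZMod m} :
    IsUnipotent S ν (1 : Matrix (Fin n) (Fin n) A.Alg) where
  lower i j h := Matrix.one_apply_ne h.ne'
  diag i := Matrix.one_apply_eq i
  mem i j := by
    rw [Matrix.one_apply]
    split_ifs
    · exact one_mem _
    · exact zero_mem _
  homog := isHomogMatrix_one ν

theorem IsUnipotent.mul {S : Subalgebra (ZMod 2) A.Alg} {ν : Fin n → ZMod m}
    {M N : Matrix (Fin n) (Fin n) A.Alg} (hM : IsUnipotent S ν M) (hN : IsUnipotent S ν N) :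
    IsUnipotent S ν (M * N) where
  lower i j h := by
    rw [Matrix.mul_apply]
    refine Finset.sum_eq_zero fun s _ => ?_
    rcases lt_or_ge s i with hs | hs
    · rw [hM.lower i s hs, zero_mul]
    · rw [hN.lower s j (lt_of_lt_of_le h hs), mul_zero]
  diag i := by
    rw [Matrix.mul_apply, Finset.sum_eq_single i, hM.diag, hN.diag, one_mul]
    · intro s _ hs
      rcases lt_or_gt_of_ne hs with hs | hs
      · rw [hM.lower i s hs, zero_mul]
      · rw [hN.lower s i hs, mul_zero]
    · simp
  mem i j := by
    rw [Matrix.mul_apply]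
    exact sum_mem fun s _ => mul_mem (hM.mem i s) (hN.mem s j)
  homog := by simpa using hM.homog.mul hN.homog

/-- `1 - M` is strictly upper triangular, so each further factor moves the support one diagonal up.
-/
theorem IsUnipotent.pow_one_sub_apply {S : Subalgebra (ZMod 2) A.Alg} {ν : Fin n → ZMod m}
    {M : Matrix (Fin n) (Fin n) A.Alg} (hM : IsUnipotent S ν M) (k : ℕ) (i j : Fin n)
    (h : (j : ℕ) < i + k) : ((1 - M) ^ k) i j = 0 := by
  induction k generalizing j with
  | zero => rw [pow_zero, Matrix.one_apply_ne]; rintro rfl; simp at h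
  | succ k ih =>
    rw [pow_succ, Matrix.mul_apply]
    refine Finset.sum_eq_zero fun s _ => ?_
    by_cases hs : (s : ℕ) < i + k
    · rw [ih s hs, zero_mul]
    · have hjs : j ≤ s := by rw [Fin.le_def]; omega
      rw [Matrix.sub_apply]
      rcases hjs.lt_or_eq with hjs | rfl
      · rw [hM.lower s j hjs, Matrix.one_apply_ne hjs.ne', sub_zero, mul_zero]
      · rw [hM.diag, Matrix.one_apply_eq, sub_self, mul_zero]

theorem IsUnipotent.pow_one_sub {S : Subalgebra (ZMod 2) A.Alg} {ν : Fin n → ZMod m}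
    {M : Matrix (Fin n) (Fin n) A.Alg} (hM : IsUnipotent S ν M) : (1 - M) ^ n = 0 := by
  ext i j
  exact hM.pow_one_sub_apply n i j (by omega)

/-- The inverse of a unipotent matrix, as a finite geometric series. -/
noncomputable def geom (M : Matrix (Fin n) (Fin n) A.Alg) : Matrix (Fin n) (Fin n) A.Alg :=
  ∑ k ∈ Finset.range n, (1 - M) ^ k

theorem IsUnipotent.mul_geom {S : Subalgebra (ZMod 2) A.Alg} {ν : Fin n → ZMod m}
    {M : Matrix (Fin n) (Fin n) A.Alg} (hM : IsUnipotent S ν M) : M * geom M = 1 := by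
  have h := mul_neg_geom_sum (1 - M) n
  rwa [hM.pow_one_sub, sub_sub_cancel, sub_zero] at h

theorem IsUnipotent.geom_mul {S : Subalgebra (ZMod 2) A.Alg} {ν : Fin n → ZMod m}
    {M : Matrix (Fin n) (Fin n) A.Alg} (hM : IsUnipotent S ν M) : geom M * M = 1 := by
  have h := geom_sum_mul_neg (1 - M) n
  rwa [hM.pow_one_sub, sub_sub_cancel, sub_zero] at h

/-- Inverses must not leave `S`: the subalgebra later bounds the rank of the generators that occur
in conjugating matrices, which keeps the change of generators triangular. -/
theorem IsUnipotent.geom {S : Subalgebra (ZMod 2) A.Alg} {ν : Fin n → ZMod m}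
    {M : Matrix (Fin n) (Fin n) A.Alg} (hM : IsUnipotent S ν M) : IsUnipotent S ν (geom M) := by
  have hmem (k : ℕ) : (∀ i j, ((1 - M) ^ k) i j ∈ S) ∧ IsHomogMatrix ν 0 ((1 - M) ^ k) := by
    induction k with
    | zero => exact ⟨IsUnipotent.one.mem (ν := ν), isHomogMatrix_one ν⟩
    | succ k ih =>
      refine ⟨fun i j => ?_, ?_⟩
      · rw [pow_succ, Matrix.mul_apply]
        exact sum_mem fun s _ => mul_mem (ih.1 i s)
          (sub_mem (IsUnipotent.one.mem (ν := ν) s j) (hM.mem s j))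
      · rw [pow_succ]
        have h := ih.2.mul (k := 0) (l := 0) (N := 1 - M)
          fun i j => sub_mem (isHomogMatrix_one ν i j) (hM.homog i j)
        rwa [add_zero] at h
  refine ⟨fun i j h => ?_, fun i => ?_, fun i j => ?_, fun i j => ?_⟩
  · rw [BasedAlg.geom, Matrix.sum_apply]
    exact Finset.sum_eq_zero fun k _ => hM.pow_one_sub_apply k i j (by rw [Fin.lt_def] at h; omega)
  · have hn : 0 ∈ Finset.range n := Finset.mem_range.2 (lt_of_le_of_lt (Nat.zero_le _) i.2)
    rw [BasedAlg.geom, Matrix.sum_apply, Finset.sum_eq_single_of_mem 0 hn, pow_zero,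
      Matrix.one_apply_eq]
    exact fun k _ hk => hM.pow_one_sub_apply k i i (by omega)
  · rw [BasedAlg.geom, Matrix.sum_apply]
    exact sum_mem fun k _ => (hmem k).1 i j
  · rw [BasedAlg.geom, Matrix.sum_apply]
    exact sum_mem fun k _ => (hmem k).2 i j

/-- `u` behaves like the matrix of a path from a vertex with matrix `M` to one with matrix `M'`. -/
structure IsTransport (S : Subalgebra (ZMod 2) A.Alg) (ν : Fin n → ZMod m)
    (M M' : Matrix (Fin n) (Fin n) A.Alg) (u : (Matrix (Fin n) (Fin n) A.Alg)ˣ) : Prop where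
  diff : (u : Matrix (Fin n) (Fin n) A.Alg).map A.diff = M' * u + u * M
  unip : IsUnipotent S ν (u : Matrix (Fin n) (Fin n) A.Alg)
  unip_inv : IsUnipotent S ν (↑u⁻¹ : Matrix (Fin n) (Fin n) A.Alg)

variable {S : Subalgebra (ZMod 2) A.Alg} {ν : Fin n → ZMod m}
  {M M' M'' : Matrix (Fin n) (Fin n) A.Alg} {u u' : (Matrix (Fin n) (Fin n) A.Alg)ˣ}

/-- The two terms containing the matrix `M'` of the intermediate vertex are equal and cancel. -/
theorem IsTransport.mul (h' : IsTransport S ν M' M'' u') (h : IsTransport S ν M M' u) :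
    IsTransport S ν M M'' (u' * u) where
  diff := by
    rw [Units.val_mul, diff_matrix_mul, h.diff, h'.diff, add_mul, mul_add, ← add_assoc,
      add_assoc _ _ (_ * (M' * _)), mul_assoc _ M', matrix_add_self, add_zero, mul_assoc, mul_assoc]
  unip := h'.unip.mul h.unip
  unip_inv := by rw [mul_inv_rev]; exact h.unip_inv.mul h'.unip_inv

/-- Differentiate `u⁻¹ u = 1` and multiply by `u⁻¹` on the right. -/
theorem IsTransport.inv (h : IsTransport S ν M M' u) : IsTransport S ν M' M u⁻¹ where
  diff := by
    have h1 : ((↑u⁻¹ : Matrix (Fin n) (Fin n) A.Alg) * (u : Matrix (Fin n) (Fin n) A.Alg)).map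
        A.diff = 0 := by
      rw [Units.inv_mul, diff_matrix_one]
    rw [diff_matrix_mul, h.diff] at h1
    have h2 := congrArg (· * (↑u⁻¹ : Matrix (Fin n) (Fin n) A.Alg)) h1
    simp only [add_mul, mul_add, mul_assoc, Units.mul_inv, mul_one, zero_mul] at h2
    rw [← mul_assoc _ (u : Matrix (Fin n) (Fin n) A.Alg), Units.inv_mul, one_mul] at h2
    rw [← sub_eq_zero, sub_eq_add_neg, neg_eq_of_add_eq_zero_left (matrix_add_self _),
      add_comm (M * _)]
    exact h2
  unip := h.unip_inv
  unip_inv := by rw [inv_inv]; exact h.unip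

theorem IsUnipotent.exists_isTransport (h : IsUnipotent S ν M'')
    (hd : M''.map A.diff = M' * M'' + M'' * M) : ∃ u : (Matrix (Fin n) (Fin n) A.Alg)ˣ,
    (u : Matrix (Fin n) (Fin n) A.Alg) = M'' ∧
      (↑u⁻¹ : Matrix (Fin n) (Fin n) A.Alg) = BasedAlg.geom M'' ∧ IsTransport S ν M M' u :=
  ⟨⟨M'', BasedAlg.geom M'', h.mul_geom, h.geom_mul⟩, rfl, rfl, hd, h, h.geom⟩

end BasedAlg

/-! ### Paths in a pentagon -/

/-- The product of the values on the edges of a pentagon, along the path that leads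
counter-clockwise from the last vertex to vertex `k`. -/
def pentagonPath {G : Type*} [Mul G] (y : Fin 5 → G) : Fin 5 → G :=
  ![y 0, y 1 * y 0, y 2 * (y 1 * y 0), y 3 * (y 2 * (y 1 * y 0)),
    y 4 * (y 3 * (y 2 * (y 1 * y 0)))]

/-- The number of edges of the counter-clockwise path from `v` to `w` in a pentagon. -/
def pentagonLength (v w : ℕ) (full : Bool) : ℕ :=
  if v = w then if full then 5 else 0 else (w + 5 - v) % 5

set_option maxHeartbeats 2000000 in
/-- The products along the two paths that join two vertices of a pentagon. -/
theorem pentagon_paths {G : Type*} [Group G] (y : Fin 5 → G) (v w : Fin 5) (full : Bool) :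
    ∃ x, (x = pentagonPath y 4 ∨ x = (pentagonPath y 4)⁻¹) ∧
      (((([0, 1, 2, 3, 4].rotate (v + 1)).take (pentagonLength v w full)).map y).reverse.prod =
        pentagonPath y w * (pentagonPath y v)⁻¹ ∧
      ((([0, 1, 2, 3, 4].rotate (v + 1)).drop (pentagonLength v w full)).map fun k => (y k)⁻¹).prod =
        pentagonPath y w * x * (pentagonPath y v)⁻¹ ∨
      ((([0, 1, 2, 3, 4].rotate (v + 1)).take (pentagonLength v w full)).map y).reverse.prod =
        pentagonPath y w * x * (pentagonPath y v)⁻¹ ∧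
      ((([0, 1, 2, 3, 4].rotate (v + 1)).drop (pentagonLength v w full)).map fun k => (y k)⁻¹).prod =
        pentagonPath y w * (pentagonPath y v)⁻¹) := by
  -- One of the two paths crosses the base vertex 4 and picks up a full turn `x` there. It is the
  -- clockwise path for `v < w` and the counter-clockwise one for `v > w`; for `v = w` the flag
  -- decides.
  rcases lt_trichotomy v w with h | rfl | h
  · refine ⟨_, Or.inr rfl, Or.inl ?_⟩
    fin_cases v <;> fin_cases w <;> first | exact absurd h (by decide) | skip
    all_goals simp [pentagonPath, pentagonLength, mul_assoc]
  · cases full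
    · refine ⟨_, Or.inr rfl, Or.inl ?_⟩
      fin_cases v <;> simp [pentagonPath, pentagonLength, mul_assoc]
    · refine ⟨_, Or.inl rfl, Or.inr ?_⟩
      fin_cases v <;> simp [pentagonPath, pentagonLength, mul_assoc]
  · refine ⟨_, Or.inl rfl, Or.inr ?_⟩
    fin_cases v <;> fin_cases w <;> first | exact absurd h (by decide) | skip
    all_goals simp [pentagonPath, pentagonLength, mul_assoc]

end LegendrianDGA

/-! ### The differential of a pentagonal cell and its normal form -/

namespace LegendrianDGA

namespace BasedAlg

variable {m : ℕ} {A : BasedAlg m} {n : ℕ} {S : Subalgebra (ZMod 2) A.Alg} {ν : Fin n → ZMod m}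

theorem isTransport_pentagonPath {V : Fin 5 → Matrix (Fin n) (Fin n) A.Alg}
    {y : Fin 5 → (Matrix (Fin n) (Fin n) A.Alg)ˣ}
    (hy : ∀ k, IsTransport S ν (V (k - 1)) (V k) (y k)) (k : Fin 5) :
    IsTransport S ν (V 4) (V k) (pentagonPath y k) := by
  -- The index is cyclic: `0 - 1 = 4` in `Fin 5`.
  have h0 : IsTransport S ν (V 4) (V 0) (y 0) := hy 0
  have h1 : IsTransport S ν (V 4) (V 1) (y 1 * y 0) := (hy 1).mul h0
  have h2 : IsTransport S ν (V 4) (V 2) (y 2 * (y 1 * y 0)) := (hy 2).mul h1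
  have h3 : IsTransport S ν (V 4) (V 3) (y 3 * (y 2 * (y 1 * y 0))) := (hy 3).mul h2
  fin_cases k
  exacts [h0, h1, h2, h3, (hy 4).mul h3]

/-- The sum of the products along the two paths between vertices `v` and `w` of a pentagon, and
its normal form `1 + W`, where `W` is the product along the boundary in one of the two
directions. -/
theorem exists_normal_form {V : Fin 5 → Matrix (Fin n) (Fin n) A.Alg}
    {y : Fin 5 → (Matrix (Fin n) (Fin n) A.Alg)ˣ}
    (hy : ∀ k, IsTransport S ν (V (k - 1)) (V k) (y k))
    {W : (Matrix (Fin n) (Fin n) A.Alg)ˣ}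
    (hW : pentagonPath y 4 = W ∨ (pentagonPath y 4)⁻¹ = W) (v w : Fin 5) (full : Bool)
    {P : Matrix (Fin n) (Fin n) A.Alg}
    (hP : P = ↑((([0, 1, 2, 3, 4].rotate (v + 1)).take
        (pentagonLength v w full)).map y).reverse.prod +
      ↑((([0, 1, 2, 3, 4].rotate (v + 1)).drop (pentagonLength v w full)).map fun k => (y k)⁻¹).prod) :
    (∃ X X' : (Matrix (Fin n) (Fin n) A.Alg)ˣ, IsTransport S ν (V v) (V w) X ∧
      IsTransport S ν (V v) (V w) X' ∧ P = X + X') ∧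
    ∃ G H : (Matrix (Fin n) (Fin n) A.Alg)ˣ, IsTransport S ν (V w) (V 4) G ∧
      IsTransport S ν (V 4) (V v) H ∧ G * P * H = 1 + W := by
  obtain ⟨x, hx, h⟩ := pentagon_paths y v w full
  have hv := isTransport_pentagonPath hy v
  have hw := isTransport_pentagonPath hy w
  have h4 := isTransport_pentagonPath hy 4
  have hxt : IsTransport S ν (V 4) (V 4) x := by
    rcases hx with rfl | rfl
    exacts [h4, h4.inv]
  have hP' : P = ↑(pentagonPath y w * (pentagonPath y v)⁻¹) +
      ↑(pentagonPath y w * x * (pentagonPath y v)⁻¹) := by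
    rcases h with ⟨h1, h2⟩ | ⟨h1, h2⟩
    · rw [hP, h1, h2]
    · rw [hP, h1, h2, add_comm]
  refine ⟨⟨_, _, hw.mul hv.inv, (hw.mul hxt).mul hv.inv, hP'⟩, ?_⟩
  have hxW : x = W ∨ x⁻¹ = W := by
    rcases hx with rfl | rfl
    · exact hW
    · rw [inv_inv]; exact hW.symm
  rcases hxW with rfl | hxW
  · refine ⟨(pentagonPath y w)⁻¹, pentagonPath y v, hw.inv, hv, ?_⟩
    rw [hP', mul_add, add_mul, ← Units.val_mul, ← Units.val_mul, ← Units.val_mul, ← Units.val_mul]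
    simp [mul_assoc]
  -- Here the full turn is the inverse of `W`. The extra factor `x⁻¹` turns `1 + x` into `x⁻¹ + 1`.
  · refine ⟨x⁻¹ * (pentagonPath y w)⁻¹, pentagonPath y v, hxt.inv.mul hw.inv, hv, ?_⟩
    rw [hP', mul_add, add_mul, ← Units.val_mul, ← Units.val_mul, ← Units.val_mul, ← Units.val_mul,
      add_comm, ← hxW]
    simp [mul_assoc]

/-- The differential of the matrix of a `2`-cell has differential zero. -/
theorem diff_cell_eq_zero {V V' C P : Matrix (Fin n) (Fin n) A.Alg}
    (hV : V.map A.diff = V * V) (hV' : V'.map A.diff = V' * V')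
    (hP : ∃ X X' : (Matrix (Fin n) (Fin n) A.Alg)ˣ, IsTransport S ν V V' X ∧
      IsTransport S ν V V' X' ∧ P = X + X') (hC : C.map A.diff = V' * C + C * V + P) :
    (V' * C + C * V + P).map A.diff = 0 := by
  have hdP : P.map A.diff = V' * P + P * V := by
    obtain ⟨X, X', hX, hX', rfl⟩ := hP
    rw [diff_matrix_add, hX.diff, hX'.diff, mul_add, add_mul]
    abel
  rw [diff_matrix_add, diff_matrix_add, diff_matrix_mul, diff_matrix_mul, hC, hV, hV', hdP]
  -- The ring normalizer does not use characteristic 2, so the terms are grouped explicitly into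
  -- doubles.
  have e : V' * V' * C + V' * (V' * C + C * V + P) + ((V' * C + C * V + P) * V + C * (V * V)) +
      (V' * P + P * V) = (V' * V' * C + V' * V' * C) + (V' * C * V + V' * C * V) +
        (V' * P + V' * P) + (C * V * V + C * V * V) + (P * V + P * V) := by
    noncomm_ring
  rw [e]
  simp only [matrix_add_self, add_zero]

/-- Conjugation of the matrix of a `2`-cell by transports. -/
theorem diff_conj {V V' V₀ C P W : Matrix (Fin n) (Fin n) A.Alg}
    {G H : (Matrix (Fin n) (Fin n) A.Alg)ˣ} (hG : IsTransport S ν V' V₀ G)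
    (hH : IsTransport S ν V₀ V H) (hP : G * P * H = W) (hC : C.map A.diff = V' * C + C * V + P) :
    (G * C * H : Matrix (Fin n) (Fin n) A.Alg).map A.diff =
      V₀ * (G * C * H) + (G * C * H) * V₀ + W := by
  rw [diff_matrix_mul, diff_matrix_mul, hC, hG.diff, hH.diff, ← hP]
  set g : Matrix (Fin n) (Fin n) A.Alg := ↑G
  set h : Matrix (Fin n) (Fin n) A.Alg := ↑H
  have e : ((V₀ * g + g * V') * C + g * (V' * C + C * V + P)) * h + g * C * (V * h + h * V₀) =
      V₀ * (g * C * h) + g * C * h * V₀ + g * P * h + (g * V' * C * h + g * V' * C * h) +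
        (g * C * V * h + g * C * V * h) := by
    noncomm_ring
  rw [e]
  simp only [matrix_add_self, add_zero]

end BasedAlg

/-! ### The explicit four by four matrices -/

section Model

variable {R : Type*} [Ring R]

/-- The matrix of a vertex at which only cusp edges end. -/
def vertexM (x y : R) : Matrix (Fin 4) (Fin 4) R := !![0, x, 0, 0; 0, 0, 0, 0; 0, 0, 0, y; 0, 0, 0, 0]

/-- The matrix of a swallowtail vertex on the crossing arc. -/
def hatM (x y : R) : Matrix (Fin 4) (Fin 4) R := !![0, x, x, 0; 0, 0, 0, y; 0, 0, 0, y; 0, 0, 0, 0]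

/-- The matrix of an edge below a cusp edge. -/
def cuspM (x y : R) : Matrix (Fin 4) (Fin 4) R := !![1, x, 0, 0; 0, 1, 0, 0; 0, 0, 1, y; 0, 0, 0, 1]

/-- The matrix of an edge that cuts off a corner. -/
def shearM : Matrix (Fin 4) (Fin 4) R := !![1, 0, 0, 0; 0, 1, 1, 0; 0, 0, 1, 0; 0, 0, 0, 1]

/-- The matrix of the crossing arc. -/
def arcM (p q r s t : R) : Matrix (Fin 4) (Fin 4) R :=
  !![1, p, q, r; 0, 1, 0, s; 0, 0, 1, t; 0, 0, 0, 1]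

/-- The product of the matrices along the boundary of an inner `2`-cell. -/
theorem prod_boundary (h2 : ∀ x : R, x + x = 0) (x y p q r s t : R) :
    cuspM x 0 * (shearM * (arcM p q r s t * (shearM * cuspM 0 y))) =
      arcM (p + x) (p + q) (r + x * (s + t) + (p + q) * y) (s + t) (t + y) := by
  -- The two shears contribute `1 + 1 = 0` at sheets 2 and 3, so the product has again the shape of
  -- an arc matrix.
  have h1 : shearM * (arcM p q r s t * shearM) = arcM p (p + q) r (s + t) t := by
    ext i j
    fin_cases i <;> fin_cases j <;> simp [shearM, arcM, h2]
  have h3 : cuspM x 0 * (arcM p (p + q) r (s + t) t * cuspM 0 y) =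
      arcM (p + x) (p + q) (r + x * (s + t) + (p + q) * y) (s + t) (t + y) := by
    ext i j
    fin_cases i <;> fin_cases j <;> simp [cuspM, arcM]
    all_goals abel
  rw [← h3, ← h1]
  simp only [mul_assoc]

end Model

namespace BasedAlg

variable {m : ℕ} {A : BasedAlg m}

theorem map_vertexM {x y : A.Alg} (hx : A.diff x = 0) (hy : A.diff y = 0) :
    (vertexM x y).map A.diff = vertexM x y * vertexM x y := by
  ext i j
  fin_cases i <;> fin_cases j <;> simp [vertexM, Matrix.mul_apply, Fin.sum_univ_four, hx, hy]

/-- Both sides are zero: the only candidate for a nonzero entry of the square is `x * y + x * y`. -/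
theorem map_hatM {x y : A.Alg} (hx : A.diff x = 0) (hy : A.diff y = 0) :
    (hatM x y).map A.diff = hatM x y * hatM x y := by
  ext i j
  fin_cases i <;> fin_cases j <;>
    simp [hatM, Matrix.mul_apply, Fin.sum_univ_four, hx, hy, A.add_self]

theorem map_cuspM {x y u v u' v' : A.Alg} (hx : A.diff x = u + u') (hy : A.diff y = v + v') :
    (cuspM x y).map A.diff = vertexM u v * cuspM x y + cuspM x y * vertexM u' v' := by
  ext i j
  fin_cases i <;> fin_cases j <;>
    simp [cuspM, vertexM, hx, hy, diff_one]

/-- The shear intertwines the two vertex matrices, so the two products on the right cancel, and the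
shear itself is constant. -/
theorem map_shearM' (x y : A.Alg) :
    (shearM : Matrix (Fin 4) (Fin 4) A.Alg).map A.diff =
      vertexM x y * shearM + shearM * hatM x y := by
  ext i j
  fin_cases i <;> fin_cases j <;>
    simp [shearM, hatM, vertexM, diff_one, A.add_self]

end BasedAlg
end LegendrianDGA

/-! ### Matrices at the vertices of the sphere -/

namespace LegendrianDGA
open Front ExV ExE ExF

namespace Front

variable {D : Front} {K K' : Type} [Fintype K] [DecidableEq K] [Fintype K'] [DecidableEq K']
  (e : K ≃ K') (v : D.V) (lim : K' → Fin (D.vnum v)) (lt : K' → K' → Prop) [DecidableRel lt]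

omit [DecidableEq K] [DecidableEq K'] in
theorem rank_equiv (r : ℕ) (p : K) [DecidableRel fun x y => lt (e x) (e y)] :
    Rank v (fun x => lim (e x)) (fun x y => lt (e x) (e y)) r p ↔ Rank v lim lt r (e p) := by
  have : (Finset.univ.filter fun q => lim (e q) = lim (e p) ∧ lt (e q) (e p)).card =
      (Finset.univ.filter fun q => lim q = lim (e p) ∧ lt q (e p)).card := by
    rw [← Finset.card_map e.toEmbedding]
    congr 1
    ext q
    simp
  unfold Rank
  rw [this]

omit [DecidableEq K] [DecidableEq K'] in
theorem eMat_equiv (r s : ℕ) [DecidableRel fun x y => lt (e x) (e y)] :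
    eMat v (fun x => lim (e x)) (fun x y => lt (e x) (e y)) r s =
      (eMat v lim lt r s).submatrix e e := by
  ext p q
  simp only [eMat, Matrix.of_apply, Matrix.submatrix_apply, rank_equiv e v lim lt]

omit [DecidableEq K] [DecidableEq K'] in
theorem hatMat_equiv (r s : ℕ) [DecidableRel fun x y => lt (e x) (e y)] :
    hatMat v (fun x => lim (e x)) (fun x y => lt (e x) (e y)) r s =
      (hatMat v lim lt r s).submatrix e e := by
  ext p q
  simp only [hatMat, Matrix.of_apply, Matrix.submatrix_apply, rank_equiv e v lim lt]

/-- Above the crossing arc the order of the sheets depends on which side is labelled `S`.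
Relabelling reduces either order to the standard one on `Fin 4`. -/
theorem arcMat_equiv (s : Bool) [DecidableRel fun x y => lt (e x) (e y)] :
    arcMat v (fun x => lim (e x)) (fun x y => lt (e x) (e y)) s =
      (arcMat v lim lt s).submatrix e e := by
  have h1 : (1 : Matrix K K D.CellAlg) = (1 : Matrix K' K' D.CellAlg).submatrix e e :=
    (Matrix.submatrix_one_equiv e).symm
  unfold arcMat
  simp only [eMat_equiv e v lim lt, hatMat_equiv e v lim lt, h1]
  split_ifs <;>
    simp only [← Matrix.submatrix_add, ← Pi.add_apply, Matrix.submatrix_mul_equiv]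

end Front

/-- The front of the two-swallowtail sphere. -/
abbrev Sphere : Front := swallowtailSphere

/-- The generators of the `0`-cells `A1` and `A2`. -/
noncomputable def vGen (v : ExV) : Sphere.CellAlg := a (D := Sphere) v (0 : Fin 2) (1 : Fin 2)

/-- The components above `A1` in the closures of the four sheets of an inner cell. -/
def limA1 : Fin 4 → Fin 2 := ![0, 0, 0, 1]

/-- The components above `A2` in the closures of the four sheets of an inner cell. -/
def limA2 : Fin 4 → Fin 2 := ![0, 1, 1, 1]

/-- The components above `top` and `bot` in the closures of the four sheets of an inner cell. -/
def limTop : Fin 4 → Fin 2 := ![0, 0, 1, 1]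

theorem a_A1 (i j : Fin 2) :
    a (D := Sphere) A1 i j = if i = 0 ∧ j = 1 then vGen A1 else 0 := by
  fin_cases i <;> fin_cases j <;> rfl

theorem a_A2 (i j : Fin 2) :
    a (D := Sphere) A2 i j = if i = 0 ∧ j = 1 then vGen A2 else 0 := by
  fin_cases i <;> fin_cases j <;> rfl

theorem rank_A1 : ∀ (r : Fin 3) (p : Fin 4),
    Rank (D := Sphere) A1 limA1 (· < ·) r p ↔ p = r.castSucc := by decide

theorem rank_A2 : ∀ (r : Fin 3) (p : Fin 4),
    Rank (D := Sphere) A2 limA2 (· < ·) r p ↔ p = r.succ := by decide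

theorem isUp_A1 : IsUp (D := Sphere) A1 := by decide

theorem not_isUp_A2 : ¬ IsUp (D := Sphere) A2 := by decide

/-- Under either label, conjugation by the elementary matrix spreads the 1 and the generator evenly
over the two crossing sheets. The result does not depend on the label. -/
theorem arcMat_A1 (s : Bool) : arcMat (D := Sphere) A1 limA1 (· < ·) s = hatM 1 (vGen A1) := by
  have h0 := rank_A1 0
  have h1 := rank_A1 1
  have h2 := rank_A1 2
  simp only [Fin.isValue, Fin.val_zero, Fin.val_one, Fin.val_two] at h0 h1 h2
  ext i j
  cases s <;>
  simp only [arcMat, isUp_A1, if_true, eMat, hatMat, h0, h1, h2, a_A1, Bool.false_eq_true,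
    if_false] <;>
  fin_cases i <;> fin_cases j <;>
    simp [hatM, limA1, Matrix.mul_apply, Fin.sum_univ_four, Matrix.one_apply]

theorem arcMat_A2 (s : Bool) : arcMat (D := Sphere) A2 limA2 (· < ·) s = hatM (vGen A2) 1 := by
  have h0 := rank_A2 0
  have h1 := rank_A2 1
  have h2 := rank_A2 2
  simp only [Fin.isValue, Fin.val_zero, Fin.val_one, Fin.val_two] at h0 h1 h2
  ext i j
  cases s <;>
  simp only [arcMat, not_isUp_A2, if_true, eMat, hatMat, h0, h1, h2, a_A2, Bool.false_eq_true,
    if_false] <;>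
  fin_cases i <;> fin_cases j <;>
    simp [hatM, limA2, Matrix.mul_apply, Fin.sum_univ_four, Matrix.one_apply]

/-- The correction term that distinguishes `S` from `T` involves sheets above the upward swallowtail
point, and there are none. -/
theorem stMat_A1 (s : Bool) : stMat (D := Sphere) A1 limA1 (· < ·) s = shearM := by
  have h0 := rank_A1 0
  have h1 := rank_A1 1
  have h2 := rank_A1 2
  simp only [Fin.isValue, Fin.val_zero, Fin.val_one, Fin.val_two] at h0 h1 h2
  ext i j
  cases s <;>
  simp only [stMat, isUp_A1, if_true, eMat, hatMat, h0, h1, h2, a_A1, Bool.false_eq_true,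
    if_false] <;>
  fin_cases i <;> fin_cases j <;>
    simp [shearM, limA1, Matrix.mul_apply]

/-- Here the correction term would need sheets below the downward swallowtail point. -/
theorem stMat_A2 (s : Bool) : stMat (D := Sphere) A2 limA2 (· < ·) s = shearM := by
  have h0 := rank_A2 0
  have h1 := rank_A2 1
  have h2 := rank_A2 2
  simp only [Fin.isValue, Fin.val_zero, Fin.val_one, Fin.val_two] at h0 h1 h2
  ext i j
  cases s <;>
  simp only [stMat, not_isUp_A2, if_true, eMat, hatMat, h0, h1, h2, a_A2, Bool.false_eq_true,
    if_false] <;>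
  fin_cases i <;> fin_cases j <;>
    simp [shearM, limA2, Matrix.mul_apply, Fin.sum_univ_four]

theorem regionMat_A1 : regionMat (D := Sphere) A1 limA1 (· < ·) = vertexM 1 (vGen A1) := by
  have h0 := rank_A1 0
  have h1 := rank_A1 1
  simp only [Fin.isValue, Fin.val_zero, Fin.val_one] at h0 h1
  ext i j
  simp only [regionMat, isUp_A1, if_true, hatMat, h0, h1, a_A1, Matrix.of_apply]
  fin_cases i <;> fin_cases j <;> simp [vertexM, limA1]

theorem regionMat_A2 : regionMat (D := Sphere) A2 limA2 (· < ·) = vertexM (vGen A2) 1 := by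
  have h1 := rank_A2 1
  have h2 := rank_A2 2
  simp only [Fin.isValue, Fin.val_two, Fin.val_one] at h1 h2
  ext i j
  simp only [regionMat, not_isUp_A2, if_false, hatMat, h1, h2, a_A2, Matrix.of_apply]
  fin_cases i <;> fin_cases j <;> simp [vertexM, limA2]

theorem vMat_top : vMat (D := Sphere) top limTop (· < ·) = vertexM 1 1 := by
  ext i j
  fin_cases i <;> fin_cases j <;> rfl

theorem vMat_bot : vMat (D := Sphere) bot limTop (· < ·) = vertexM 1 1 := by
  ext i j
  fin_cases i <;> fin_cases j <;> rfl

/-- The generators of the `1`-cells. -/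
noncomputable def cuspGen : ExE → Sphere.CellAlg
  | B1 => b (D := Sphere) B1 (1 : Fin 3) (2 : Fin 3)
  | B2 => b (D := Sphere) B2 (1 : Fin 3) (2 : Fin 3)
  | B3 => b (D := Sphere) B3 (0 : Fin 3) (1 : Fin 3)
  | B4 => b (D := Sphere) B4 (0 : Fin 3) (1 : Fin 3)
  | _ => 0

/-- The generators of the crossing arc. -/
noncomputable def arcGen (i j : Fin 4) : Sphere.CellAlg := b (D := Sphere) B5 i j

end LegendrianDGA

/-! ### Edges and vertices of the two pentagons -/

namespace LegendrianDGA
open Front ExV ExE ExF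

section Matrices

variable (χ : Sphere.Choices)

theorem b_B1 (i j : Fin 3) :
    b (D := Sphere) B1 i j = if i = 1 ∧ j = 2 then cuspGen B1 else 0 := by
  fin_cases i <;> fin_cases j <;> rfl

theorem b_B2 (i j : Fin 3) :
    b (D := Sphere) B2 i j = if i = 1 ∧ j = 2 then cuspGen B2 else 0 := by
  fin_cases i <;> fin_cases j <;> rfl

theorem b_B3 (i j : Fin 3) :
    b (D := Sphere) B3 i j = if i = 0 ∧ j = 1 then cuspGen B3 else 0 := by
  fin_cases i <;> fin_cases j <;> rfl

theorem b_B4 (i j : Fin 3) :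
    b (D := Sphere) B4 i j = if i = 0 ∧ j = 1 then cuspGen B4 else 0 := by
  fin_cases i <;> fin_cases j <;> rfl

theorem one_add_arcGen : 1 + Matrix.of arcGen =
    arcM (arcGen 0 1) (arcGen 0 2) (arcGen 0 3) (arcGen 1 3) (arcGen 2 3) := by
  ext i j
  have h0 : arcGen i j = !![0, arcGen 0 1, arcGen 0 2, arcGen 0 3; 0, 0, 0, arcGen 1 3;
      0, 0, 0, arcGen 2 3; 0, 0, 0, 0] i j := by
    fin_cases i <;> fin_cases j <;> rfl
  rw [Matrix.add_apply, Matrix.of_apply, h0]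
  fin_cases i <;> fin_cases j <;> simp [arcM]

/-- The edges of the pentagon `Q` of an inner `2`-cell in counter-clockwise order. -/
def pentagonEdge : Fin 5 → Fin 3 × Bool :=
  ![(0, false), (0, true), (1, false), (1, true), (2, false)]

theorem qEdges_C3 : qEdges (D := Sphere) C3 = [0, 1, 2, 3, 4].map pentagonEdge := rfl

theorem qEdges_C4 : qEdges (D := Sphere) C4 = [0, 1, 2, 3, 4].map pentagonEdge := rfl

/-- The matrices of the vertices of the pentagon of `C3`. -/
noncomputable def vertexC3 : Fin 5 → Matrix (Fin 4) (Fin 4) Sphere.CellAlg :=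
  ![vertexM 1 (vGen A1), hatM 1 (vGen A1), hatM (vGen A2) 1, vertexM (vGen A2) 1, vertexM 1 1]

/-- The matrices of the edges of the pentagon of `C3`. -/
noncomputable def edgeC3 : Fin 5 → Matrix (Fin 4) (Fin 4) Sphere.CellAlg :=
  ![cuspM 0 (cuspGen B2), shearM,
    arcM (arcGen 0 2) (arcGen 0 1) (arcGen 0 3) (arcGen 2 3) (arcGen 1 3), shearM,
    cuspM (cuspGen B4) 0]

/-- The matrices of the vertices of the pentagon of `C4`. -/
noncomputable def vertexC4 : Fin 5 → Matrix (Fin 4) (Fin 4) Sphere.CellAlg :=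
  ![vertexM (vGen A2) 1, hatM (vGen A2) 1, hatM 1 (vGen A1), vertexM 1 (vGen A1), vertexM 1 1]

/-- The matrices of the edges of the pentagon of `C4`. -/
noncomputable def edgeC4 : Fin 5 → Matrix (Fin 4) (Fin 4) Sphere.CellAlg :=
  ![cuspM (cuspGen B3) 0, shearM,
    arcM (arcGen 0 1) (arcGen 0 2) (arcGen 0 3) (arcGen 1 3) (arcGen 2 3), shearM,
    cuspM 0 (cuspGen B1)]

theorem cornerClo_C3 : (∀ p : Fin 4, cornerClo (D := Sphere) C3 (0 : Fin 3) p = limA1 p) ∧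
    (∀ p : Fin 4, cornerClo (D := Sphere) C3 (1 : Fin 3) p = limA2 p) ∧
    ∀ p : Fin 4, cornerClo (D := Sphere) C3 (2 : Fin 3) p = limTop p := by
  refine ⟨?_, ?_, ?_⟩ <;> intro p <;> fin_cases p <;> rfl

theorem cornerClo_C4 : (∀ p : Fin 4, cornerClo (D := Sphere) C4 (0 : Fin 3) p = limA2 p) ∧
    (∀ p : Fin 4, cornerClo (D := Sphere) C4 (1 : Fin 3) p = limA1 p) ∧
    ∀ p : Fin 4, cornerClo (D := Sphere) C4 (2 : Fin 3) p = limTop p := by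
  refine ⟨?_, ?_, ?_⟩ <;> intro p <;> fin_cases p <;> rfl

theorem yMat_C3 (k : Fin 5) : yMat χ C3 (pentagonEdge k) = edgeC3 k := by
  have h0 : yMat χ C3 ((0 : Fin 3), false) = edgeC3 0 := by
    refine Matrix.ext fun (i j : Fin 4) => ?_
    change (1 : Matrix (Fin 4) (Fin 4) Sphere.CellAlg) i j +
      b (D := Sphere) B2 ((![0, 0, 1, 2] : Fin 4 → Fin 3) i) ((![0, 0, 1, 2] : Fin 4 → Fin 3) j) = _
    rw [b_B2]
    fin_cases i <;> fin_cases j <;> simp [edgeC3, cuspM]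
  have h1 : yMat χ C3 ((0 : Fin 3), true) = edgeC3 1 :=
    (congrArg (fun l : Fin 4 → Fin 2 => stMat (D := Sphere) A1 l (· < ·)
      (χ.label C3 (0 : Fin 3))) (funext cornerClo_C3.1)).trans (stMat_A1 _)
  have h2 : yMat χ C3 ((1 : Fin 3), false) = edgeC3 2 := by
    refine Matrix.ext fun (i j : Fin 4) => ?_
    change (1 : Matrix (Fin 4) (Fin 4) Sphere.CellAlg) i j +
      arcGen ((![0, 2, 1, 3] : Fin 4 → Fin 4) i) ((![0, 2, 1, 3] : Fin 4 → Fin 4) j) = _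
    have h0 (i j : Fin 4) := congrFun (congrFun one_add_arcGen i) j
    simp only [Matrix.add_apply, Matrix.of_apply] at h0
    -- The generators of the arc are numbered as above `C4`. Above `C3` the two crossing sheets are
    -- exchanged, and the identity matrix is invariant under this exchange.
    have h : (1 : Matrix (Fin 4) (Fin 4) Sphere.CellAlg) i j =
        (1 : Matrix (Fin 4) (Fin 4) Sphere.CellAlg) ((![0, 2, 1, 3] : Fin 4 → Fin 4) i)
          ((![0, 2, 1, 3] : Fin 4 → Fin 4) j) := by
      fin_cases i <;> fin_cases j <;> simp [Matrix.one_apply]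
    rw [h, h0]
    fin_cases i <;> fin_cases j <;> simp [arcM, edgeC3]
  have h3 : yMat χ C3 ((1 : Fin 3), true) = edgeC3 3 :=
    (congrArg (fun l : Fin 4 → Fin 2 => stMat (D := Sphere) A2 l (· < ·)
      (χ.label C3 (1 : Fin 3))) (funext cornerClo_C3.2.1)).trans (stMat_A2 _)
  have h4 : yMat χ C3 ((2 : Fin 3), false) = edgeC3 4 := by
    refine Matrix.ext fun (i j : Fin 4) => ?_
    change (1 : Matrix (Fin 4) (Fin 4) Sphere.CellAlg) i j +
      b (D := Sphere) B4 ((![0, 1, 2, 2] : Fin 4 → Fin 3) i) ((![0, 1, 2, 2] : Fin 4 → Fin 3) j) = _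
    rw [b_B4]
    fin_cases i <;> fin_cases j <;> simp [edgeC3, cuspM]
  fin_cases k
  exacts [h0, h1, h2, h3, h4]

theorem yMat_C4 (k : Fin 5) : yMat χ C4 (pentagonEdge k) = edgeC4 k := by
  have h0 : yMat χ C4 ((0 : Fin 3), false) = edgeC4 0 := by
    refine Matrix.ext fun (i j : Fin 4) => ?_
    change (1 : Matrix (Fin 4) (Fin 4) Sphere.CellAlg) i j +
      b (D := Sphere) B3 ((![0, 1, 2, 2] : Fin 4 → Fin 3) i) ((![0, 1, 2, 2] : Fin 4 → Fin 3) j) = _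
    rw [b_B3]
    fin_cases i <;> fin_cases j <;> simp [edgeC4, cuspM]
  have h1 : yMat χ C4 ((0 : Fin 3), true) = edgeC4 1 :=
    (congrArg (fun l : Fin 4 → Fin 2 => stMat (D := Sphere) A2 l (· < ·)
      (χ.label C4 (0 : Fin 3))) (funext cornerClo_C4.1)).trans (stMat_A2 _)
  have h2 : yMat χ C4 ((1 : Fin 3), false) = edgeC4 2 := by
    refine Matrix.ext fun (i j : Fin 4) => ?_
    have h (i : Fin 4) : (![0, 1, 2, 3] : Fin 4 → Fin 4) i = i := by revert i; decide
    change (1 : Matrix (Fin 4) (Fin 4) Sphere.CellAlg) i j +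
      arcGen ((![0, 1, 2, 3] : Fin 4 → Fin 4) i) ((![0, 1, 2, 3] : Fin 4 → Fin 4) j) = _
    rw [h, h]
    exact congrFun (congrFun one_add_arcGen i) j
  have h3 : yMat χ C4 ((1 : Fin 3), true) = edgeC4 3 :=
    (congrArg (fun l : Fin 4 → Fin 2 => stMat (D := Sphere) A1 l (· < ·)
      (χ.label C4 (1 : Fin 3))) (funext cornerClo_C4.2.1)).trans (stMat_A1 _)
  have h4 : yMat χ C4 ((2 : Fin 3), false) = edgeC4 4 := by
    refine Matrix.ext fun (i j : Fin 4) => ?_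
    change (1 : Matrix (Fin 4) (Fin 4) Sphere.CellAlg) i j +
      b (D := Sphere) B1 ((![0, 0, 1, 2] : Fin 4 → Fin 3) i) ((![0, 0, 1, 2] : Fin 4 → Fin 3) j) = _
    rw [b_B1]
    fin_cases i <;> fin_cases j <;> simp [edgeC4, cuspM]
  fin_cases k
  exacts [h0, h1, h2, h3, h4]

theorem qvMat_C3 (k : Fin 5) : qvMat χ C3 (pentagonEdge k) = vertexC3 k := by
  have h0 : qvMat χ C3 ((0 : Fin 3), false) = vertexC3 0 :=
    (congrArg (fun l : Fin 4 → Fin 2 => regionMat (D := Sphere) A1 l (· < ·)) (funext cornerClo_C3.1)).trans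
      regionMat_A1
  have h1 : qvMat χ C3 ((0 : Fin 3), true) = vertexC3 1 :=
    (congrArg (fun l : Fin 4 → Fin 2 => arcMat (D := Sphere) A1 l (· < ·)
      (χ.label C3 (0 : Fin 3))) (funext cornerClo_C3.1)).trans
      (arcMat_A1 _)
  have h2 : qvMat χ C3 ((1 : Fin 3), false) = vertexC3 2 :=
    (congrArg (fun l : Fin 4 → Fin 2 => arcMat (D := Sphere) A2 l (· < ·)
      (χ.label C3 (1 : Fin 3))) (funext cornerClo_C3.2.1)).trans
      (arcMat_A2 _)
  have h3 : qvMat χ C3 ((1 : Fin 3), true) = vertexC3 3 :=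
    (congrArg (fun l : Fin 4 → Fin 2 => regionMat (D := Sphere) A2 l (· < ·)) (funext cornerClo_C3.2.1)).trans
      regionMat_A2
  have h4 : qvMat χ C3 ((2 : Fin 3), false) = vertexC3 4 :=
    (congrArg (fun l : Fin 4 → Fin 2 => vMat (D := Sphere) top l (· < ·)) (funext cornerClo_C3.2.2)).trans
      vMat_top
  fin_cases k
  exacts [h0, h1, h2, h3, h4]

theorem qvMat_C4 (k : Fin 5) : qvMat χ C4 (pentagonEdge k) = vertexC4 k := by
  have h0 : qvMat χ C4 ((0 : Fin 3), false) = vertexC4 0 :=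
    (congrArg (fun l : Fin 4 → Fin 2 => regionMat (D := Sphere) A2 l (· < ·)) (funext cornerClo_C4.1)).trans
      regionMat_A2
  have h1 : qvMat χ C4 ((0 : Fin 3), true) = vertexC4 1 :=
    (congrArg (fun l : Fin 4 → Fin 2 => arcMat (D := Sphere) A2 l (· < ·)
      (χ.label C4 (0 : Fin 3))) (funext cornerClo_C4.1)).trans
      (arcMat_A2 _)
  have h2 : qvMat χ C4 ((1 : Fin 3), false) = vertexC4 2 :=
    (congrArg (fun l : Fin 4 → Fin 2 => arcMat (D := Sphere) A1 l (· < ·)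
      (χ.label C4 (1 : Fin 3))) (funext cornerClo_C4.2.1)).trans
      (arcMat_A1 _)
  have h3 : qvMat χ C4 ((1 : Fin 3), true) = vertexC4 3 :=
    (congrArg (fun l : Fin 4 → Fin 2 => regionMat (D := Sphere) A1 l (· < ·)) (funext cornerClo_C4.2.1)).trans
      regionMat_A1
  have h4 : qvMat χ C4 ((2 : Fin 3), false) = vertexC4 4 :=
    (congrArg (fun l : Fin 4 → Fin 2 => vMat (D := Sphere) bot l (· < ·)) (funext cornerClo_C4.2.2)).trans
      vMat_bot
  fin_cases k
  exacts [h0, h1, h2, h3, h4]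

/-- The additional edges point away from the arc, so the one before the arc is passed backwards
although all three sides run counter-clockwise. -/
theorem qDir_C3 (k : Fin 5) : qDir (D := Sphere) C3 (pentagonEdge k) = decide (k ≠ 1) := by
  fin_cases k <;> decide

theorem qDir_C4 (k : Fin 5) : qDir (D := Sphere) C4 (pentagonEdge k) = decide (k = 3) := by
  fin_cases k <;> decide

end Matrices
end LegendrianDGA

/-! ### The differential on the crossing arc -/

namespace LegendrianDGA
open Front ExV ExE ExF

/-- The four sheets above the crossing arc, as numbered above `C4`. -/
def arcSheet : ESheet (D := Sphere) B5 ≃ Fin 4 where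
  toFun x := x.1
  invFun p := ⟨p, by revert p; intro p; fin_cases p <;> decide⟩
  left_inv _ := rfl
  right_inv _ := rfl

/-- The four sheets above the crossing arc, as numbered above `C3`. -/
def arcSheet' : ESheet (D := Sphere) B5 ≃ Fin 4 := arcSheet.trans (Equiv.swap 1 2)

section

variable (χ : Sphere.Choices)

theorem bd_C1_ne : ∀ j : Fin 3, ¬ @Eq ExE (Sphere.bd C1 j) B5 := by
  intro j
  fin_cases j <;> exact ExE.noConfusion

theorem bd_C2_ne : ∀ j : Fin 3, ¬ @Eq ExE (Sphere.bd C2 j) B5 := by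
  intro j
  fin_cases j <;> exact ExE.noConfusion

theorem eq_one_of_bd_C3 : ∀ j : Fin 3, @Eq ExE (Sphere.bd C3 j) B5 → j = 1 := by
  intro j
  fin_cases j <;> first | exact fun _ => rfl | exact ExE.noConfusion

theorem eq_one_of_bd_C4 : ∀ j : Fin 3, @Eq ExE (Sphere.bd C4 j) B5 → j = 1 := by
  intro j
  fin_cases j <;> first | exact fun _ => rfl | exact ExE.noConfusion

/-- The two conditions name the corners of `C3` and `C4` at the end `t` of the arc. Their numbers
differ because the two boundaries pass the arc in opposite directions. -/
theorem sLt_of_label (t : Bool)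
    (h : χ.label C3 (if t then (1 : Fin 3) else (0 : Fin 3)) = true)
    (h' : χ.label C4 (if t then (0 : Fin 3) else (1 : Fin 3)) = false) :
    sLt χ B5 t = fun x y => arcSheet' x < arcSheet' y := by
  have key : ∀ p x : Fin 4, (((![0, 2, 1, 3] : Fin 4 → Fin 4) p : Fin 4) : ℕ) = x →
      Equiv.swap 1 2 x = p := by decide
  have key' : ∀ x : Fin 4,
      (((![0, 2, 1, 3] : Fin 4 → Fin 4) (Equiv.swap 1 2 x) : Fin 4) : ℕ) = x := by decide
  ext x y
  constructor
  · rintro ⟨f, j, hj, hl, p, q, hpq, hp, hq⟩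
    cases f
    · exact (bd_C1_ne j hj).elim
    · exact (bd_C2_ne j hj).elim
    · have hj' : j = (1 : Fin 3) := eq_one_of_bd_C3 j hj
      subst hj'
      have e1 : arcSheet' x = p := key p x.1 hp
      have e2 : arcSheet' y = q := key q y.1 hq
      rw [e1, e2]
      exact hpq
    · exfalso
      have hj' : j = (1 : Fin 3) := eq_one_of_bd_C4 j hj
      subst hj'
      cases t
      · rcases hl with ⟨-, hl⟩ | ⟨hl, -⟩
        · exact Bool.false_ne_true (h'.symm.trans hl)
        · exact Bool.false_ne_true hl
      · rcases hl with ⟨hl, -⟩ | ⟨-, hl⟩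
        · exact Bool.false_ne_true hl
        · exact Bool.false_ne_true (h'.symm.trans hl)
  · intro hxy
    refine ⟨C3, (1 : Fin 3), rfl, ?_, arcSheet' x, arcSheet' y, hxy, key' x.1, key' y.1⟩
    cases t
    · exact Or.inr ⟨rfl, h⟩
    · exact Or.inl ⟨rfl, h⟩

theorem sLt_of_label' (t : Bool)
    (h : χ.label C3 (if t then (1 : Fin 3) else (0 : Fin 3)) = false)
    (h' : χ.label C4 (if t then (0 : Fin 3) else (1 : Fin 3)) = true) :
    sLt χ B5 t = fun x y => arcSheet x < arcSheet y := by
  have key : ∀ p x : Fin 4, (((![0, 1, 2, 3] : Fin 4 → Fin 4) p : Fin 4) : ℕ) = x →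
      x = p := by decide
  have key' : ∀ x : Fin 4,
      (((![0, 1, 2, 3] : Fin 4 → Fin 4) x : Fin 4) : ℕ) = x := by decide
  ext x y
  constructor
  · rintro ⟨f, j, hj, hl, p, q, hpq, hp, hq⟩
    cases f
    · exact (bd_C1_ne j hj).elim
    · exact (bd_C2_ne j hj).elim
    · exfalso
      have hj' : j = (1 : Fin 3) := eq_one_of_bd_C3 j hj
      subst hj'
      cases t
      · rcases hl with ⟨hl, -⟩ | ⟨-, hl⟩
        · exact Bool.false_ne_true hl.symm
        · exact Bool.false_ne_true (h.symm.trans hl)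
      · rcases hl with ⟨-, hl⟩ | ⟨hl, -⟩
        · exact Bool.false_ne_true (h.symm.trans hl)
        · exact Bool.false_ne_true hl.symm
    · have hj' : j = (1 : Fin 3) := eq_one_of_bd_C4 j hj
      subst hj'
      have e1 : arcSheet x = p := key p x.1 hp
      have e2 : arcSheet y = q := key q y.1 hq
      rw [e1, e2]
      exact hpq
  · intro hxy
    refine ⟨C4, (1 : Fin 3), rfl, ?_, arcSheet x, arcSheet y, hxy, key' x.1, key' y.1⟩
    cases t
    · exact Or.inl ⟨rfl, h'⟩
    · exact Or.inr ⟨rfl, h'⟩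

theorem arcCorner_C3 : ArcCorner (D := Sphere) C3 (0 : Fin 3) ∧
    ArcCorner (D := Sphere) C3 (1 : Fin 3) := by decide

theorem arcCorner_C4 : ArcCorner (D := Sphere) C4 (0 : Fin 3) ∧
    ArcCorner (D := Sphere) C4 (1 : Fin 3) := by decide

theorem label_C3_ne (t : Bool) : χ.label C3 (if t then (1 : Fin 3) else (0 : Fin 3)) ≠
    χ.label C4 (if t then (0 : Fin 3) else (1 : Fin 3)) := by
  cases t
  · exact χ.label_ne C3 C4 (0 : Fin 3) (1 : Fin 3) arcCorner_C3.1 arcCorner_C4.2 rfl (by simp)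
  · exact χ.label_ne C3 C4 (1 : Fin 3) (0 : Fin 3) arcCorner_C3.2 arcCorner_C4.1 rfl (by simp)

/-- The labels can only exchange the two crossing sheets. Invariance of `lim` and `M` under this
exchange makes the end matrix independent of the labels. -/
theorem arcMat_sLt (t : Bool) {inst : DecidableRel (sLt χ B5 t)} (v : ExV) (lim : Fin 4 → Fin 2)
    (hlim : ∀ p, lim (Equiv.swap 1 2 p) = lim p) (M : Matrix (Fin 4) (Fin 4) Sphere.CellAlg)
    (hM : arcMat (D := Sphere) v lim (· < ·) true = M)
    (hs : M.submatrix (Equiv.swap 1 2) (Equiv.swap 1 2) = M) :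
    @arcMat Sphere _ _ _ v (fun x => lim (arcSheet x)) (sLt χ B5 t) inst true =
      M.submatrix arcSheet arcSheet := by
  have aux' (lt lt' : ESheet (D := Sphere) B5 → ESheet (D := Sphere) B5 → Prop)
      (i : DecidableRel lt) (i' : DecidableRel lt') (h : lt = lt') :
      @arcMat Sphere _ _ _ v (fun x => lim (arcSheet x)) lt i true =
        @arcMat Sphere _ _ _ v (fun x => lim (arcSheet x)) lt' i' true := by
    subst h
    rw [Subsingleton.elim i i']
  have hne := label_C3_ne χ t
  cases h : χ.label C3 (if t then (1 : Fin 3) else (0 : Fin 3))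
  · have h' : χ.label C4 (if t then (0 : Fin 3) else (1 : Fin 3)) = true := by
      rw [h] at hne
      exact Bool.eq_true_of_not_eq_false hne.symm
    rw [aux' _ _ _ _ (sLt_of_label' χ t h h'), arcMat_equiv (D := Sphere) arcSheet v lim (· < ·), hM]
  · have h' : χ.label C4 (if t then (0 : Fin 3) else (1 : Fin 3)) = false := by
      rw [h] at hne
      exact Bool.eq_false_of_not_eq_true hne.symm
    have hl : (fun x => lim (arcSheet x)) = fun x => lim (arcSheet' x) :=
      funext fun x => (hlim (arcSheet x)).symm
    rw [aux' _ _ _ _ (sLt_of_label χ t h h'), hl,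
      arcMat_equiv (D := Sphere) arcSheet' v lim (· < ·), hM]
    conv_rhs => rw [← hs]
    rfl

theorem hatM_swap (x y : Sphere.CellAlg) :
    (hatM x y).submatrix (Equiv.swap 1 2) (Equiv.swap 1 2) = hatM x y := by
  ext i j
  fin_cases i <;> fin_cases j <;> rfl

theorem endMat_B5_false :
    endMat χ B5 false = (hatM 1 (vGen A1)).submatrix arcSheet arcSheet := by
  have h1 : InRegion (D := Sphere) A1
    (fun x : ESheet (D := Sphere) B5 => (![0, 0, 0, 1] : Fin 4 → Fin 2) x.1) := by decide
  have h2 : ArcEnd (D := Sphere) B5 false := by decide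
  exact ((if_pos h1).trans (if_pos h2)).trans (arcMat_sLt χ false A1 limA1 (by decide) _
    (arcMat_A1 true) (hatM_swap _ _))

theorem endMat_B5_true :
    endMat χ B5 true = (hatM (vGen A2) 1).submatrix arcSheet arcSheet := by
  have h1 : InRegion (D := Sphere) A2
    (fun x : ESheet (D := Sphere) B5 => (![0, 1, 1, 1] : Fin 4 → Fin 2) x.1) := by decide
  have h2 : ArcEnd (D := Sphere) B5 true := by decide
  exact ((if_pos h1).trans (if_pos h2)).trans (arcMat_sLt χ true A2 limA2 (by decide) _
    (arcMat_A2 true) (hatM_swap _ _))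

theorem dB_B5 : dB χ B5 =
    (hatM (vGen A2) 1 * (1 + Matrix.of arcGen) +
      (1 + Matrix.of arcGen) * hatM 1 (vGen A1)).submatrix arcSheet arcSheet := by
  have h : 1 + bMat (D := Sphere) B5 = (1 + Matrix.of arcGen).submatrix arcSheet arcSheet :=
    congrArg₂ (· + ·) (Matrix.submatrix_one_equiv arcSheet).symm rfl
  have h' : (hatM (vGen A2) 1 * (1 + Matrix.of arcGen) +
      (1 + Matrix.of arcGen) * hatM 1 (vGen A1)).submatrix arcSheet arcSheet =
      (hatM (vGen A2) 1).submatrix arcSheet arcSheet *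
        (1 + Matrix.of arcGen).submatrix arcSheet arcSheet +
      (1 + Matrix.of arcGen).submatrix arcSheet arcSheet *
        (hatM 1 (vGen A1)).submatrix arcSheet arcSheet := by
    rw [Matrix.submatrix_mul_equiv, Matrix.submatrix_mul_equiv]
    rfl
  rw [h', ← h, ← endMat_B5_false χ, ← endMat_B5_true χ]
  rfl

end
end LegendrianDGA

/-! ### Path products, and the outer cells -/

namespace LegendrianDGA
open Front ExV ExE ExF

theorem list_get_of_eq {α : Type*} {L L' : List α} (h : L = L') (v : Fin L.length) :
    L.get v = L'.get (Fin.cast (congrArg List.length h) v) := by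
  subst h
  rfl

namespace Front

variable {D : Front} (χ : D.Choices) (f : D.F)

section Pentagon

variable {e : Fin 5 → Fin (D.sides f) × Bool} (hq : qEdges f = [0, 1, 2, 3, 4].map e)
include hq

theorem exists_vertices : ∃ v w : Fin 5, (χ.v₀ f : ℕ) = v ∧ (χ.v₁ f : ℕ) = w ∧
    (qEdges f).get (χ.v₀ f) = e v ∧ (qEdges f).get (χ.v₁ f) = e w := by
  have hl : ([0, 1, 2, 3, 4].map e).length = 5 := rfl
  have hget (v : Fin 5) : ([0, 1, 2, 3, 4].map e).get (Fin.cast hl.symm v) = e v := by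
    fin_cases v <;> rfl
  have hlen : (qEdges f).length = 5 := (congrArg List.length hq).trans hl
  refine ⟨Fin.cast hlen (χ.v₀ f), Fin.cast hlen (χ.v₁ f), rfl, rfl, ?_, ?_⟩
  · rw [list_get_of_eq hq, ← hget]
    rfl
  · rw [list_get_of_eq hq, ← hget]
    rfl

theorem plusLength_eq {v w : ℕ} (hv : (χ.v₀ f : ℕ) = v) (hw : (χ.v₁ f : ℕ) = w) :
    plusLength χ f = pentagonLength v w (χ.full f) := by
  have hlen : (qEdges f).length = 5 := congrArg List.length hq
  unfold plusLength pentagonLength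
  simp only [Fin.ext_iff, hv, hw, hlen]

section Paths

variable {y : Fin 5 → Matrix (Fin (D.fnum f)) (Fin (D.fnum f)) D.CellAlg} {v w : ℕ}
  (hv : (χ.v₀ f : ℕ) = v) (hw : (χ.v₁ f : ℕ) = w)
include hv hw

theorem pathMat_gammaPlus (hy : ∀ k, ypow (yMat χ f (e k)) (qDir f (e k)) = y k) :
    pathMat χ f (gammaPlus χ f) = ((([0, 1, 2, 3, 4].rotate (v + 1)).take
      (pentagonLength v w (χ.full f))).map y).reverse.prod := by
  rw [pathMat, gammaPlus, qEdgesFrom, plusLength_eq χ f hq hv hw, hv, hq, ← List.map_rotate,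
    ← List.map_take, List.map_map, List.map_map]
  congr 3
  funext k
  simp [hy]

theorem pathMat_gammaMinus (hy : ∀ k, ypow (yMat χ f (e k)) (!qDir f (e k)) = y k) :
    pathMat χ f (gammaMinus χ f) = ((([0, 1, 2, 3, 4].rotate (v + 1)).drop
      (pentagonLength v w (χ.full f))).map y).prod := by
  rw [pathMat, gammaMinus, qEdgesFrom, plusLength_eq χ f hq hv hw, hv, hq, ← List.map_rotate,
    ← List.map_drop, List.map_map, List.map_reverse, List.reverse_reverse, List.map_map]
  congr 2
  funext k
  simp [hy]

end Paths

theorem dC_pentagon {Y V : Fin 5 → Matrix (Fin (D.fnum f)) (Fin (D.fnum f)) D.CellAlg}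
    {dir : Fin 5 → Bool} (hY : ∀ k, yMat χ f (e k) = Y k) (hV : ∀ k, qvMat χ f (e k) = V k)
    (hdir : ∀ k, qDir f (e k) = dir k) : ∃ v w : Fin 5, dC χ f = V w * cMat f + cMat f * V v +
      ((([0, 1, 2, 3, 4].rotate (v + 1)).take (pentagonLength v w (χ.full f))).map fun k =>
        ypow (Y k) (dir k)).reverse.prod +
      ((([0, 1, 2, 3, 4].rotate (v + 1)).drop (pentagonLength v w (χ.full f))).map fun k =>
        if dir k then ypow (Y k) false else Y k).prod := by
  obtain ⟨v, w, hv, hw, ev, ew⟩ := exists_vertices χ f hq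
  refine ⟨v, w, ?_⟩
  rw [dC, ev, ew, hV, hV, pathMat_gammaPlus χ f hq hv hw fun k => by rw [hY, hdir],
    pathMat_gammaMinus χ f hq hv hw (y := fun k => if dir k then ypow (Y k) false else Y k)
      fun k => by rw [hY, hdir]; cases dir k <;> rfl]

end Pentagon

/-- The two paths together pass every edge once, and in a commutative setting neither the cut nor
the rotation matters. -/
theorem sum_take_add_sum_drop {M : Type*} [AddCommMonoid M] (x : Fin (D.sides f) × Bool → M) :
    (((qEdgesFrom χ f).take (plusLength χ f)).map x).sum +
      (((qEdgesFrom χ f).drop (plusLength χ f)).map x).sum = ((qEdges f).map x).sum := by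
  rw [← List.sum_append, ← List.map_append, List.take_append_drop]
  exact ((List.rotate_perm _ _).map x).sum_eq

theorem mem_qEdges_of_mem_take {k : Fin (D.sides f) × Bool}
    (hk : k ∈ (qEdgesFrom χ f).take (plusLength χ f)) : k ∈ qEdges f :=
  List.mem_rotate.1 (List.mem_of_mem_take hk)

theorem mem_qEdges_of_mem_drop {k : Fin (D.sides f) × Bool}
    (hk : k ∈ (qEdgesFrom χ f).drop (plusLength χ f)) : k ∈ qEdges f :=
  List.mem_rotate.1 (List.mem_of_mem_drop hk)

end Front

theorem unipotent_two_list_prod {R : Type*} [Ring R] (l : List R) :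
    (l.map fun x => (!![1, x; 0, 1] : Matrix (Fin 2) (Fin 2) R)).prod = !![1, l.sum; 0, 1] := by
  induction l with
  | nil => ext i j; fin_cases i <;> fin_cases j <;> rfl
  | cons x l ih =>
    rw [List.map_cons, List.prod_cons, ih]
    ext i j
    fin_cases i <;> fin_cases j <;> simp [add_comm]

theorem CellAlg.add_self {D : Front} (x : D.CellAlg) : x + x = 0 := by
  rw [← two_smul (ZMod 2) x, show (2 : ZMod 2) = 0 from rfl, zero_smul]

theorem ypow_two {D : Front} (x : D.CellAlg) (η : Bool) :
    ypow (!![1, x; 0, 1] : Matrix (Fin 2) (Fin 2) D.CellAlg) η = !![1, x; 0, 1] := by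
  have hx : -x = x := neg_eq_of_add_eq_zero_left (CellAlg.add_self x)
  cases η
  · ext i j
    fin_cases i <;> fin_cases j <;> simp [ypow, Finset.sum_range_succ, hx]
  · rfl

/-- For two sheets the edge matrices form an additive group, so each path product records just the
sum of its edges; with matrices that are independent of the direction, order and direction are
irrelevant. -/
theorem two_sheets_paths {E R : Type*} [Ring R] (Y : E × Bool → Matrix (Fin 2) (Fin 2) R)
    (x : E → R) (l l' : List E) (h : ∀ k ∈ l, ∀ η, Y (k, η) = !![1, x k; 0, 1])
    (h' : ∀ k ∈ l', ∀ η, Y (k, η) = !![1, x k; 0, 1]) :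
    (((l.map fun k => (k, true)).map Y).reverse.prod +
      ((l'.reverse.map fun k => (k, false)).map Y).reverse.prod) 0 1 =
        (l.map x).sum + (l'.map x).sum := by
  have e : ((l.map fun k => (k, true)).map Y).reverse =
      (l.reverse.map x).map fun x => (!![1, x; 0, 1] : Matrix (Fin 2) (Fin 2) R) := by
    rw [List.map_map, List.map_map, ← List.map_reverse]
    exact List.map_congr_left fun k hk => h k (List.mem_reverse.1 hk) _
  have e' : ((l'.reverse.map fun k => (k, false)).map Y).reverse =
      (l'.map x).map fun x => (!![1, x; 0, 1] : Matrix (Fin 2) (Fin 2) R) := by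
    rw [List.map_map, List.map_map, List.map_reverse, List.reverse_reverse]
    exact List.map_congr_left fun k hk => h' k hk _
  rw [e, e', unipotent_two_list_prod, unipotent_two_list_prod, List.map_reverse, List.sum_reverse]
  simp

section Outer

variable (χ : Sphere.Choices)

theorem triangle_side : ∀ k : Fin 3 × Bool,
    k ∈ ([(0, false), (1, false), (2, false)] : List (Fin 3 × Bool)) → k.2 = false := by decide

/-- The generators of the `2`-cells `C1` and `C2`. -/
noncomputable def outerGen : ExF → Sphere.CellAlg
  | C1 => c (D := Sphere) C1 (0 : Fin 2) (1 : Fin 2)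
  | C2 => c (D := Sphere) C2 (0 : Fin 2) (1 : Fin 2)
  | _ => 0

/-- The entry above the diagonal of the matrix of a side of `C1`. -/
noncomputable def sideC1 (k : Fin 3 × Bool) : Sphere.CellAlg :=
  (![0, cuspGen B1, cuspGen B2] : Fin 3 → Sphere.CellAlg) k.1

/-- The entry above the diagonal of the matrix of a side of `C2`. -/
noncomputable def sideC2 (k : Fin 3 × Bool) : Sphere.CellAlg :=
  (![0, cuspGen B4, cuspGen B3] : Fin 3 → Sphere.CellAlg) k.1

theorem yMat_C1 (k : Fin 3) :
    yMat χ C1 (k, false) = (!![1, sideC1 (k, false); 0, 1] : Matrix (Fin 2) (Fin 2) _) := by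
  refine Matrix.ext fun (i j : Fin 2) => ?_
  change (1 : Matrix (Fin 2) (Fin 2) Sphere.CellAlg) i j +
    b (D := Sphere) (Sphere.bd C1 k) (Sphere.fclo C1 k i) (Sphere.fclo C1 k j) = _
  have h : b (D := Sphere) (Sphere.bd C1 k) (Sphere.fclo C1 k i) (Sphere.fclo C1 k j) =
      !![0, sideC1 (k, false); 0, 0] i j := by
    fin_cases k <;> fin_cases i <;> fin_cases j <;> rfl
  rw [h]
  fin_cases i <;> fin_cases j <;> simp

theorem yMat_C2 (k : Fin 3) :
    yMat χ C2 (k, false) = (!![1, sideC2 (k, false); 0, 1] : Matrix (Fin 2) (Fin 2) _) := by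
  refine Matrix.ext fun (i j : Fin 2) => ?_
  change (1 : Matrix (Fin 2) (Fin 2) Sphere.CellAlg) i j +
    b (D := Sphere) (Sphere.bd C2 k) (Sphere.fclo C2 k i) (Sphere.fclo C2 k j) = _
  have h : b (D := Sphere) (Sphere.bd C2 k) (Sphere.fclo C2 k i) (Sphere.fclo C2 k j) =
      !![0, sideC2 (k, false); 0, 0] i j := by
    fin_cases k <;> fin_cases i <;> fin_cases j <;> rfl
  rw [h]
  fin_cases i <;> fin_cases j <;> simp

theorem ypow_C1 (k : Fin 3 × Bool) (hk : k ∈ qEdges (D := Sphere) C1) (η : Bool) :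
    ypow (yMat χ C1 k) η = (!![1, sideC1 k; 0, 1] : Matrix (Fin 2) (Fin 2) _) := by
  have h : k.2 = false := triangle_side k hk
  obtain ⟨k, t⟩ := k
  obtain rfl : t = false := h
  exact (congrArg (ypow · η) (yMat_C1 χ k)).trans (ypow_two _ η)

theorem ypow_C2 (k : Fin 3 × Bool) (hk : k ∈ qEdges (D := Sphere) C2) (η : Bool) :
    ypow (yMat χ C2 k) η = (!![1, sideC2 k; 0, 1] : Matrix (Fin 2) (Fin 2) _) := by
  have h : k.2 = false := triangle_side k hk
  obtain ⟨k, t⟩ := k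
  obtain rfl : t = false := h
  exact (congrArg (ypow · η) (yMat_C2 χ k)).trans (ypow_two _ η)

theorem paths_C1 : (pathMat χ C1 (gammaPlus χ C1) + pathMat χ C1 (gammaMinus χ C1))
    (0 : Fin 2) (1 : Fin 2) = cuspGen B1 + cuspGen B2 := by
  have h := two_sheets_paths
    (fun k : (Fin 3 × Bool) × Bool => ypow (yMat χ C1 k.1) (qDir (D := Sphere) C1 k.1 == k.2))
    sideC1 ((qEdgesFrom χ C1).take (plusLength χ C1)) ((qEdgesFrom χ C1).drop (plusLength χ C1))
    (fun k hk η => ypow_C1 χ k (mem_qEdges_of_mem_take χ C1 hk) _)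
    (fun k hk η => ypow_C1 χ k (mem_qEdges_of_mem_drop χ C1 hk) _)
  refine (h.trans (sum_take_add_sum_drop χ C1 sideC1)).trans ?_
  -- The outer arc carries only a cusp edge, hence no generator, and contributes 0.
  change 0 + (cuspGen B1 + (cuspGen B2 + 0)) = _
  rw [zero_add, add_zero]

theorem paths_C2 : (pathMat χ C2 (gammaPlus χ C2) + pathMat χ C2 (gammaMinus χ C2))
    (0 : Fin 2) (1 : Fin 2) = cuspGen B3 + cuspGen B4 := by
  have h := two_sheets_paths
    (fun k : (Fin 3 × Bool) × Bool => ypow (yMat χ C2 k.1) (qDir (D := Sphere) C2 k.1 == k.2))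
    sideC2 ((qEdgesFrom χ C2).take (plusLength χ C2)) ((qEdgesFrom χ C2).drop (plusLength χ C2))
    (fun k hk η => ypow_C2 χ k (mem_qEdges_of_mem_take χ C2 hk) _)
    (fun k hk η => ypow_C2 χ k (mem_qEdges_of_mem_drop χ C2 hk) _)
  refine (h.trans (sum_take_add_sum_drop χ C2 sideC2)).trans ?_
  change 0 + (cuspGen B4 + (cuspGen B3 + 0)) = _
  rw [zero_add, add_zero, add_comm]

/-- An outer cell lies outside the swallowtail region: at most one of its sheets ends at the
swallowtail point. -/
theorem not_inRegion_C1 (k : Fin 3) :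
    ¬ InRegion (cornerV (D := Sphere) C1 k) (cornerClo (D := Sphere) C1 k) := by
  fin_cases k <;> decide

theorem qvMat_C1_diag (k : Fin 3 × Bool) :
    qvMat χ C1 k (0 : Fin 2) (0 : Fin 2) = 0 ∧ qvMat χ C1 k (1 : Fin 2) (1 : Fin 2) = 0 ∧
      qvMat χ C1 k (1 : Fin 2) (0 : Fin 2) = 0 := by
  obtain ⟨k, t⟩ := k
  have h : qvMat χ C1 (k, t) =
      vMat (cornerV (D := Sphere) C1 k) (cornerClo (D := Sphere) C1 k) (· < ·) :=
    if_neg (not_inRegion_C1 k)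
  refine ⟨(congrFun (congrFun h (0 : Fin 2)) (0 : Fin 2)).trans ?_,
    (congrFun (congrFun h (1 : Fin 2)) (1 : Fin 2)).trans ?_,
    (congrFun (congrFun h (1 : Fin 2)) (0 : Fin 2)).trans ?_⟩ <;> fin_cases k <;> rfl

theorem not_inRegion_C2 (k : Fin 3) :
    ¬ InRegion (cornerV (D := Sphere) C2 k) (cornerClo (D := Sphere) C2 k) := by
  fin_cases k <;> decide

theorem qvMat_C2_diag (k : Fin 3 × Bool) :
    qvMat χ C2 k (0 : Fin 2) (0 : Fin 2) = 0 ∧ qvMat χ C2 k (1 : Fin 2) (1 : Fin 2) = 0 ∧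
      qvMat χ C2 k (1 : Fin 2) (0 : Fin 2) = 0 := by
  obtain ⟨k, t⟩ := k
  have h : qvMat χ C2 (k, t) =
      vMat (cornerV (D := Sphere) C2 k) (cornerClo (D := Sphere) C2 k) (· < ·) :=
    if_neg (not_inRegion_C2 k)
  refine ⟨(congrFun (congrFun h (0 : Fin 2)) (0 : Fin 2)).trans ?_,
    (congrFun (congrFun h (1 : Fin 2)) (1 : Fin 2)).trans ?_,
    (congrFun (congrFun h (1 : Fin 2)) (0 : Fin 2)).trans ?_⟩ <;> fin_cases k <;> rfl

/-- The vertex terms vanish because products of strictly upper triangular two by two matrices are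
zero. Only the two path products remain. -/
theorem dC_C1 : dC χ C1 (0 : Fin 2) (1 : Fin 2) = cuspGen B1 + cuspGen B2 := by
  have h0 := qvMat_C1_diag χ ((qEdges (D := Sphere) C1).get (χ.v₁ C1))
  have h1 := qvMat_C1_diag χ ((qEdges (D := Sphere) C1).get (χ.v₀ C1))
  have hC : cMat (D := Sphere) C1 = (!![0, outerGen C1; 0, 0] : Matrix (Fin 2) (Fin 2) _) := by
    refine Matrix.ext fun (i j : Fin 2) => ?_
    fin_cases i <;> fin_cases j <;> rfl
  have key (M N C P P' : Matrix (Fin 2) (Fin 2) Sphere.CellAlg) (hC : C = !![0, outerGen C1; 0, 0])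
      (hM : M 0 0 = 0) (hN : N 1 1 = 0) : (M * C + C * N + P + P') 0 1 = (P + P') 0 1 := by
    subst hC
    simp only [Matrix.add_apply, Matrix.mul_apply, Fin.sum_univ_two]
    simp [hM, hN]
  exact (key _ _ _ _ _ hC h0.1 h1.2.1).trans (paths_C1 χ)

theorem dC_C2 : dC χ C2 (0 : Fin 2) (1 : Fin 2) = cuspGen B3 + cuspGen B4 := by
  have h0 := qvMat_C2_diag χ ((qEdges (D := Sphere) C2).get (χ.v₁ C2))
  have h1 := qvMat_C2_diag χ ((qEdges (D := Sphere) C2).get (χ.v₀ C2))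
  have hC : cMat (D := Sphere) C2 = (!![0, outerGen C2; 0, 0] : Matrix (Fin 2) (Fin 2) _) := by
    refine Matrix.ext fun (i j : Fin 2) => ?_
    fin_cases i <;> fin_cases j <;> rfl
  have key (M N C P P' : Matrix (Fin 2) (Fin 2) Sphere.CellAlg) (hC : C = !![0, outerGen C2; 0, 0])
      (hM : M 0 0 = 0) (hN : N 1 1 = 0) : (M * C + C * N + P + P') 0 1 = (P + P') 0 1 := by
    subst hC
    simp only [Matrix.add_apply, Matrix.mul_apply, Fin.sum_univ_two]
    simp [hM, hN]
  exact (key _ _ _ _ _ hC h0.1 h1.2.1).trans (paths_C2 χ)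

end Outer
end LegendrianDGA

/-! ### Maslov number, Maslov potentials and the number of generators -/

namespace LegendrianDGA
open Front ExV ExE ExF

/-- An integral Maslov potential on the sheets above the `2`-cells. -/
def facePot : (f : Sphere.F) → Fin (Sphere.fnum f) → ℤ
  | C1 => (![0, -1] : Fin 2 → ℤ)
  | C2 => (![1, 0] : Fin 2 → ℤ)
  | C3 => (![1, 0, 0, -1] : Fin 4 → ℤ)
  | C4 => (![1, 0, 0, -1] : Fin 4 → ℤ)

/-- An integral Maslov potential on the components above the `1`-cells, by their numbers. -/
def edgePot : Sphere.E → ℕ → ℤ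
  | B1, n => if n = 1 then 0 else -1
  | B2, n => if n = 1 then 0 else -1
  | B3, n => if n = 0 then 1 else 0
  | B4, n => if n = 0 then 1 else 0
  | B5, n => if n = 0 then 1 else if n = 3 then -1 else 0
  | outL, _ => 0
  | outR, _ => 0

/-- An integral Maslov potential on the components above the `0`-cells. -/
def vertexPot : (v : Sphere.V) → Fin (Sphere.vnum v) → ℤ
  | A1 => (![0, -1] : Fin 2 → ℤ)
  | A2 => (![1, 0] : Fin 2 → ℤ)
  | top => (![0, 0] : Fin 2 → ℤ)
  | bot => (![0, 0] : Fin 2 → ℤ)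

theorem facePot_smooth : ∀ f i p, Sphere.ekind (Sphere.bd f i) (Sphere.fclo f i p) = Kind.smooth →
    edgePot (Sphere.bd f i) (Sphere.fclo f i p) = facePot f p := by decide

theorem facePot_cusp : ∀ f i p q, p < q → Sphere.fclo f i p = Sphere.fclo f i q →
    Sphere.ekind (Sphere.bd f i) (Sphere.fclo f i p) = Kind.cusp →
    facePot f p = facePot f q + 1 := by decide

theorem vertexPot_smooth : ∀ e b x,
    Sphere.vkind (Sphere.vert e b) (Sphere.eclo e b x) = Kind.smooth →
    vertexPot (Sphere.vert e b) (Sphere.eclo e b x) = edgePot e x := by decide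

theorem vertexPot_swallow : ∀ e b x,
    (Sphere.vkind (Sphere.vert e b) (Sphere.eclo e b x)).IsSwallow →
    Sphere.ekind e x = Kind.smooth →
    (∀ y, Sphere.ekind e y = Kind.smooth → Sphere.eclo e b y = Sphere.eclo e b x → y = x) →
    vertexPot (Sphere.vert e b) (Sphere.eclo e b x) = edgePot e x := by decide

/-- An integral potential drops by exactly the signed number of cusp crossings. A closed path
therefore has count 0, which gives Maslov number 0. -/
theorem facePot_of_sheetPath {s t : Σ f : Sphere.F, Fin (Sphere.fnum f)} {n : ℤ}
    (h : Sphere.SheetPath s t n) : facePot s.1 s.2 = facePot t.1 t.2 + n := by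
  induction h with
  | refl => rw [add_zero]
  | @cross n f g i j p q _ hij hk hpq ih =>
    rw [ih]
    congr 1
    have h1 := facePot_smooth f i p hk
    have hk' : Sphere.ekind (Sphere.bd g j) (Sphere.fclo g j q) = Kind.smooth := by
      rw [← hk]
      congr 1
      · exact hij.symm
      · rw [Fin.heq_ext_iff (congrArg Sphere.enum hij.symm)]
        exact hpq.symm
    have h2 := facePot_smooth g j q hk'
    rw [← h1, ← h2, hpq, hij]
  | @down n f i p q _ hlt hpq hk ih =>
    rw [ih]
    have := facePot_cusp f i p q hlt hpq hk
    simp only at this ⊢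
    omega
  | @up n f i p q _ hlt hpq hk ih =>
    rw [ih]
    have := facePot_cusp f i q p hlt hpq.symm (by rw [← hpq]; exact hk)
    simp only at this ⊢
    omega

theorem maslovNumber_sphere : Sphere.maslovNumber = 0 := by
  have : {n : ℕ | 0 < n ∧ ∃ s, Sphere.SheetPath s s n} = ∅ := by
    rw [Set.eq_empty_iff_forall_notMem]
    rintro n ⟨hn, s, hs⟩
    have := facePot_of_sheetPath hs
    omega
  rw [Front.maslovNumber, this, Nat.sInf_empty]

theorem nonempty_maslovPotential : Nonempty Sphere.MaslovPotential :=
  ⟨{ vpot := fun v x => (vertexPot v x : ZMod _)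
     epot := fun e x => (edgePot e x : ZMod _)
     fpot := fun f p => (facePot f p : ZMod _)
     side_smooth := fun f i p h => congrArg _ (facePot_smooth f i p h)
     side_cusp := fun f i p q h h' h'' => by
       rw [facePot_cusp f i p q h h' h'', Int.cast_add, Int.cast_one]
     end_smooth := fun e b x h => congrArg _ (vertexPot_smooth e b x h)
     end_swallow := fun e b x h h' h'' => congrArg _ (vertexPot_swallow e b x h h' h'') }⟩

/-- The label `S` for the corners of `C3`, and `T` for those of `C4`. -/
def arcLabel : Sphere.F → Bool
  | C3 => true
  | _ => false

set_option synthInstance.maxHeartbeats 200000 in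
set_option synthInstance.maxSize 1000 in
theorem nonempty_choices : Nonempty Sphere.Choices :=
  ⟨{ label := fun f _ => arcLabel f
     label_ne := by decide
     v₀ := fun f => ⟨0, by revert f; decide⟩
     v₁ := fun f => ⟨0, by revert f; decide⟩
     full := fun _ => true }⟩

theorem card_cellGen : Nat.card Sphere.CellGen = 25 := by
  rw [Nat.card_eq_fintype_card]
  rfl

section Degrees

variable (μ : Sphere.MaslovPotential)

/-- Up to a constant, there is only one Maslov potential. -/
theorem maslovPotential_eq : ∃ k : ZMod Sphere.maslovNumber,
    (∀ i, μ.fpot C3 i = (![k + 1, k, k, k - 1] : Fin 4 → ZMod Sphere.maslovNumber) i) ∧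
    (∀ i, μ.fpot C4 i = (![k + 1, k, k, k - 1] : Fin 4 → ZMod Sphere.maslovNumber) i) ∧
    (∀ i, μ.epot B5 i = (![k + 1, k, k, k - 1] : Fin 4 → ZMod Sphere.maslovNumber) i) ∧
    (∀ i, μ.fpot C1 i = (![k, k - 1] : Fin 2 → ZMod Sphere.maslovNumber) i) ∧
    (∀ i, μ.fpot C2 i = (![k + 1, k] : Fin 2 → ZMod Sphere.maslovNumber) i) ∧
    (∀ i, μ.vpot A1 i = (![k, k - 1] : Fin 2 → ZMod Sphere.maslovNumber) i) ∧
    (∀ i, μ.vpot A2 i = (![k + 1, k] : Fin 2 → ZMod Sphere.maslovNumber) i) ∧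
    (μ.epot B1 (1 : Fin 3) = k ∧ μ.epot B1 (2 : Fin 3) = k - 1) ∧
    (μ.epot B2 (1 : Fin 3) = k ∧ μ.epot B2 (2 : Fin 3) = k - 1) ∧
    (μ.epot B3 (0 : Fin 3) = k + 1 ∧ μ.epot B3 (1 : Fin 3) = k) ∧
    (μ.epot B4 (0 : Fin 3) = k + 1 ∧ μ.epot B4 (1 : Fin 3) = k) := by
  -- The value at a swallowtail point is read off along a cusp arc, where a single smooth sheet ends
  -- there.
  have h1 : ∀ y : Fin 3, (![.cusp, .smooth, .smooth] : Fin 3 → Kind) y = .smooth →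
    (![0, 0, 1] : Fin 3 → Fin 2) y = (![0, 0, 1] : Fin 3 → Fin 2) 1 → y = 1 := by decide
  have h3 : ∀ y : Fin 3, (![.smooth, .smooth, .cusp] : Fin 3 → Kind) y = .smooth →
    (![0, 1, 1] : Fin 3 → Fin 2) y = (![0, 1, 1] : Fin 3 → Fin 2) 1 → y = 1 := by decide
  have c40 : μ.fpot C4 (0 : Fin 4) = μ.fpot C4 (1 : Fin 4) + 1 :=
    μ.side_cusp C4 (2 : Fin 3) (0 : Fin 4) (1 : Fin 4) (by decide) rfl rfl
  have c42 : μ.fpot C4 (2 : Fin 4) = μ.fpot C4 (3 : Fin 4) + 1 :=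
    μ.side_cusp C4 (0 : Fin 3) (2 : Fin 4) (3 : Fin 4) (by decide) rfl rfl
  have c30 : μ.fpot C3 (0 : Fin 4) = μ.fpot C3 (1 : Fin 4) + 1 :=
    μ.side_cusp C3 (0 : Fin 3) (0 : Fin 4) (1 : Fin 4) (by decide) rfl rfl
  have s40 : μ.epot B5 (0 : Fin 4) = μ.fpot C4 (0 : Fin 4) :=
    μ.side_smooth C4 (1 : Fin 3) (0 : Fin 4) rfl
  have s41 : μ.epot B5 (1 : Fin 4) = μ.fpot C4 (1 : Fin 4) :=
    μ.side_smooth C4 (1 : Fin 3) (1 : Fin 4) rfl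
  have s42 : μ.epot B5 (2 : Fin 4) = μ.fpot C4 (2 : Fin 4) :=
    μ.side_smooth C4 (1 : Fin 3) (2 : Fin 4) rfl
  have s43 : μ.epot B5 (3 : Fin 4) = μ.fpot C4 (3 : Fin 4) :=
    μ.side_smooth C4 (1 : Fin 3) (3 : Fin 4) rfl
  have s30 : μ.epot B5 (0 : Fin 4) = μ.fpot C3 (0 : Fin 4) :=
    μ.side_smooth C3 (1 : Fin 3) (0 : Fin 4) rfl
  have s31 : μ.epot B5 (2 : Fin 4) = μ.fpot C3 (1 : Fin 4) :=
    μ.side_smooth C3 (1 : Fin 3) (1 : Fin 4) rfl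
  have s32 : μ.epot B5 (1 : Fin 4) = μ.fpot C3 (2 : Fin 4) :=
    μ.side_smooth C3 (1 : Fin 3) (2 : Fin 4) rfl
  have s33 : μ.epot B5 (3 : Fin 4) = μ.fpot C3 (3 : Fin 4) :=
    μ.side_smooth C3 (1 : Fin 3) (3 : Fin 4) rfl
  have b11 : μ.epot B1 (1 : Fin 3) = μ.fpot C4 (2 : Fin 4) :=
    μ.side_smooth C4 (2 : Fin 3) (2 : Fin 4) rfl
  have b12 : μ.epot B1 (2 : Fin 3) = μ.fpot C4 (3 : Fin 4) :=
    μ.side_smooth C4 (2 : Fin 3) (3 : Fin 4) rfl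
  have b30 : μ.epot B3 (0 : Fin 3) = μ.fpot C4 (0 : Fin 4) :=
    μ.side_smooth C4 (0 : Fin 3) (0 : Fin 4) rfl
  have b31 : μ.epot B3 (1 : Fin 3) = μ.fpot C4 (1 : Fin 4) :=
    μ.side_smooth C4 (0 : Fin 3) (1 : Fin 4) rfl
  have b21 : μ.epot B2 (1 : Fin 3) = μ.fpot C3 (2 : Fin 4) :=
    μ.side_smooth C3 (0 : Fin 3) (2 : Fin 4) rfl
  have b22 : μ.epot B2 (2 : Fin 3) = μ.fpot C3 (3 : Fin 4) :=
    μ.side_smooth C3 (0 : Fin 3) (3 : Fin 4) rfl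
  have b40 : μ.epot B4 (0 : Fin 3) = μ.fpot C3 (0 : Fin 4) :=
    μ.side_smooth C3 (2 : Fin 3) (0 : Fin 4) rfl
  have b41 : μ.epot B4 (1 : Fin 3) = μ.fpot C3 (1 : Fin 4) :=
    μ.side_smooth C3 (2 : Fin 3) (1 : Fin 4) rfl
  have f10 : μ.epot B1 (1 : Fin 3) = μ.fpot C1 (0 : Fin 2) :=
    μ.side_smooth C1 (1 : Fin 3) (0 : Fin 2) rfl
  have f11 : μ.epot B1 (2 : Fin 3) = μ.fpot C1 (1 : Fin 2) :=
    μ.side_smooth C1 (1 : Fin 3) (1 : Fin 2) rfl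
  have f20 : μ.epot B3 (0 : Fin 3) = μ.fpot C2 (0 : Fin 2) :=
    μ.side_smooth C2 (2 : Fin 3) (0 : Fin 2) rfl
  have f21 : μ.epot B3 (1 : Fin 3) = μ.fpot C2 (1 : Fin 2) :=
    μ.side_smooth C2 (2 : Fin 3) (1 : Fin 2) rfl
  have a10 : μ.vpot A1 (0 : Fin 2) = μ.epot B1 (1 : Fin 3) :=
    μ.end_swallow B1 true (1 : Fin 3) (Or.inl rfl) rfl h1
  have a11 : μ.vpot A1 (1 : Fin 2) = μ.epot B1 (2 : Fin 3) :=
    μ.end_smooth B1 true (2 : Fin 3) rfl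
  have a20 : μ.vpot A2 (0 : Fin 2) = μ.epot B3 (0 : Fin 3) :=
    μ.end_smooth B3 false (0 : Fin 3) rfl
  have a21 : μ.vpot A2 (1 : Fin 2) = μ.epot B3 (1 : Fin 3) :=
    μ.end_swallow B3 false (1 : Fin 3) (Or.inr rfl) rfl h3
  obtain ⟨k, hk⟩ : ∃ k, μ.fpot C4 (1 : Fin 4) = k := ⟨_, rfl⟩
  rw [hk] at c40 s41 b31
  -- Sheet 3 above `C4` continues across the arc as sheet 2 above `C3`. This lies one below sheet 1,
  -- whose value is the same on both sides.
  have e42 : μ.fpot C4 (2 : Fin 4) = k := by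
    rw [← s42, s31]
    exact add_right_cancel (c30.symm.trans (s30.symm.trans (s40.trans c40)))
  have e43 : μ.fpot C4 (3 : Fin 4) = k - 1 := by rw [← e42, c42, add_sub_cancel_right]
  have e30 : μ.fpot C3 (0 : Fin 4) = k + 1 := by rw [← s30, s40, c40]
  have e31 : μ.fpot C3 (1 : Fin 4) = k := by rw [← s31, s42, e42]
  have e32 : μ.fpot C3 (2 : Fin 4) = k := by rw [← s32, s41]
  have e33 : μ.fpot C3 (3 : Fin 4) = k - 1 := by rw [← s33, s43, e43]
  rw [e42] at s42 b11
  rw [e43] at s43 b12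
  rw [c40] at s40 b30
  rw [e32] at b21
  rw [e33] at b22
  rw [e30] at b40
  rw [e31] at b41
  refine ⟨k, ?_, ?_, ?_, ?_, ?_, ?_, ?_, ⟨b11, b12⟩, ⟨b21, b22⟩, ⟨b30, b31⟩, ⟨b40, b41⟩⟩
  · intro (i : Fin 4)
    fin_cases i
    exacts [e30, e31, e32, e33]
  · intro (i : Fin 4)
    fin_cases i
    exacts [c40, hk, e42, e43]
  · intro (i : Fin 4)
    fin_cases i
    exacts [s40, s41, s42, s43]
  · intro (i : Fin 2)
    fin_cases i
    exacts [f10.symm.trans b11, f11.symm.trans b12]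
  · intro (i : Fin 2)
    fin_cases i
    exacts [f20.symm.trans b30, f21.symm.trans b31]
  · intro (i : Fin 2)
    fin_cases i
    exacts [a10.trans b11, a11.trans b12]
  · intro (i : Fin 2)
    fin_cases i
    exacts [a20.trans b30, a21.trans b31]

end Degrees

end LegendrianDGA

/-! ### Differentials of the generators of dimension 0 and 1, and of the outer cells -/

namespace LegendrianDGA
open Front ExV ExE ExF

/-- With two sheets the products of the end matrices with `bMat` vanish, so the differential is just
the sum of the two end entries. -/
theorem Front.dB_two {D : Front} (χ : D.Choices) (e : D.E) (σ : Fin 2 ≃ ESheet e)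
    {x y z : D.CellAlg} (h1 : (endMat χ e true).submatrix σ σ = !![0, x; 0, 0])
    (h0 : (endMat χ e false).submatrix σ σ = !![0, y; 0, 0])
    (hb : (bMat e).submatrix σ σ = !![0, z; 0, 0]) : dB χ e (σ 0) (σ 1) = x + y := by
  have h : (dB χ e).submatrix σ σ =
      !![0, x; 0, 0] * (1 + !![0, z; 0, 0]) + (1 + !![0, z; 0, 0]) * !![0, y; 0, 0] := by
    rw [← h1, ← h0, ← hb, ← Matrix.submatrix_one_equiv σ, ← Pi.add_apply, ← Pi.add_apply,
      ← Matrix.submatrix_add, Matrix.submatrix_mul_equiv, Matrix.submatrix_mul_equiv]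
    rfl
  refine (congrFun (congrFun h 0) 1).trans ?_
  simp only [Matrix.add_apply, Matrix.mul_apply, Fin.sum_univ_two]
  simp

/-- The two sheets above `B1` or `B2`. -/
def lowerSheets : Fin 2 ≃ {x : Fin 3 // (![.cusp, .smooth, .smooth] : Fin 3 → Kind) x ≠ .cusp} where
  toFun i := ⟨i.succ, by revert i; decide⟩
  invFun x := x.1.pred (by obtain ⟨x, hx⟩ := x; revert x; decide)
  left_inv i := by simp
  right_inv x := by simp

/-- The two sheets above `B3` or `B4`. -/
def upperSheets : Fin 2 ≃ {x : Fin 3 // (![.smooth, .smooth, .cusp] : Fin 3 → Kind) x ≠ .cusp} where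
  toFun i := ⟨i.castSucc, by revert i; decide⟩
  invFun x := x.1.castPred (by obtain ⟨x, hx⟩ := x; revert x; decide)
  left_inv i := by simp
  right_inv x := by simp

section

variable (χ : Sphere.Choices)

theorem dB_B1 :
    dB χ B1 ⟨(1 : Fin 3), by decide⟩ ⟨(2 : Fin 3), by decide⟩ = vGen A1 + 1 := by
  refine dB_two (D := Sphere) χ B1 lowerSheets (z := cuspGen B1) ?_ ?_ ?_
  -- On a cusp arc the cusp edge is not a sheet, so three sheets never meet at the swallowtail point
  -- and the plain `vMat` applies.
  · refine (congrArg (fun M => Matrix.submatrix M lowerSheets lowerSheets)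
      (if_neg (by decide))).trans ?_
    ext i j
    fin_cases i <;> fin_cases j <;> rfl
  · refine (congrArg (fun M => Matrix.submatrix M lowerSheets lowerSheets)
      (if_neg (by decide))).trans ?_
    ext i j
    fin_cases i <;> fin_cases j <;> rfl
  · ext i j
    fin_cases i <;> fin_cases j <;> rfl

theorem dB_B2 :
    dB χ B2 ⟨(1 : Fin 3), by decide⟩ ⟨(2 : Fin 3), by decide⟩ = vGen A1 + 1 := by
  refine dB_two (D := Sphere) χ B2 lowerSheets (z := cuspGen B2) ?_ ?_ ?_
  · refine (congrArg (fun M => Matrix.submatrix M lowerSheets lowerSheets)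
      (if_neg (by decide))).trans ?_
    ext i j
    fin_cases i <;> fin_cases j <;> rfl
  · refine (congrArg (fun M => Matrix.submatrix M lowerSheets lowerSheets)
      (if_neg (by decide))).trans ?_
    ext i j
    fin_cases i <;> fin_cases j <;> rfl
  · ext i j
    fin_cases i <;> fin_cases j <;> rfl

theorem dB_B3 :
    dB χ B3 ⟨(0 : Fin 3), by decide⟩ ⟨(1 : Fin 3), by decide⟩ = 1 + vGen A2 := by
  refine dB_two (D := Sphere) χ B3 upperSheets (z := cuspGen B3) ?_ ?_ ?_
  · refine (congrArg (fun M => Matrix.submatrix M upperSheets upperSheets)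
      (if_neg (by decide))).trans ?_
    ext i j
    fin_cases i <;> fin_cases j <;> rfl
  · refine (congrArg (fun M => Matrix.submatrix M upperSheets upperSheets)
      (if_neg (by decide))).trans ?_
    ext i j
    fin_cases i <;> fin_cases j <;> rfl
  · ext i j
    fin_cases i <;> fin_cases j <;> rfl

theorem dB_B4 :
    dB χ B4 ⟨(0 : Fin 3), by decide⟩ ⟨(1 : Fin 3), by decide⟩ = 1 + vGen A2 := by
  refine dB_two (D := Sphere) χ B4 upperSheets (z := cuspGen B4) ?_ ?_ ?_
  · refine (congrArg (fun M => Matrix.submatrix M upperSheets upperSheets)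
      (if_neg (by decide))).trans ?_
    ext i j
    fin_cases i <;> fin_cases j <;> rfl
  · refine (congrArg (fun M => Matrix.submatrix M upperSheets upperSheets)
      (if_neg (by decide))).trans ?_
    ext i j
    fin_cases i <;> fin_cases j <;> rfl
  · ext i j
    fin_cases i <;> fin_cases j <;> rfl

theorem dB_B5_apply (i j : Fin 4) : dB χ B5 ⟨i, (arcSheet.symm i).2⟩ ⟨j, (arcSheet.symm j).2⟩ =
    (hatM (vGen A2) 1 * (1 + Matrix.of arcGen) +
      (1 + Matrix.of arcGen) * hatM 1 (vGen A1)) i j :=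
  congrFun (congrFun (dB_B5 χ) (arcSheet.symm i)) (arcSheet.symm j)

variable (μ : Sphere.MaslovPotential)

/-- With two sheets above the vertex, the matrix of its generators squares to zero. -/
theorem diff_vGen : (cellularDGA μ χ).diff (vGen A1) = 0 ∧
    (cellularDGA μ χ).diff (vGen A2) = 0 := by
  have h (v : ExV) (hv : ∀ i j : Fin 2, a (D := Sphere) v i j = if i = 0 ∧ j = 1 then vGen v else 0) :
      (aMat (D := Sphere) v * aMat (D := Sphere) v) (0 : Fin 2) (1 : Fin 2) = 0 := by
    have e : aMat (D := Sphere) v = (!![0, vGen v; 0, 0] : Matrix (Fin 2) (Fin 2) _) := by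
      refine Matrix.ext fun (i j : Fin 2) => (hv i j).trans ?_
      fin_cases i <;> fin_cases j <;> rfl
    have e' : (!![0, vGen v; 0, 0] * !![0, vGen v; 0, 0] : Matrix (Fin 2) (Fin 2) _) 0 1 = 0 := by
      simp only [Matrix.mul_apply, Fin.sum_univ_two]
      simp
    rw [← e] at e'
    exact e'
  exact ⟨((cellularDGA μ χ).diff_gen (Sum.inl ⟨A1, ((0 : Fin 2), (1 : Fin 2)), by decide⟩)).trans
    (h A1 a_A1), ((cellularDGA μ χ).diff_gen
      (Sum.inl ⟨A2, ((0 : Fin 2), (1 : Fin 2)), by decide⟩)).trans (h A2 a_A2)⟩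

theorem diff_cuspGen_B1 : (cellularDGA μ χ).diff (cuspGen B1) = (vGen A1 + 1 : Sphere.CellAlg) :=
  ((cellularDGA μ χ).diff_gen
    (Sum.inr (Sum.inl ⟨B1, ((1 : Fin 3), (2 : Fin 3)), by decide⟩))).trans (dB_B1 χ)

theorem diff_cuspGen_B2 : (cellularDGA μ χ).diff (cuspGen B2) = (vGen A1 + 1 : Sphere.CellAlg) :=
  ((cellularDGA μ χ).diff_gen
    (Sum.inr (Sum.inl ⟨B2, ((1 : Fin 3), (2 : Fin 3)), by decide⟩))).trans (dB_B2 χ)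

theorem diff_cuspGen_B3 : (cellularDGA μ χ).diff (cuspGen B3) = (1 + vGen A2 : Sphere.CellAlg) :=
  ((cellularDGA μ χ).diff_gen
    (Sum.inr (Sum.inl ⟨B3, ((0 : Fin 3), (1 : Fin 3)), by decide⟩))).trans (dB_B3 χ)

theorem diff_cuspGen_B4 : (cellularDGA μ χ).diff (cuspGen B4) = (1 + vGen A2 : Sphere.CellAlg) :=
  ((cellularDGA μ χ).diff_gen
    (Sum.inr (Sum.inl ⟨B4, ((0 : Fin 3), (1 : Fin 3)), by decide⟩))).trans (dB_B4 χ)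

theorem diff_arcGen : (cellularDGA μ χ).diff (arcGen 0 1) = (vGen A2 + 1 : Sphere.CellAlg) ∧
    (cellularDGA μ χ).diff (arcGen 0 2) = (vGen A2 + 1 : Sphere.CellAlg) ∧
    (cellularDGA μ χ).diff (arcGen 1 3) = (1 + vGen A1 : Sphere.CellAlg) ∧
    (cellularDGA μ χ).diff (arcGen 2 3) = (1 + vGen A1 : Sphere.CellAlg) ∧
    (cellularDGA μ χ).diff (arcGen 0 3) =
      (vGen A2 * (arcGen 1 3 + arcGen 2 3) + (arcGen 0 1 + arcGen 0 2) * vGen A1 :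
        Sphere.CellAlg) := by
  have h (i j : Fin 4) := dB_B5_apply χ i j
  rw [one_add_arcGen] at h
  refine ⟨?_, ?_, ?_, ?_, ?_⟩
  · refine (((cellularDGA μ χ).diff_gen
      (Sum.inr (Sum.inl ⟨B5, ((0 : Fin 4), (1 : Fin 4)), by decide⟩))).trans (h 0 1)).trans ?_
    simp only [Matrix.add_apply, Matrix.mul_apply, Fin.sum_univ_four]
    simp [hatM, arcM]
    rfl
  · refine (((cellularDGA μ χ).diff_gen
      (Sum.inr (Sum.inl ⟨B5, ((0 : Fin 4), (2 : Fin 4)), by decide⟩))).trans (h 0 2)).trans ?_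
    simp only [Matrix.add_apply, Matrix.mul_apply, Fin.sum_univ_four]
    simp [hatM, arcM]
    rfl
  · refine (((cellularDGA μ χ).diff_gen
      (Sum.inr (Sum.inl ⟨B5, ((1 : Fin 4), (3 : Fin 4)), by decide⟩))).trans (h 1 3)).trans ?_
    simp only [Matrix.add_apply, Matrix.mul_apply, Fin.sum_univ_four]
    simp [hatM, arcM]
    rfl
  · refine (((cellularDGA μ χ).diff_gen
      (Sum.inr (Sum.inl ⟨B5, ((2 : Fin 4), (3 : Fin 4)), by decide⟩))).trans (h 2 3)).trans ?_
    simp only [Matrix.add_apply, Matrix.mul_apply, Fin.sum_univ_four]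
    simp [hatM, arcM]
    rfl
  · refine (((cellularDGA μ χ).diff_gen
      (Sum.inr (Sum.inl ⟨B5, ((0 : Fin 4), (3 : Fin 4)), by decide⟩))).trans (h 0 3)).trans ?_
    simp only [Matrix.add_apply, Matrix.mul_apply, Fin.sum_univ_four]
    simp [hatM, arcM, mul_add, add_mul]
    rfl

theorem diff_outerGen : (cellularDGA μ χ).diff (outerGen C1) = cuspGen B1 + cuspGen B2 ∧
    (cellularDGA μ χ).diff (outerGen C2) = cuspGen B3 + cuspGen B4 :=
  ⟨((cellularDGA μ χ).diff_gen
    (Sum.inr (Sum.inr ⟨C1, ((0 : Fin 2), (1 : Fin 2)), by decide⟩))).trans (dC_C1 χ),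
  ((cellularDGA μ χ).diff_gen
    (Sum.inr (Sum.inr ⟨C2, ((0 : Fin 2), (1 : Fin 2)), by decide⟩))).trans (dC_C2 χ)⟩

end
end LegendrianDGA

/-! ### Normal form of the pentagon relation -/

namespace LegendrianDGA

namespace BasedAlg

variable {m : ℕ} {A : BasedAlg m} {n : ℕ}

/-- The matrices of the edges of a pentagon, oriented according to `dir`, define transports. -/
theorem exists_transports {S : Subalgebra (ZMod 2) A.Alg} {ν : Fin n → ZMod m}
    {V Y : Fin 5 → Matrix (Fin n) (Fin n) A.Alg} {dir : Fin 5 → Bool}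
    (hU : ∀ k, IsUnipotent S ν (Y k))
    (hd : ∀ k, (Y k).map A.diff = if dir k then V k * Y k + Y k * V (k - 1)
      else V (k - 1) * Y k + Y k * V k) :
    ∃ y : Fin 5 → (Matrix (Fin n) (Fin n) A.Alg)ˣ, ∀ k,
      (y k : Matrix (Fin n) (Fin n) A.Alg) = (if dir k then Y k else geom (Y k)) ∧
      (↑(y k)⁻¹ : Matrix (Fin n) (Fin n) A.Alg) = (if dir k then geom (Y k) else Y k) ∧
      IsTransport S ν (V (k - 1)) (V k) (y k) := by
  have h (k : Fin 5) : ∃ u : (Matrix (Fin n) (Fin n) A.Alg)ˣ,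
      (u : Matrix (Fin n) (Fin n) A.Alg) = (if dir k then Y k else geom (Y k)) ∧
      (↑u⁻¹ : Matrix (Fin n) (Fin n) A.Alg) = (if dir k then geom (Y k) else Y k) ∧
      IsTransport S ν (V (k - 1)) (V k) u := by
    have hk := hd k
    cases hdir : dir k
    · rw [hdir] at hk
      obtain ⟨u, hu, hu', hT⟩ := (hU k).exists_isTransport hk
      exact ⟨u⁻¹, hu', by rw [inv_inv]; exact hu, hT.inv⟩
    · rw [hdir] at hk
      obtain ⟨u, hu, hu', hT⟩ := (hU k).exists_isTransport hk
      exact ⟨u, hu, hu', hT⟩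
  choose y hy using h
  exact ⟨y, hy⟩

/-- The relation that defines the differential of the matrix `C` of a `2`-cell with a pentagon whose
vertices and edges have the matrices `V` and `Y`. -/
def PentagonRelation (V Y : Fin 5 → Matrix (Fin n) (Fin n) A.Alg) (dir : Fin 5 → Bool)
    (C : Matrix (Fin n) (Fin n) A.Alg) : Prop :=
  ∃ (v w : Fin 5) (full : Bool), ∀ i j, i < j → A.diff (C i j) = (V w * C + C * V v +
    ((([0, 1, 2, 3, 4].rotate (v + 1)).take (pentagonLength v w full)).map fun k =>
      if dir k then Y k else geom (Y k)).reverse.prod +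
    ((([0, 1, 2, 3, 4].rotate (v + 1)).drop (pentagonLength v w full)).map fun k =>
      if dir k then geom (Y k) else Y k).prod) i j

/-- Strictly upper triangular matrices. -/
def IsStrictUpper (M : Matrix (Fin n) (Fin n) A.Alg) : Prop := ∀ i j, j ≤ i → M i j = 0

theorem IsStrictUpper.mul {M N : Matrix (Fin n) (Fin n) A.Alg} (hM : IsStrictUpper M)
    (hN : IsStrictUpper N) : IsStrictUpper (M * N) := by
  intro i j h
  rw [Matrix.mul_apply]
  refine Finset.sum_eq_zero fun s _ => ?_
  rcases le_or_gt s i with hs | hs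
  · rw [hM i s hs, zero_mul]
  · rw [hN s j (h.trans hs.le), mul_zero]

theorem IsStrictUpper.add {M N : Matrix (Fin n) (Fin n) A.Alg} (hM : IsStrictUpper M)
    (hN : IsStrictUpper N) : IsStrictUpper (M + N) := fun i j h => by
  rw [Matrix.add_apply, hM i j h, hN i j h, add_zero]

/-- The diagonal becomes `1 + 1 = 0`. -/
theorem IsUnipotent.add_isStrictUpper {S : Subalgebra (ZMod 2) A.Alg} {ν : Fin n → ZMod m}
    {M N : Matrix (Fin n) (Fin n) A.Alg} (hM : IsUnipotent S ν M) (hN : IsUnipotent S ν N) :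
    IsStrictUpper (M + N) := by
  intro i j h
  rw [Matrix.add_apply]
  rcases h.lt_or_eq with h | rfl
  · rw [hM.lower i j h, hN.lower i j h, add_zero]
  · rw [hM.diag, hN.diag, A.add_self]

/-- What follows from the relation of a `2`-cell: its differential is homogeneous with square zero,
and the matrix `C` can be conjugated so that the differential takes a normal form that is
independent of the choice of initial and terminal vertices. -/
theorem PentagonRelation.normal_form {S : Subalgebra (ZMod 2) A.Alg} {ν : Fin n → ZMod m}
    {V Y : Fin 5 → Matrix (Fin n) (Fin n) A.Alg} {dir : Fin 5 → Bool}
    {C W : Matrix (Fin n) (Fin n) A.Alg} (h : PentagonRelation V Y dir C)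
    (hU : ∀ k, IsUnipotent S ν (Y k))
    (hd : ∀ k, (Y k).map A.diff = if dir k then V k * Y k + Y k * V (k - 1)
      else V (k - 1) * Y k + Y k * V k)
    (hV : ∀ k, (V k).map A.diff = V k * V k) (hVs : ∀ k, IsStrictUpper (V k))
    (hVh : ∀ k, IsHomogMatrix ν (-1) (V k)) (hCs : IsStrictUpper C) (hCh : IsHomogMatrix ν 1 C)
    (hW : ∀ y : Fin 5 → (Matrix (Fin n) (Fin n) A.Alg)ˣ,
      (∀ k, (y k : Matrix (Fin n) (Fin n) A.Alg) = (if dir k then Y k else geom (Y k)) ∧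
        (↑(y k)⁻¹ : Matrix (Fin n) (Fin n) A.Alg) = (if dir k then geom (Y k) else Y k)) →
      (↑(pentagonPath y 4) : Matrix (Fin n) (Fin n) A.Alg) = W ∨
      (↑(pentagonPath y 4)⁻¹ : Matrix (Fin n) (Fin n) A.Alg) = W) :
    (C.map A.diff).map A.diff = 0 ∧ IsHomogMatrix ν 0 (C.map A.diff) ∧
    ∃ G H : Matrix (Fin n) (Fin n) A.Alg, IsUnipotent S ν G ∧ IsUnipotent S ν H ∧
      (G * C * H).map A.diff = V 4 * (G * C * H) + (G * C * H) * V 4 + (1 + W) := by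
  obtain ⟨v, w, full, h⟩ := h
  obtain ⟨y, hy⟩ := exists_transports hU hd
  obtain ⟨U, hU4, hUW⟩ : ∃ U : (Matrix (Fin n) (Fin n) A.Alg)ˣ,
      (pentagonPath y 4 = U ∨ (pentagonPath y 4)⁻¹ = U) ∧ (U : Matrix (Fin n) (Fin n) A.Alg) = W := by
    rcases hW y fun k => ⟨(hy k).1, (hy k).2.1⟩ with hW | hW
    exacts [⟨_, Or.inl rfl, hW⟩, ⟨_, Or.inr rfl, hW⟩]
  obtain ⟨⟨X, X', hX, hX', hP⟩, G, H, hG, hH, hGH⟩ :=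
    exists_normal_form (fun k => (hy k).2.2) hU4 v w full rfl
  set P := (↑((([0, 1, 2, 3, 4].rotate (v + 1)).take
        (pentagonLength v w full)).map y).reverse.prod +
      ↑((([0, 1, 2, 3, 4].rotate (v + 1)).drop (pentagonLength v w full)).map
        fun k => (y k)⁻¹).prod : Matrix (Fin n) (Fin n) A.Alg) with hPdef
  have hPs : IsStrictUpper P := by
    rw [hP]
    exact hX.unip.add_isStrictUpper hX'.unip
  have hPh : IsHomogMatrix ν 0 P := by
    rw [hP]
    exact hX.unip.homog.add hX'.unip.homog
  have hC : C.map A.diff = V w * C + C * V v + P := by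
    ext i j
    -- The relation is given only above the diagonal, where there are generators. On and below it
    -- both sides vanish.
    rcases lt_or_ge i j with hij | hij
    · have e : (fun k => if dir k then Y k else geom (Y k)) =
          Units.coeHom (Matrix (Fin n) (Fin n) A.Alg) ∘ y := funext fun k => (hy k).1.symm
      have e' : (fun k => if dir k then geom (Y k) else Y k) =
          Units.coeHom (Matrix (Fin n) (Fin n) A.Alg) ∘ fun k => (y k)⁻¹ :=
        funext fun k => (hy k).2.1.symm
      rw [Matrix.map_apply, h i j hij, hPdef, ← Units.coeHom_apply, ← Units.coeHom_apply,
        map_list_prod, map_list_prod, List.map_reverse, List.map_map, List.map_map, ← add_assoc,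
        e, e']
    · rw [Matrix.map_apply, hCs i j hij, map_zero]
      exact ((((hVs w).mul hCs).add (hCs.mul (hVs v))).add hPs i j hij).symm
  refine ⟨?_, ?_, G, H, hG.unip, hH.unip, ?_⟩
  · have := diff_cell_eq_zero (hV v) (hV w) ⟨X, X', hX, hX', hP⟩ hC
    rwa [← hC] at this
  · rw [hC]
    have h1 := (hVh w).mul hCh
    have h2 := hCh.mul (hVh v)
    rw [neg_add_cancel] at h1
    rw [add_neg_cancel] at h2
    exact (h1.add h2).add hPh
  · rw [← hUW]
    exact diff_conj hG hH hGH hC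

theorem IsUnipotent.geom_of_mul_self {S : Subalgebra (ZMod 2) A.Alg} {ν : Fin n → ZMod m}
    {M : Matrix (Fin n) (Fin n) A.Alg} (hM : IsUnipotent S ν M) (h : M * M = 1) :
    BasedAlg.geom M = M := by
  have := congrArg (M * ·) hM.mul_geom
  simpa [← mul_assoc, h] using this

end BasedAlg

end LegendrianDGA

/-! ### Labels of the generators, and entries of the normal form -/

namespace LegendrianDGA

/-- Labels for the generators of the cellular DGA of the two-swallowtail sphere: the generators
`a1`, `a2` of `0`-cells, `b1`, ..., `b4` of cusp arcs, `p`, `q`, `r`, `s`, `t` (for the pairs of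
sheets `12`, `13`, `14`, `24`, `34`) of the crossing arc, `o1`, `o2` of the outer `2`-cells and
`cij` of the inner `2`-cells `C3` (`false`) and `C4` (`true`). -/
inductive SphereGen
  | a1 | a2 | b1 | b2 | b3 | b4 | p | q | r | s | t | o1 | o2
  | c12 (f : Bool) | c13 (f : Bool) | c14 (f : Bool) | c23 (f : Bool) | c24 (f : Bool)
  | c34 (f : Bool)
  deriving DecidableEq, Fintype

namespace SphereGen

/-- The degrees of the generators. -/
def deg : SphereGen → ℤ
  | a1 | a2 => 0
  | b1 | b2 | b3 | b4 | p | q | s | t => 1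
  | r | o1 | o2 => 2
  | c23 _ => 1
  | c12 _ | c13 _ | c24 _ | c34 _ => 2
  | c14 _ => 3

/-- The order in which the generators are changed. -/
def rank : SphereGen → ℕ
  | a1 | a2 => 0
  | b1 | b3 => 1
  | b2 | b4 => 2
  | p | q | s | t | o1 | o2 => 3
  | c12 _ | c34 _ => 4
  | r | c23 _ => 5
  | c13 _ => 6
  | c24 _ => 7
  | c14 _ => 8

section Matrices

variable {R : Type*} [Ring R] (X : SphereGen → R)

/-- The matrices of the vertices of the pentagons of the inner `2`-cells. -/
def vertexMat : Bool → Fin 5 → Matrix (Fin 4) (Fin 4) R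
  | false => ![vertexM 1 (X a1), hatM 1 (X a1), hatM (X a2) 1, vertexM (X a2) 1, vertexM 1 1]
  | true => ![vertexM (X a2) 1, hatM (X a2) 1, hatM 1 (X a1), vertexM 1 (X a1), vertexM 1 1]

/-- The matrices of the edges of the pentagons of the inner `2`-cells. -/
def edgeMat : Bool → Fin 5 → Matrix (Fin 4) (Fin 4) R
  | false => ![cuspM 0 (X b2), shearM, arcM (X q) (X p) (X r) (X t) (X s), shearM, cuspM (X b4) 0]
  | true => ![cuspM (X b3) 0, shearM, arcM (X p) (X q) (X r) (X s) (X t), shearM, cuspM 0 (X b1)]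

/-- Whether an edge of the pentagon is oriented counter-clockwise. -/
def edgeDir : Bool → Fin 5 → Bool
  | false, k => decide (k ≠ 1)
  | true, k => decide (k = 3)

/-- The matrices of the inner `2`-cells. -/
def cellMat (f : Bool) : Matrix (Fin 4) (Fin 4) R :=
  !![0, X (c12 f), X (c13 f), X (c14 f); 0, 0, X (c23 f), X (c24 f); 0, 0, 0, X (c34 f); 0, 0, 0, 0]

/-- The products of the matrices along the boundaries of the inner `2`-cells. -/
def boundaryMat : Bool → Matrix (Fin 4) (Fin 4) R
  | false => arcM (X q + X b4) (X q + X p) (X r + X b4 * (X t + X s) + (X q + X p) * X b2)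
      (X t + X s) (X s + X b2)
  | true => arcM (X p + X b3) (X p + X q) (X r + X b3 * (X s + X t) + (X p + X q) * X b1)
      (X s + X t) (X t + X b1)

/-- What is added to the generators to obtain those in which the differential is standard. -/
def shift (u13 u24 u14 : Bool → R) : SphereGen → R
  | a1 | a2 => 1
  | b1 | b3 | o1 | o2 => 0
  | b2 => X b1
  | b4 => X b3
  | p => X b3
  | q => X b4
  | t => X b1
  | s => X b2
  | r => X a2 * (X (c34 true) + X (c34 false) + X o1) +
      (X (c12 true) + X (c12 false) + X o2) * X a1
  | c12 _ | c34 _ => 0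
  | c23 f => boundaryMat X f 0 2
  | c13 f => u13 f
  | c24 f => u24 f + (X (c13 f) + u13 f) + boundaryMat X f 0 3
  | c14 f => u14 f

end Matrices

/-- The generators that are cancelled against each other. -/
def pairs : List (SphereGen × SphereGen) :=
  [(b1, a1), (o1, b2), (b3, a2), (o2, b4), (c12 true, p), (c12 false, q), (c34 true, t),
    (c34 false, s), (c13 false, c23 false), (c13 true, c23 true), (c14 false, c24 false),
    (c14 true, c24 true)]

end SphereGen

namespace BasedAlg

open SphereGen

variable {m : ℕ} {A : BasedAlg m}

/-- The degrees of the four sheets above an inner `2`-cell. -/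
def sheetDeg (m : ℕ) : Fin 4 → ZMod m := ![1, 0, 0, -1]

section

variable {S : Subalgebra (ZMod 2) A.Alg}

theorem isUnipotent_arcM {p q r s t : A.Alg} (hp : p ∈ S) (hq : q ∈ S) (hr : r ∈ S) (hs : s ∈ S)
    (ht : t ∈ S) (hp' : p ∈ A.homog 1) (hq' : q ∈ A.homog 1) (hr' : r ∈ A.homog 2)
    (hs' : s ∈ A.homog 1) (ht' : t ∈ A.homog 1) :
    IsUnipotent S (sheetDeg m) (arcM p q r s t) where
  lower i j h := by
    fin_cases i <;> fin_cases j <;> first | rfl | exact absurd h (by decide)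
  diag i := by fin_cases i <;> rfl
  mem i j := by
    fin_cases i <;> fin_cases j <;>
      first | assumption | exact one_mem S | exact zero_mem S
  homog i j := by
    have h2 : (1 - -1 : ZMod m) = 2 := by ring
    fin_cases i <;> fin_cases j <;>
      simp [sheetDeg, arcM, A.one_mem_homog, *]

theorem isUnipotent_cuspM {x y : A.Alg} (hx : x ∈ S) (hy : y ∈ S) (hx' : x ∈ A.homog 1)
    (hy' : y ∈ A.homog 1) : IsUnipotent S (sheetDeg m) (cuspM x y) :=
  isUnipotent_arcM hx (zero_mem _) (zero_mem _) (zero_mem _) hy hx' (zero_mem _) (zero_mem _)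
    (zero_mem _) hy'

theorem isUnipotent_shearM : IsUnipotent S (sheetDeg m) (shearM : Matrix _ _ A.Alg) where
  lower i j h := by
    fin_cases i <;> fin_cases j <;> first | rfl | exact absurd h (by decide)
  diag i := by fin_cases i <;> rfl
  mem i j := by
    fin_cases i <;> fin_cases j <;> first | exact one_mem S | exact zero_mem S
  homog i j := by
    fin_cases i <;> fin_cases j <;> simp [sheetDeg, shearM, A.one_mem_homog]

theorem shearM_mul_self : (shearM * shearM : Matrix _ _ A.Alg) = 1 := by
  ext i j
  fin_cases i <;> fin_cases j <;> simp [shearM, A.add_self]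

theorem geom_shearM : geom (shearM : Matrix _ _ A.Alg) = shearM :=
  (isUnipotent_shearM (S := ⊤)).geom_of_mul_self shearM_mul_self

theorem isStrictUpper_vertexM (x y : A.Alg) : IsStrictUpper (vertexM x y) := by
  intro i j h
  fin_cases i <;> fin_cases j <;> first | rfl | exact absurd h (by decide)

theorem isStrictUpper_hatM (x y : A.Alg) : IsStrictUpper (hatM x y) := by
  intro i j h
  fin_cases i <;> fin_cases j <;> first | rfl | exact absurd h (by decide)

theorem isHomogMatrix_vertexM {x y : A.Alg} (hx : x ∈ A.homog 0) (hy : y ∈ A.homog 0) :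
    IsHomogMatrix (sheetDeg m) (-1) (vertexM x y) := by
  intro i j
  fin_cases i <;> fin_cases j <;> simp [sheetDeg, vertexM, hx, hy]

theorem isHomogMatrix_hatM {x y : A.Alg} (hx : x ∈ A.homog 0) (hy : y ∈ A.homog 0) :
    IsHomogMatrix (sheetDeg m) (-1) (hatM x y) := by
  intro i j
  fin_cases i <;> fin_cases j <;> simp [sheetDeg, hatM, hx, hy]

/-- The entries of the normal form of the matrix of an inner `2`-cell. -/
theorem exists_cell_form {ν : Fin 4 → ZMod m} {G C H W : Matrix (Fin 4) (Fin 4) A.Alg}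
    (hG : IsUnipotent S ν G) (hH : IsUnipotent S ν H) (hC : IsStrictUpper C)
    (hCh : IsHomogMatrix ν 1 C)
    (h : (G * C * H).map A.diff = vertexM 1 1 * (G * C * H) + (G * C * H) * vertexM 1 1 + (1 + W))
    {T T' : Subalgebra (ZMod 2) A.Alg} (hST : S ≤ T) (hTT : T ≤ T') (h01 : C 0 1 ∈ T)
    (h12 : C 1 2 ∈ T) (h23 : C 2 3 ∈ T) (h02 : C 0 2 ∈ T') (h13 : C 1 3 ∈ T') :
    A.diff (C 0 1) = W 0 1 ∧ A.diff (C 2 3) = W 2 3 ∧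
    ∃ u02 ∈ T, ∃ u13 ∈ T, ∃ u03 ∈ T', u02 ∈ A.homog (ν 0 - ν 2 + 1) ∧
      u13 ∈ A.homog (ν 1 - ν 3 + 1) ∧ u03 ∈ A.homog (ν 0 - ν 3 + 1) ∧
      A.diff (C 0 2 + u02) = C 1 2 + W 0 2 ∧
      A.diff (C 0 3 + u03) = (C 1 3 + u13) + (C 0 2 + u02) + W 0 3 := by
  have hhom : IsHomogMatrix ν 1 (G * C * H) := by
    have := (hG.homog.mul hCh).mul hH.homog
    rwa [zero_add, add_zero] at this
  have hu (i j : Fin 4) : (G * C * H) i j + C i j ∈ A.homog (ν i - ν j + 1) :=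
    add_mem (hhom i j) (hCh i j)
  have hsum (i j : Fin 4) : C i j + ((G * C * H) i j + C i j) = (G * C * H) i j := by
    rw [add_left_comm, A.add_self, add_zero]
  -- All vanishing entries are listed so that the triple product collapses. Its entries just above
  -- the diagonal are those of `C`, and the others change by terms of lower rank.
  have l (i j : Fin 4) (hij : j ≤ i) : C i j = 0 := hC i j hij
  have C00 := l 0 0 (by decide)
  have C10 := l 1 0 (by decide)
  have C11 := l 1 1 (by decide)
  have C20 := l 2 0 (by decide)
  have C21 := l 2 1 (by decide)
  have C22 := l 2 2 (by decide)
  have C30 := l 3 0 (by decide)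
  have C31 := l 3 1 (by decide)
  have C32 := l 3 2 (by decide)
  have C33 := l 3 3 (by decide)
  have G10 := hG.lower 1 0 (by decide)
  have G20 := hG.lower 2 0 (by decide)
  have G21 := hG.lower 2 1 (by decide)
  have G30 := hG.lower 3 0 (by decide)
  have G31 := hG.lower 3 1 (by decide)
  have G32 := hG.lower 3 2 (by decide)
  have H10 := hH.lower 1 0 (by decide)
  have H20 := hH.lower 2 0 (by decide)
  have H21 := hH.lower 2 1 (by decide)
  have H30 := hH.lower 3 0 (by decide)
  have H31 := hH.lower 3 1 (by decide)
  have H32 := hH.lower 3 2 (by decide)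
  have e (i j : Fin 4) := congrFun (congrFun h i) j
  set M := G * C * H with hM
  have M_apply (i j : Fin 4) : M i j = (G i 0 * C 0 1 + G i 1 * 0) * H 1 j +
      (G i 0 * C 0 2 + G i 1 * C 1 2) * H 2 j +
      (G i 0 * C 0 3 + G i 1 * C 1 3 + G i 2 * C 2 3) * H 3 j := by
    simp only [hM, Matrix.mul_apply, Fin.sum_univ_four, C00, C10, C11, C20, C21, C22, C30, C31,
      C32, C33, mul_zero, zero_mul, add_zero, zero_add]
  have M01 : M 0 1 = C 0 1 := by simp [M_apply, hG.diag, hH.diag, H21, H31]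
  have M12 : M 1 2 = C 1 2 := by simp [M_apply, hG.diag, hH.diag, H32, G10]
  have M23 : M 2 3 = C 2 3 := by simp [M_apply, hG.diag, hH.diag, G20, G21]
  have M02 : M 0 2 + C 0 2 = C 0 1 * H 1 2 + G 0 1 * C 1 2 := by
    -- A double `C 0 2` is added on the right, since the ring normalizer cannot cancel the one that
    -- occurs twice on the left.
    rw [← add_zero (_ + G 0 1 * C 1 2), ← A.add_self (C 0 2), M_apply, hG.diag, hH.diag, H32]
    noncomm_ring
  have M13 : M 1 3 + C 1 3 = C 1 2 * H 2 3 + G 1 2 * C 2 3 := by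
    rw [← add_zero (_ + G 1 2 * C 2 3), ← A.add_self (C 1 3), M_apply, hG.diag, hH.diag, G10]
    noncomm_ring
  have M03 : M 0 3 + C 0 3 = C 0 1 * H 1 3 + (C 0 2 + G 0 1 * C 1 2) * H 2 3 +
      (G 0 1 * C 1 3 + G 0 2 * C 2 3) := by
    rw [← add_zero (_ + (G 0 1 * C 1 3 + _)), ← A.add_self (C 0 3), M_apply, hG.diag, hH.diag]
    noncomm_ring
  have M_lower (i j : Fin 4) (hij : j ≤ i) : M i j = 0 := by
    fin_cases i <;> fin_cases j <;> first | exact absurd hij (by decide) | skip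
    all_goals simp [M_apply, G10, G20, G21, G30, G31, G32, H10, H20, H21, H30, H31, H32]
  refine ⟨?_, ?_, M 0 2 + C 0 2, ?_, M 1 3 + C 1 3, ?_, M 0 3 + C 0 3, ?_, hu 0 2, hu 1 3, hu 0 3,
    ?_, ?_⟩
  · have := e 0 1
    simp only [Matrix.map_apply, Matrix.add_apply, Matrix.mul_apply, Fin.sum_univ_four] at this
    simpa [M01, vertexM, M_lower] using this
  · have := e 2 3
    simp only [Matrix.map_apply, Matrix.add_apply, Matrix.mul_apply, Fin.sum_univ_four] at this
    simpa [M23, vertexM, M_lower] using this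
  · rw [M02]
    exact add_mem (mul_mem h01 (hST (hH.mem _ _))) (mul_mem (hST (hG.mem _ _)) h12)
  · rw [M13]
    exact add_mem (mul_mem h12 (hST (hH.mem _ _))) (mul_mem (hST (hG.mem _ _)) h23)
  · have hS := hST.trans hTT
    rw [M03]
    exact add_mem (add_mem (mul_mem (hTT h01) (hS (hH.mem _ _))) (mul_mem (add_mem h02
      (mul_mem (hS (hG.mem _ _)) (hTT h12))) (hS (hH.mem _ _))))
      (add_mem (mul_mem (hS (hG.mem _ _)) h13) (mul_mem (hS (hG.mem _ _)) (hTT h23)))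
  · have := e 0 2
    simp only [Matrix.map_apply, Matrix.add_apply, Matrix.mul_apply, Fin.sum_univ_four] at this
    rw [hsum]
    simpa [M12, vertexM, M_lower] using this
  · have := e 0 3
    simp only [Matrix.map_apply, Matrix.add_apply, Matrix.mul_apply, Fin.sum_univ_four] at this
    rw [hsum, hsum, hsum]
    simpa [vertexM, M_lower] using this

end

end BasedAlg
end LegendrianDGA

/-! ### The model of the sphere is a differential graded algebra -/

namespace LegendrianDGA
namespace BasedAlg

open SphereGen

variable {m : ℕ} {A : BasedAlg m}

/-- The generators `X` of `A` have the degrees and differentials of those of the cellular DGA of the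
two-swallowtail sphere. -/
structure IsSphereModel (A : BasedAlg m) (x : SphereGen ≃ A.Gen) (X : SphereGen → A.Alg) :
    Prop where
  gen_eq : ∀ g, A.gen (x g) = X g
  deg_eq : ∀ g, A.deg (x g) = (g.deg : ZMod m)
  diff_a : A.diff (X a1) = 0 ∧ A.diff (X a2) = 0
  diff_b1 : A.diff (X b1) = X a1 + 1
  diff_b2 : A.diff (X b2) = X a1 + 1
  diff_b3 : A.diff (X b3) = 1 + X a2
  diff_b4 : A.diff (X b4) = 1 + X a2
  diff_p : A.diff (X p) = X a2 + 1
  diff_q : A.diff (X q) = X a2 + 1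
  diff_s : A.diff (X s) = 1 + X a1
  diff_t : A.diff (X t) = 1 + X a1
  diff_r : A.diff (X r) = X a2 * (X s + X t) + (X p + X q) * X a1
  diff_o1 : A.diff (X o1) = X b1 + X b2
  diff_o2 : A.diff (X o2) = X b3 + X b4
  cell : ∀ f, PentagonRelation (vertexMat X f) (edgeMat X f) (edgeDir f) (cellMat X f)

theorem isStrictUpper_vertexMat (X : SphereGen → A.Alg) (f : Bool) (k : Fin 5) : IsStrictUpper (vertexMat X f k) := by
  cases f <;> fin_cases k <;>
    first | exact isStrictUpper_vertexM _ _ | exact isStrictUpper_hatM _ _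

/-- The direction in which all three sides run along their orientation is used: counter-clockwise
for `C3`, clockwise for `C4`. Only shears are then inverted, and these are involutions. -/
theorem pentagonPath_eq_boundaryMat (X : SphereGen → A.Alg) (f : Bool) (y : Fin 5 → (Matrix (Fin 4) (Fin 4) A.Alg)ˣ)
    (hy : ∀ k, (y k : Matrix (Fin 4) (Fin 4) A.Alg) =
        (if edgeDir f k then edgeMat X f k else geom (edgeMat X f k)) ∧
      (↑(y k)⁻¹ : Matrix (Fin 4) (Fin 4) A.Alg) =
        (if edgeDir f k then geom (edgeMat X f k) else edgeMat X f k)) :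
    (↑(pentagonPath y 4) : Matrix (Fin 4) (Fin 4) A.Alg) = boundaryMat X f ∨
      (↑(pentagonPath y 4)⁻¹ : Matrix (Fin 4) (Fin 4) A.Alg) = boundaryMat X f := by
  cases f
  · left
    have h0 : (y 0 : Matrix (Fin 4) (Fin 4) A.Alg) = cuspM 0 (X b2) := (hy 0).1
    have h1 : (y 1 : Matrix (Fin 4) (Fin 4) A.Alg) = shearM := ((hy 1).1).trans geom_shearM
    have h2 : (y 2 : Matrix (Fin 4) (Fin 4) A.Alg) = _ := (hy 2).1
    have h3 : (y 3 : Matrix (Fin 4) (Fin 4) A.Alg) = shearM := (hy 3).1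
    have h4 : (y 4 : Matrix (Fin 4) (Fin 4) A.Alg) = cuspM (X b4) 0 := (hy 4).1
    change (↑(y 4 * (y 3 * (y 2 * (y 1 * y 0)))) : Matrix (Fin 4) (Fin 4) A.Alg) = _
    simp only [Units.val_mul, h0, h1, h2, h3, h4]
    exact prod_boundary A.add_self _ _ _ _ _ _ _
  · right
    have h0 : (↑(y 0)⁻¹ : Matrix (Fin 4) (Fin 4) A.Alg) = cuspM (X b3) 0 := (hy 0).2
    have h1 : (↑(y 1)⁻¹ : Matrix (Fin 4) (Fin 4) A.Alg) = shearM := (hy 1).2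
    have h2 : (↑(y 2)⁻¹ : Matrix (Fin 4) (Fin 4) A.Alg) = _ := (hy 2).2
    have h3 : (↑(y 3)⁻¹ : Matrix (Fin 4) (Fin 4) A.Alg) = shearM := ((hy 3).2).trans geom_shearM
    have h4 : (↑(y 4)⁻¹ : Matrix (Fin 4) (Fin 4) A.Alg) = cuspM 0 (X b1) := (hy 4).2
    change (↑(y 4 * (y 3 * (y 2 * (y 1 * y 0))))⁻¹ : Matrix (Fin 4) (Fin 4) A.Alg) = _
    simp only [mul_inv_rev, Units.val_mul, h0, h1, h2, h3, h4, mul_assoc]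
    exact prod_boundary A.add_self _ _ _ _ _ _ _

theorem isStrictUpper_cellMat (X : SphereGen → A.Alg) (f : Bool) : IsStrictUpper (cellMat X f) := by
  intro i j h
  fin_cases i <;> fin_cases j <;> first | rfl | exact absurd h (by decide)

namespace IsSphereModel

variable {x : SphereGen ≃ A.Gen} {X : SphereGen → A.Alg} (hA : IsSphereModel A x X)
include hA

theorem mem_homog {g : SphereGen} {d : ZMod m} (h : (g.deg : ZMod m) = d) :
    X g ∈ A.homog d := by
  rw [← hA.gen_eq, ← h, ← hA.deg_eq]
  exact A.gen_mem_homog _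

theorem mem_low {g : SphereGen} {n : ℕ} (h : g.rank < n) :
    X g ∈ A.low (fun y => (x.symm y).rank) n := by
  rw [← hA.gen_eq]
  exact gen_mem_low (by rwa [x.symm_apply_apply])

theorem map_vertexMat (f : Bool) (k : Fin 5) :
    (vertexMat X f k).map A.diff = vertexMat X f k * vertexMat X f k := by
  have h1 := hA.diff_a.1
  have h2 := hA.diff_a.2
  have h := A.diff_one
  cases f <;> fin_cases k
  exacts [map_vertexM h h1, map_hatM h h1, map_hatM h2 h, map_vertexM h2 h, map_vertexM h h,
    map_vertexM h2 h, map_hatM h2 h, map_hatM h h1, map_vertexM h h1, map_vertexM h h]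

theorem isHomogMatrix_vertexMat (f : Bool) (k : Fin 5) :
    IsHomogMatrix (sheetDeg m) (-1) (vertexMat X f k) := by
  have h1 : X a1 ∈ A.homog 0 := hA.mem_homog (by simp [SphereGen.deg])
  have h2 : X a2 ∈ A.homog 0 := hA.mem_homog (by simp [SphereGen.deg])
  have h := A.one_mem_homog
  cases f <;> fin_cases k
  exacts [isHomogMatrix_vertexM h h1, isHomogMatrix_hatM h h1, isHomogMatrix_hatM h2 h,
    isHomogMatrix_vertexM h2 h, isHomogMatrix_vertexM h h, isHomogMatrix_vertexM h2 h,
    isHomogMatrix_hatM h2 h, isHomogMatrix_hatM h h1, isHomogMatrix_vertexM h h1,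
    isHomogMatrix_vertexM h h]

/-- The bound 6 admits all generators of edges, including `r` of rank 5. -/
theorem isUnipotent_edgeMat (f : Bool) (k : Fin 5) :
    IsUnipotent (A.low (fun y => (x.symm y).rank) 6) (sheetDeg m) (edgeMat X f k) := by
  have hl (g : SphereGen) (hg : g.rank < 6) := hA.mem_low hg
  have h1 (g : SphereGen) (hg : g.deg = 1) : X g ∈ A.homog 1 := hA.mem_homog (by rw [hg]; simp)
  have h2 : X r ∈ A.homog 2 := hA.mem_homog (by simp [SphereGen.deg])
  cases f <;> fin_cases k
  exacts [isUnipotent_cuspM (zero_mem _) (hl _ (by decide)) (zero_mem _) (h1 _ rfl),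
    isUnipotent_shearM,
    isUnipotent_arcM (hl _ (by decide)) (hl _ (by decide)) (hl _ (by decide)) (hl _ (by decide))
      (hl _ (by decide)) (h1 _ rfl) (h1 _ rfl) h2 (h1 _ rfl) (h1 _ rfl),
    isUnipotent_shearM,
    isUnipotent_cuspM (hl _ (by decide)) (zero_mem _) (h1 _ rfl) (zero_mem _),
    isUnipotent_cuspM (hl _ (by decide)) (zero_mem _) (h1 _ rfl) (zero_mem _),
    isUnipotent_shearM,
    isUnipotent_arcM (hl _ (by decide)) (hl _ (by decide)) (hl _ (by decide)) (hl _ (by decide))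
      (hl _ (by decide)) (h1 _ rfl) (h1 _ rfl) h2 (h1 _ rfl) (h1 _ rfl),
    isUnipotent_shearM,
    isUnipotent_cuspM (zero_mem _) (hl _ (by decide)) (zero_mem _) (h1 _ rfl)]

theorem map_arcM : (arcM (X p) (X q) (X r) (X s) (X t)).map A.diff =
    hatM (X a2) 1 * arcM (X p) (X q) (X r) (X s) (X t) +
      arcM (X p) (X q) (X r) (X s) (X t) * hatM 1 (X a1) := by
  ext i j
  simp only [Matrix.map_apply, Matrix.add_apply, Matrix.mul_apply, Fin.sum_univ_four]
  fin_cases i <;> fin_cases j <;>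
    simp [arcM, hatM, hA.diff_p, hA.diff_q, hA.diff_r, hA.diff_s, hA.diff_t, diff_one, mul_add,
      add_mul, A.add_self]

/-- Exchanging the crossing sheets swaps `p` with `q` and `s` with `t`, which leaves the
differentials symmetric. -/
theorem map_arcM' : (arcM (X q) (X p) (X r) (X t) (X s)).map A.diff =
    hatM (X a2) 1 * arcM (X q) (X p) (X r) (X t) (X s) +
      arcM (X q) (X p) (X r) (X t) (X s) * hatM 1 (X a1) := by
  ext i j
  simp only [Matrix.map_apply, Matrix.add_apply, Matrix.mul_apply, Fin.sum_univ_four]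
  fin_cases i <;> fin_cases j <;>
    simp [arcM, hatM, hA.diff_p, hA.diff_q, hA.diff_r, hA.diff_s, hA.diff_t, diff_one, mul_add,
      add_mul, A.add_self, add_comm]

theorem map_edgeMat (f : Bool) (k : Fin 5) : (edgeMat X f k).map A.diff =
    if edgeDir f k then vertexMat X f k * edgeMat X f k + edgeMat X f k * vertexMat X f (k - 1)
      else vertexMat X f (k - 1) * edgeMat X f k + edgeMat X f k * vertexMat X f k := by
  -- The zero entry of a cusp edge matrix sits between entries 1 at both ends, so its differential
  -- is viewed as `1 + 1`.
  have h0 : A.diff 0 = 1 + 1 := by rw [map_zero, A.add_self]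
  cases f <;> fin_cases k
  exacts [map_cuspM h0 (hA.diff_b2), map_shearM' _ _, hA.map_arcM', map_shearM' _ _,
    map_cuspM hA.diff_b4 h0, map_cuspM hA.diff_b3 h0, map_shearM' _ _, hA.map_arcM,
    map_shearM' _ _, map_cuspM h0 hA.diff_b1]

theorem isHomogMatrix_cellMat (f : Bool) : IsHomogMatrix (sheetDeg m) 1 (cellMat X f) := by
  intro i j
  fin_cases i <;> fin_cases j <;>
    first
    | exact zero_mem _
    | exact hA.mem_homog (by simp [SphereGen.deg, sheetDeg]; try norm_num)

theorem cell_normal_form (f : Bool) :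
    ((cellMat X f).map A.diff).map A.diff = 0 ∧
    IsHomogMatrix (sheetDeg m) 0 ((cellMat X f).map A.diff) ∧
    ∃ G H : Matrix (Fin 4) (Fin 4) A.Alg,
      IsUnipotent (A.low (fun y => (x.symm y).rank) 6) (sheetDeg m) G ∧
      IsUnipotent (A.low (fun y => (x.symm y).rank) 6) (sheetDeg m) H ∧
      (G * cellMat X f * H).map A.diff = vertexM 1 1 * (G * cellMat X f * H) +
        (G * cellMat X f * H) * vertexM 1 1 + (1 + boundaryMat X f) := by
  have h := (hA.cell f).normal_form (hA.isUnipotent_edgeMat f) (hA.map_edgeMat f)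
    (hA.map_vertexMat f) (isStrictUpper_vertexMat X f) (hA.isHomogMatrix_vertexMat f)
    (isStrictUpper_cellMat X f) (hA.isHomogMatrix_cellMat f) (pentagonPath_eq_boundaryMat X f)
  have e : vertexMat X f 4 = vertexM 1 1 := by cases f <;> rfl
  rwa [e] at h

/-- The correction of `c13` involves only generators of rank at most 5, that is edges, `c12` and
`c23`. The correction of `c14` may also contain `c13` and `c24`, hence the bound 8. -/
theorem cell_form (f : Bool) :
    A.diff (X (c12 f)) = boundaryMat X f 0 1 ∧ A.diff (X (c34 f)) = boundaryMat X f 2 3 ∧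
    ∃ u13 ∈ A.low (fun y => (x.symm y).rank) 6, ∃ u24 ∈ A.low (fun y => (x.symm y).rank) 6,
      ∃ u14 ∈ A.low (fun y => (x.symm y).rank) 8, u13 ∈ A.homog 2 ∧ u24 ∈ A.homog 2 ∧
      u14 ∈ A.homog 3 ∧ A.diff (X (c13 f) + u13) = X (c23 f) + boundaryMat X f 0 2 ∧
      A.diff (X (c14 f) + u14) = (X (c24 f) + u24) + (X (c13 f) + u13) + boundaryMat X f 0 3 := by
  obtain ⟨-, -, G, H, hG, hH, h⟩ := hA.cell_normal_form f
  obtain ⟨h1, h2, u, hu, u', hu', u'', hu'', k, k', k'', e, e'⟩ :=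
    exists_cell_form hG hH (isStrictUpper_cellMat X f) (hA.isHomogMatrix_cellMat f) h le_rfl
      (low_mono (show 6 ≤ 8 by decide)) (hA.mem_low (g := c12 f) (by simp [rank]))
      (hA.mem_low (g := c23 f) (by simp [rank])) (hA.mem_low (g := c34 f) (by simp [rank]))
      (hA.mem_low (g := c13 f) (by simp [rank])) (hA.mem_low (g := c24 f) (by simp [rank]))
  refine ⟨h1, h2, u, hu, u', hu', u'', hu'', ?_, ?_, ?_, e, e'⟩
  · convert k using 2
    simp [sheetDeg]
    norm_num
  · convert k' using 2
    simp [sheetDeg]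
    norm_num
  · convert k'' using 2
    simp [sheetDeg]
    norm_num

theorem isDGA : A.IsDGA := by
  have h0 := hA.diff_a
  have h1 (g : SphereGen) (d : ZMod m) (hd : d = 1) (hg : g.deg = 1) : X g ∈ A.homog d :=
    hA.mem_homog (by rw [hg, hd]; simp)
  have ha1 : X a1 ∈ A.homog 0 := hA.mem_homog (by simp [SphereGen.deg])
  have ha2 : X a2 ∈ A.homog 0 := hA.mem_homog (by simp [SphereGen.deg])
  have hc (f : Bool) := hA.cell_normal_form f
  have hdeg : ∀ g, A.diff (X g) ∈ A.homog (((g.deg - 1 : ℤ)) : ZMod m) := by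
    intro g
    cases g with
    | a1 => rw [hA.diff_a.1]; exact zero_mem _
    | a2 => rw [hA.diff_a.2]; exact zero_mem _
    | b1 => simpa [hA.diff_b1, SphereGen.deg] using add_mem ha1 A.one_mem_homog
    | b2 => simpa [hA.diff_b2, SphereGen.deg] using add_mem ha1 A.one_mem_homog
    | b3 => simpa [hA.diff_b3, SphereGen.deg] using add_mem A.one_mem_homog ha2
    | b4 => simpa [hA.diff_b4, SphereGen.deg] using add_mem A.one_mem_homog ha2
    | p => simpa [hA.diff_p, SphereGen.deg] using add_mem ha2 A.one_mem_homog
    | q => simpa [hA.diff_q, SphereGen.deg] using add_mem ha2 A.one_mem_homog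
    | s => simpa [hA.diff_s, SphereGen.deg] using add_mem A.one_mem_homog ha1
    | t => simpa [hA.diff_t, SphereGen.deg] using add_mem A.one_mem_homog ha1
    | r =>
      rw [hA.diff_r]
      have k1 := A.mul_mem_homog ha2 (add_mem (h1 s 1 rfl rfl) (h1 t 1 rfl rfl))
      have k2 := A.mul_mem_homog (add_mem (h1 p 1 rfl rfl) (h1 q 1 rfl rfl)) ha1
      rw [zero_add] at k1
      rw [add_zero] at k2
      simpa [SphereGen.deg] using add_mem k1 k2
    | o1 =>
      rw [hA.diff_o1]
      exact add_mem (h1 _ _ (by simp [SphereGen.deg]) rfl) (h1 _ _ (by simp [SphereGen.deg]) rfl)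
    | o2 =>
      rw [hA.diff_o2]
      exact add_mem (h1 _ _ (by simp [SphereGen.deg]) rfl) (h1 _ _ (by simp [SphereGen.deg]) rfl)
    | c12 f => simpa [sheetDeg, SphereGen.deg, cellMat] using (hc f).2.1 0 1
    | c13 f => simpa [sheetDeg, SphereGen.deg, cellMat] using (hc f).2.1 0 2
    | c14 f =>
      have := (hc f).2.1 0 3
      simp [sheetDeg, SphereGen.deg, cellMat] at this ⊢
      convert this using 2
      norm_num
    | c23 f => simpa [sheetDeg, SphereGen.deg, cellMat] using (hc f).2.1 1 2
    | c24 f => simpa [sheetDeg, SphereGen.deg, cellMat] using (hc f).2.1 1 3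
    | c34 f => simpa [sheetDeg, SphereGen.deg, cellMat] using (hc f).2.1 2 3
  have hdd : ∀ g, A.diff (A.diff (X g)) = 0 := by
    have hz : ∀ f i j, A.diff (A.diff (cellMat X f i j)) = 0 := fun f i j =>
      congrFun (congrFun (hc f).1 i) j
    intro g
    cases g with
    | r =>
      rw [hA.diff_r]
      simp only [map_add, diff_mul, h0.1, h0.2, hA.diff_s, hA.diff_t, hA.diff_p, hA.diff_q]
      rw [add_comm 1 (X a1), A.add_self, A.add_self]
      simp
    | c12 f => exact hz f 0 1
    | c13 f => exact hz f 0 2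
    | c14 f => exact hz f 0 3
    | c23 f => exact hz f 1 2
    | c24 f => exact hz f 1 3
    | c34 f => exact hz f 2 3
    | _ =>
      simp [h0.1, h0.2, hA.diff_b1, hA.diff_b2, hA.diff_b3, hA.diff_b4, hA.diff_p, hA.diff_q,
        hA.diff_s, hA.diff_t, hA.diff_o1, hA.diff_o2, A.diff_one, A.add_self]
  refine A.isDGA_of_gen (x.surjective.forall.2 fun g => ?_) (x.surjective.forall.2 fun g => ?_)
  · rw [← diff_gen, hA.gen_eq, hA.deg_eq]
    simpa using hdeg g
  · rw [← diff_gen, hA.gen_eq]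
    exact hdd g

end IsSphereModel
end BasedAlg
end LegendrianDGA

/-! ### Cancellation of the generators -/

namespace LegendrianDGA
namespace BasedAlg
namespace IsSphereModel

open SphereGen

variable {m : ℕ} {A : BasedAlg m} {x : SphereGen ≃ A.Gen} {X : SphereGen → A.Alg}
  (hA : IsSphereModel A x X)
include hA

theorem boundaryMat_mem_homog (f : Bool) :
    boundaryMat X f 0 2 ∈ A.homog 1 ∧ boundaryMat X f 0 3 ∈ A.homog 2 := by
  have h1 (g : SphereGen) (hg : g.deg = 1) : X g ∈ A.homog 1 := hA.mem_homog (by rw [hg]; simp)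
  have h2 : X r ∈ A.homog 2 := hA.mem_homog (by simp [SphereGen.deg])
  have hm {a b : A.Alg} (ha : a ∈ A.homog 1) (hb : b ∈ A.homog 1) : a * b ∈ A.homog 2 := by
    have := A.mul_mem_homog ha hb
    rwa [one_add_one_eq_two] at this
  cases f
  exacts [⟨add_mem (h1 q rfl) (h1 p rfl), add_mem (add_mem h2 (hm (h1 b4 rfl)
      (add_mem (h1 t rfl) (h1 s rfl)))) (hm (add_mem (h1 q rfl) (h1 p rfl)) (h1 b2 rfl))⟩,
    ⟨add_mem (h1 p rfl) (h1 q rfl), add_mem (add_mem h2 (hm (h1 b3 rfl)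
      (add_mem (h1 s rfl) (h1 t rfl)))) (hm (add_mem (h1 p rfl) (h1 q rfl)) (h1 b1 rfl))⟩]

/-- The bounds 5 and 7 are the ranks of `c23` and `c24`, whose shifts contain these entries. -/
theorem boundaryMat_mem_low (f : Bool) :
    boundaryMat X f 0 2 ∈ A.low (fun y => (x.symm y).rank) 5 ∧
      boundaryMat X f 0 3 ∈ A.low (fun y => (x.symm y).rank) 7 := by
  have h1 (g : SphereGen) (n : ℕ) (hg : g.rank < n) := hA.mem_low hg
  cases f
  exacts [⟨add_mem (h1 q 5 (by decide)) (h1 p 5 (by decide)),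
      add_mem (add_mem (h1 r 7 (by decide)) (mul_mem (h1 b4 7 (by decide))
        (add_mem (h1 t 7 (by decide)) (h1 s 7 (by decide))))) (mul_mem
        (add_mem (h1 q 7 (by decide)) (h1 p 7 (by decide))) (h1 b2 7 (by decide)))⟩,
    ⟨add_mem (h1 p 5 (by decide)) (h1 q 5 (by decide)),
      add_mem (add_mem (h1 r 7 (by decide)) (mul_mem (h1 b3 7 (by decide))
        (add_mem (h1 s 7 (by decide)) (h1 t 7 (by decide))))) (mul_mem
        (add_mem (h1 p 7 (by decide)) (h1 q 7 (by decide))) (h1 b1 7 (by decide)))⟩]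

-- The second member of each pair is shifted so that it becomes the differential of the shifted
-- first member. For `c24` this requires the already corrected `c13`, which explains the order of
-- the ranks.
set_option maxRecDepth 4000 in
theorem stableTameIso_single : A.StableTameIso (single 2) := by
  choose d12 d34 u13 hu13 u24 hu24 u14 hu14 k13 k24 k14 d13 d14 using hA.cell_form
  set v : SphereGen → A.Alg := shift X u13 u24 u14 with hv
  have hl (g : SphereGen) (n : ℕ) (hg : g.rank < n) := hA.mem_low hg
  have hh (g : SphereGen) (d : ZMod m) (hd : (g.deg : ZMod m) = d) := hA.mem_homog hd
  have hlow : ∀ g, v g ∈ A.low (fun y => (x.symm y).rank) g.rank := by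
    intro g
    cases g with
    | a1 => exact one_mem _
    | a2 => exact one_mem _
    | b1 => exact zero_mem _
    | b2 => exact hl b1 2 (by decide)
    | b3 => exact zero_mem _
    | b4 => exact hl b3 2 (by decide)
    | p => exact hl b3 3 (by decide)
    | q => exact hl b4 3 (by decide)
    | r =>
      exact add_mem (mul_mem (hl a2 5 (by decide)) (add_mem (add_mem (hl (c34 true) 5 (by decide))
        (hl (c34 false) 5 (by decide))) (hl o1 5 (by decide))))
        (mul_mem (add_mem (add_mem (hl (c12 true) 5 (by decide))
        (hl (c12 false) 5 (by decide))) (hl o2 5 (by decide))) (hl a1 5 (by decide)))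
    | s => exact hl b2 3 (by decide)
    | t => exact hl b1 3 (by decide)
    | o1 => exact zero_mem _
    | o2 => exact zero_mem _
    | c12 f => exact zero_mem _
    | c13 f => exact hu13 f
    | c14 f => exact hu14 f
    | c23 f => exact (hA.boundaryMat_mem_low f).1
    | c24 f =>
      exact add_mem (add_mem (low_mono (show 6 ≤ 7 by decide) (hu24 f)) (add_mem
        (hl (c13 f) 7 (by simp [rank])) (low_mono (show 6 ≤ 7 by decide) (hu13 f))))
        (hA.boundaryMat_mem_low f).2
    | c34 f => exact zero_mem _
  have hhom : ∀ g, v g ∈ A.homog (g.deg : ZMod m) := by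
    intro g
    cases g with
    | a1 => simpa [hv, shift, SphereGen.deg] using A.one_mem_homog
    | a2 => simpa [hv, shift, SphereGen.deg] using A.one_mem_homog
    | b1 => exact zero_mem _
    | b2 => exact hh b1 _ rfl
    | b3 => exact zero_mem _
    | b4 => exact hh b3 _ rfl
    | p => exact hh b3 _ rfl
    | q => exact hh b4 _ rfl
    | r =>
      have h1 := A.mul_mem_homog (hh a2 0 (by simp [SphereGen.deg])) (add_mem (add_mem
        (hh (c34 true) 2 (by simp [SphereGen.deg])) (hh (c34 false) 2 (by simp [SphereGen.deg])))
        (hh o1 2 (by simp [SphereGen.deg])))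
      have h2 := A.mul_mem_homog (add_mem (add_mem
        (hh (c12 true) 2 (by simp [SphereGen.deg])) (hh (c12 false) 2 (by simp [SphereGen.deg])))
        (hh o2 2 (by simp [SphereGen.deg]))) (hh a1 0 (by simp [SphereGen.deg]))
      rw [zero_add] at h1
      rw [add_zero] at h2
      simpa [hv, shift, SphereGen.deg] using add_mem h1 h2
    | s => exact hh b2 _ rfl
    | t => exact hh b1 _ rfl
    | o1 => exact zero_mem _
    | o2 => exact zero_mem _
    | c12 f => exact zero_mem _
    | c13 f => simpa [hv, shift, SphereGen.deg] using k13 f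
    | c14 f => simpa [hv, shift, SphereGen.deg] using k14 f
    | c23 f => simpa [hv, shift, SphereGen.deg] using (hA.boundaryMat_mem_homog f).1
    | c24 f =>
      have := add_mem (add_mem (k24 f) (add_mem (hh (c13 f) 2 (by simp [SphereGen.deg])) (k13 f)))
        (hA.boundaryMat_mem_homog f).2
      simpa [hv, shift, SphereGen.deg] using this
    | c34 f => exact zero_mem _
  have hθ := triangular_mem_closure (fun y => (x.symm y).rank) (fun y => v (x.symm y))
    (x.surjective.forall.2 fun g => by simpa using hlow g)
    (x.surjective.forall.2 fun g => by simpa [hA.deg_eq] using hhom g)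
  have θ_gen (g : SphereGen) : FreeAlgebra.lift (ZMod 2) (fun y => A.gen y + v (x.symm y))
      (A.gen (x g)) = X g + v g := by
    rw [← hA.gen_eq g]
    exact (FreeAlgebra.lift_ι_apply _ _).trans (by rw [x.symm_apply_apply])
  have h2 : A.deg (x r) = 2 := by simp [hA.deg_eq, SphereGen.deg]
  rw [← h2]
  refine A.stableTameIso_single hA.isDGA hθ (x r) (pairs.map fun e => (x e.1, x e.2)) ?_
    (x.surjective.forall.2 fun g => ?_) ?_ ?_ ?_
  · rw [← Nat.card_congr x, Nat.card_eq_fintype_card]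
    rfl
  · have : ∀ g : SphereGen, g = r ∨ ∃ e ∈ pairs, g = e.1 ∨ g = e.2 := by decide
    rcases this g with rfl | ⟨e, he, h⟩
    · exact Or.inl rfl
    · exact Or.inr ⟨_, List.mem_map_of_mem he, h.imp (congrArg x) (congrArg x)⟩
  · have : ∀ e ∈ pairs, e.2.deg = e.1.deg - 1 := by decide
    simp only [List.mem_map]
    rintro _ ⟨e, he, rfl⟩
    simp [hA.deg_eq, this e he]
  · rw [θ_gen]
    -- This is the differential of the bracket multiplied by `X a2` in the shift of `r`. With `h3`
    -- for the other bracket it makes the shifted `r` a cycle.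
    have h1 : boundaryMat X true 2 3 + boundaryMat X false 2 3 + (X b1 + X b2) = X s + X t := by
      have : X t + X b1 + (X s + X b2) + (X b1 + X b2) =
          X s + X t + (X b1 + X b1) + (X b2 + X b2) := by abel
      rwa [A.add_self, A.add_self, add_zero, add_zero] at this
    have h3 : boundaryMat X true 0 1 + boundaryMat X false 0 1 + (X b3 + X b4) = X p + X q := by
      have : X p + X b3 + (X q + X b4) + (X b3 + X b4) =
          X p + X q + (X b3 + X b3) + (X b4 + X b4) := by abel
      rwa [A.add_self, A.add_self, add_zero, add_zero] at this
    simp only [hv, shift, map_add, diff_mul, hA.diff_r, hA.diff_a.1, hA.diff_a.2, d12, d34,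
      hA.diff_o1, hA.diff_o2, zero_mul, zero_add, mul_zero, add_zero, h1, h3, A.add_self]
  · simp only [List.mem_map]
    rintro _ ⟨e, he, rfl⟩
    rw [θ_gen, θ_gen]
    have h : ∀ f : Bool, A.diff (X (c13 f) + v (c13 f)) = X (c23 f) + v (c23 f) ∧
        A.diff (X (c14 f) + v (c14 f)) = X (c24 f) + v (c24 f) := by
      refine fun f => ⟨d13 f, (d14 f).trans ?_⟩
      simp only [hv, shift, add_assoc]
    simp only [pairs, List.mem_cons, List.not_mem_nil, or_false] at he
    rcases he with rfl | rfl | rfl | rfl | rfl | rfl | rfl | rfl | rfl | rfl | rfl | rfl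
    exacts [by simp [hv, shift, hA.diff_b1], by simp [hv, shift, hA.diff_o1, add_comm],
      by simp [hv, shift, hA.diff_b3, add_comm], by simp [hv, shift, hA.diff_o2, add_comm],
      by simpa [hv, shift, boundaryMat, arcM] using d12 true, by simpa [hv, shift, boundaryMat, arcM] using d12 false,
      by simpa [hv, shift, boundaryMat, arcM] using d34 true, by simpa [hv, shift, boundaryMat, arcM] using d34 false,
      (h false).1, (h true).1, (h false).2, (h true).2]

end IsSphereModel
end BasedAlg
end LegendrianDGA

/-! ### Identification of the cellular DGA with the model -/

namespace LegendrianDGA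
open Front ExV ExE ExF

/-- The generators of the cellular DGA of the two-swallowtail sphere. -/
def sphereGen : SphereGen → Sphere.CellGen
  | .a1 => .inl ⟨A1, ((0 : Fin 2), (1 : Fin 2)), by decide⟩
  | .a2 => .inl ⟨A2, ((0 : Fin 2), (1 : Fin 2)), by decide⟩
  | .b1 => .inr (.inl ⟨B1, ((1 : Fin 3), (2 : Fin 3)), by decide⟩)
  | .b2 => .inr (.inl ⟨B2, ((1 : Fin 3), (2 : Fin 3)), by decide⟩)
  | .b3 => .inr (.inl ⟨B3, ((0 : Fin 3), (1 : Fin 3)), by decide⟩)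
  | .b4 => .inr (.inl ⟨B4, ((0 : Fin 3), (1 : Fin 3)), by decide⟩)
  | .p => .inr (.inl ⟨B5, ((0 : Fin 4), (1 : Fin 4)), by decide⟩)
  | .q => .inr (.inl ⟨B5, ((0 : Fin 4), (2 : Fin 4)), by decide⟩)
  | .r => .inr (.inl ⟨B5, ((0 : Fin 4), (3 : Fin 4)), by decide⟩)
  | .s => .inr (.inl ⟨B5, ((1 : Fin 4), (3 : Fin 4)), by decide⟩)
  | .t => .inr (.inl ⟨B5, ((2 : Fin 4), (3 : Fin 4)), by decide⟩)
  | .o1 => .inr (.inr ⟨C1, ((0 : Fin 2), (1 : Fin 2)), by decide⟩)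
  | .o2 => .inr (.inr ⟨C2, ((0 : Fin 2), (1 : Fin 2)), by decide⟩)
  | .c12 false => .inr (.inr ⟨C3, ((0 : Fin 4), (1 : Fin 4)), by decide⟩)
  | .c12 true => .inr (.inr ⟨C4, ((0 : Fin 4), (1 : Fin 4)), by decide⟩)
  | .c13 false => .inr (.inr ⟨C3, ((0 : Fin 4), (2 : Fin 4)), by decide⟩)
  | .c13 true => .inr (.inr ⟨C4, ((0 : Fin 4), (2 : Fin 4)), by decide⟩)
  | .c14 false => .inr (.inr ⟨C3, ((0 : Fin 4), (3 : Fin 4)), by decide⟩)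
  | .c14 true => .inr (.inr ⟨C4, ((0 : Fin 4), (3 : Fin 4)), by decide⟩)
  | .c23 false => .inr (.inr ⟨C3, ((1 : Fin 4), (2 : Fin 4)), by decide⟩)
  | .c23 true => .inr (.inr ⟨C4, ((1 : Fin 4), (2 : Fin 4)), by decide⟩)
  | .c24 false => .inr (.inr ⟨C3, ((1 : Fin 4), (3 : Fin 4)), by decide⟩)
  | .c24 true => .inr (.inr ⟨C4, ((1 : Fin 4), (3 : Fin 4)), by decide⟩)
  | .c34 false => .inr (.inr ⟨C3, ((2 : Fin 4), (3 : Fin 4)), by decide⟩)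
  | .c34 true => .inr (.inr ⟨C4, ((2 : Fin 4), (3 : Fin 4)), by decide⟩)

set_option maxRecDepth 10000 in
set_option synthInstance.maxHeartbeats 200000 in
set_option synthInstance.maxSize 1000 in
theorem sphereGen_bijective : Function.Bijective sphereGen := by
  rw [Fintype.bijective_iff_injective_and_card]
  exact ⟨show ∀ g g', sphereGen g = sphereGen g' → g = g' by decide, rfl⟩

/-- The generators, as elements of the cellular DGA. -/
noncomputable def sphereElt (g : SphereGen) : Sphere.CellAlg := FreeAlgebra.ι (ZMod 2) (sphereGen g)

section

variable (μ : Sphere.MaslovPotential) (χ : Sphere.Choices)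

theorem deg_sphereGen (g : SphereGen) : (cellularDGA μ χ).deg (sphereGen g) = (g.deg : ZMod _) := by
  obtain ⟨k, h3, h4, h5, h1, h2, ha1, ha2, hb1, hb2, hb3, hb4⟩ := maslovPotential_eq μ
  have key {x y u v d : ZMod Sphere.maslovNumber} (n : ℤ) (hx : x = u) (hy : y = v)
      (h : u - v + d = n) : x - y + d = n := by rw [hx, hy, h]
  have key' {x y u v : ZMod Sphere.maslovNumber} (n : ℤ) (hx : x = u) (hy : y = v)
      (h : u - v = n) : x - y = n := by rw [hx, hy, h]
  have key'' {x y u v d : ZMod Sphere.maslovNumber} (n : ℤ) (hx : x = u) (hy : y = v)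
      (h : u - v - d = n) : x - y - d = n := by rw [hx, hy, h]
  cases g with
  | a1 => exact key'' 0 (ha1 (0 : Fin 2)) (ha1 (1 : Fin 2)) (by simp)
  | a2 => exact key'' 0 (ha2 (0 : Fin 2)) (ha2 (1 : Fin 2)) (by simp)
  | b1 => exact key' 1 hb1.1 hb1.2 (by simp)
  | b2 => exact key' 1 hb2.1 hb2.2 (by simp)
  | b3 => exact key' 1 hb3.1 hb3.2 (by simp)
  | b4 => exact key' 1 hb4.1 hb4.2 (by simp)
  | p => exact key' 1 (h5 (0 : Fin 4)) (h5 (1 : Fin 4)) (by simp)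
  | q => exact key' 1 (h5 (0 : Fin 4)) (h5 (2 : Fin 4)) (by simp)
  | r => exact key' 2 (h5 (0 : Fin 4)) (h5 (3 : Fin 4)) (by simp; ring)
  | s => exact key' 1 (h5 (1 : Fin 4)) (h5 (3 : Fin 4)) (by simp)
  | t => exact key' 1 (h5 (2 : Fin 4)) (h5 (3 : Fin 4)) (by simp)
  | o1 => exact key 2 (h1 (0 : Fin 2)) (h1 (1 : Fin 2)) (by simp; ring)
  | o2 => exact key 2 (h2 (0 : Fin 2)) (h2 (1 : Fin 2)) (by simp; ring)
  | c12 f =>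
    cases f
    exacts [key 2 (h3 (0 : Fin 4)) (h3 (1 : Fin 4)) (by simp; ring),
      key 2 (h4 (0 : Fin 4)) (h4 (1 : Fin 4)) (by simp; ring)]
  | c13 f =>
    cases f
    exacts [key 2 (h3 (0 : Fin 4)) (h3 (2 : Fin 4)) (by simp; ring),
      key 2 (h4 (0 : Fin 4)) (h4 (2 : Fin 4)) (by simp; ring)]
  | c14 f =>
    cases f
    exacts [key 3 (h3 (0 : Fin 4)) (h3 (3 : Fin 4)) (by simp; ring),
      key 3 (h4 (0 : Fin 4)) (h4 (3 : Fin 4)) (by simp; ring)]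
  | c23 f =>
    cases f
    exacts [key 1 (h3 (1 : Fin 4)) (h3 (2 : Fin 4)) (by simp),
      key 1 (h4 (1 : Fin 4)) (h4 (2 : Fin 4)) (by simp)]
  | c24 f =>
    cases f
    exacts [key 2 (h3 (1 : Fin 4)) (h3 (3 : Fin 4)) (by simp; ring),
      key 2 (h4 (1 : Fin 4)) (h4 (3 : Fin 4)) (by simp; ring)]
  | c34 f =>
    cases f
    exacts [key 2 (h3 (2 : Fin 4)) (h3 (3 : Fin 4)) (by simp; ring),
      key 2 (h4 (2 : Fin 4)) (h4 (3 : Fin 4)) (by simp; ring)]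

theorem cMat_C3 : (cMat (D := Sphere) C3 : Matrix (Fin 4) (Fin 4) Sphere.CellAlg) =
    SphereGen.cellMat sphereElt false := by
  ext i j
  fin_cases i <;> fin_cases j <;> rfl

theorem cMat_C4 : (cMat (D := Sphere) C4 : Matrix (Fin 4) (Fin 4) Sphere.CellAlg) =
    SphereGen.cellMat sphereElt true := by
  ext i j
  fin_cases i <;> fin_cases j <;> rfl

theorem pentagonRelation_C3 : BasedAlg.PentagonRelation (A := cellularDGA μ χ)
    (SphereGen.vertexMat sphereElt false) (SphereGen.edgeMat sphereElt false)
    (SphereGen.edgeDir false) (SphereGen.cellMat sphereElt false) := by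
  obtain ⟨v, w, h⟩ := dC_pentagon χ C3 qEdges_C3 (yMat_C3 χ) (qvMat_C3 χ) qDir_C3
  rw [cMat_C3] at h
  refine ⟨v, w, χ.full C3, fun i j hij => ?_⟩
  -- Above the diagonal the entries are generators, so the differential can be read off from `dC`.
  have e : SphereGen.cellMat sphereElt false i j =
      FreeAlgebra.ι (ZMod 2) (Sum.inr (Sum.inr ⟨C3, (i, j), hij⟩)) := by
    revert hij
    fin_cases i <;> fin_cases j <;> first | exact fun _ => rfl | exact fun h => absurd h (by decide)
  refine (congrArg (cellularDGA μ χ).diff e).trans (((cellularDGA μ χ).diff_gen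
    (Sum.inr (Sum.inr ⟨C3, (i, j), hij⟩))).trans ((congrFun (congrFun h i) j).trans ?_))
  rfl

theorem pentagonRelation_C4 : BasedAlg.PentagonRelation (A := cellularDGA μ χ)
    (SphereGen.vertexMat sphereElt true) (SphereGen.edgeMat sphereElt true)
    (SphereGen.edgeDir true) (SphereGen.cellMat sphereElt true) := by
  obtain ⟨v, w, h⟩ := dC_pentagon χ C4 qEdges_C4 (yMat_C4 χ) (qvMat_C4 χ) qDir_C4
  rw [cMat_C4] at h
  refine ⟨v, w, χ.full C4, fun i j hij => ?_⟩
  have e : SphereGen.cellMat sphereElt true i j =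
      FreeAlgebra.ι (ZMod 2) (Sum.inr (Sum.inr ⟨C4, (i, j), hij⟩)) := by
    revert hij
    fin_cases i <;> fin_cases j <;> first | exact fun _ => rfl | exact fun h => absurd h (by decide)
  refine (congrArg (cellularDGA μ χ).diff e).trans (((cellularDGA μ χ).diff_gen
    (Sum.inr (Sum.inr ⟨C4, (i, j), hij⟩))).trans ((congrFun (congrFun h i) j).trans ?_))
  rfl

theorem isSphereModel : BasedAlg.IsSphereModel (cellularDGA μ χ)
    (Equiv.ofBijective sphereGen sphereGen_bijective) sphereElt where
  gen_eq _ := rfl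
  deg_eq := deg_sphereGen μ χ
  diff_a := diff_vGen χ μ
  diff_b1 := diff_cuspGen_B1 χ μ
  diff_b2 := diff_cuspGen_B2 χ μ
  diff_b3 := diff_cuspGen_B3 χ μ
  diff_b4 := diff_cuspGen_B4 χ μ
  diff_p := (diff_arcGen χ μ).1
  diff_q := (diff_arcGen χ μ).2.1
  diff_s := (diff_arcGen χ μ).2.2.1
  diff_t := (diff_arcGen χ μ).2.2.2.1
  diff_r := (diff_arcGen χ μ).2.2.2.2
  diff_o1 := (diff_outerGen χ μ).1
  diff_o2 := (diff_outerGen χ μ).2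
  cell f := by
    cases f
    exacts [pentagonRelation_C3 μ χ, pentagonRelation_C4 μ χ]

end
end LegendrianDGA

theorem mainTheorem12 :
    LegendrianDGA.swallowtailSphere.maslovNumber = 0 ∧
    Nonempty LegendrianDGA.swallowtailSphere.MaslovPotential ∧
    Nonempty LegendrianDGA.swallowtailSphere.Choices ∧
    Nat.card LegendrianDGA.swallowtailSphere.CellGen = 25 ∧
    ∀ (μ : LegendrianDGA.swallowtailSphere.MaslovPotential)
      (χ : LegendrianDGA.swallowtailSphere.Choices),
      (LegendrianDGA.Front.cellularDGA μ χ).IsDGA ∧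
      (LegendrianDGA.Front.cellularDGA μ χ).StableTameIso (LegendrianDGA.BasedAlg.single 2) := by
  exact ⟨LegendrianDGA.maslovNumber_sphere, LegendrianDGA.nonempty_maslovPotential,
    LegendrianDGA.nonempty_choices, LegendrianDGA.card_cellGen, fun μ χ =>
      ⟨(LegendrianDGA.isSphereModel μ χ).isDGA,
        (LegendrianDGA.isSphereModel μ χ).stableTameIso_single⟩⟩
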